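/- Consider a leader $\dot w=Sw+dv(t)$, $y_r=w_1$, with $w\in\mathbb R^{n}$ $(n\ge 1)$, where $S$ is the companion matrix with ones above the diagonal and last row $(s_1,\dots,s_n)$, $d=(0,\dots,0,d_n)^\top$, and $v:[0,\infty)\to\mathbb R$ is continuous and bounded, and $N$ followers $$\dot z_i=A_i^0z_i+f_i(x_i),\quad \dot x_{i1}=x_{i2},\ \dots,\ \dot x_{in_i}=u_i+g_i(z_i,x_i),\quad y_i=x_{i1},$$ with $A_i^0$ Hurwitz, $f_i,g_i$ infinitely differentiable and $n_i\ge1$. Let the nodes $0$ (leader), $1,\dots,N$ be joined by a weighted digraph with weights $a_{ij}\ge0$, $a_{ii}=0$ ($a_{ij}>0$ iff there is an edge from $j$ to $i$), and assume: 1. (connectedness) $a_{0j}=0$ for all $j$, $a_{ij}=a_{ji}$ for $i,j\ge1$, and there is a directed path from node $0$ to every other node; 2. (relative degree) $n_i\le n$ for all $i$; 3. (Lipschitz property) there is $M>0$ with $|g_i(z+\Delta,x)-g_i(z,x)|\le M\|\Delta\|$ for all $i,z,\Delta,x$. For a positive definite $P$ with $S^\top P+PS<2Pdd^\top P$, consider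 the fully distributed adaptive controller $$\begin{aligned}u_i&=-g_i(\xi_i,x_i)+x_{i(n_i+1)},\qquad \dot x_{i(n_i+1)}=x_{i(n_i+2)},\ \dots,\\ \dot x_{in}&=\sum_{j=1}^{n}s_jx_{ij}-d_n\theta_i\,d^\top P\hat x_{vi}-d_n\theta_i\,\mathrm{sgn}(d^\top P\hat x_{vi}),\\ \dot\theta_i&=\|d^\top P\hat x_{vi}\|_2^2+\|d^\top P\hat x_{vi}\|_1,\qquad \dot\xi_i=A_i^0\xi_i+f_i(x_i),\end{aligned}$$ where $\hat x_i=(x_{i1},\dots,x_{in})^\top$, $\hat x_0=w$, $\hat x_{vi}=\sum_{j=0}^Na_{ij}(\hat x_i-\hat x_j)$ (if $n_i=n$ there are no compensator states $x_{ij}$, and $x_{i(n_i+1)}$ in $u_i$ stands for the right-hand side of the equation for $\dot x_{in}$). It uses neither $v$, nor a bound on $v$, nor the eigenvalues of the matrix obtained from the graph Laplacian by deleting the row and column of node $0$. If $d_n\ne0$, then such a matrix $P$ exists. For every such $P$ and every continuous bounded $v$, the following hold for the closed loop, whose solutions are understood in the sense of Filippov: * from every initial state of $(z_i,x_i,\theta_i,\xi_i,w)$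 and of the compensator states there is a solution on $[0,\infty)$, and every solution on a bounded interval $[0,T)$ extends to $[0,\infty)$; * along every solution on $[0,\infty)$, the errors $\hat x_i-w$ and $\xi_i-z_i$ and the gains $\theta_i$ are bounded, the tracking errors $e_i=y_i-y_r$ tend to $0$ as $t\to\infty$, and each $\theta_i(t)$ converges to a finite value. -/

import Mathlib

open MeasureTheory Set Filter Topology Matrix

namespace Coord

noncomputable section

/-! ## Filippov solutions -/

section Filippov

variable {E : Type*} [NormedAddCommGroup E] [NormedSpace ℝ E] [MeasureSpace E]

/-- Filippov's set-valued regularization at the point `p` and time `t` of a time-dependent vector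
field: the intersection, over all `δ > 0` and all null sets `N`, of the closed convex hull of the
values on `B(p, δ) \ N`.  (On a finite-dimensional space with a Lebesgue measure it does not
depend on which of the equivalent norms defines the balls.) -/
def filippovSet (F : ℝ → E → E) (t : ℝ) (p : E) : Set E :=
  ⋂ (δ : ℝ) (_ : 0 < δ) (N : Set E) (_ : (volume : Measure E) N = 0),
    closure (convexHull ℝ (F t '' (Metric.ball p δ \ N)))

/-- Filippov solution of `ẋ = F(t, x)` on the compact interval `[t₀, t₁]`: an absolutely continuous
curve whose derivative exists and lies in the Filippov set at almost every time. -/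
def IsFilippovSolution (F : ℝ → E → E) (t₀ t₁ : ℝ) (γ : ℝ → E) : Prop :=
  AbsolutelyContinuousOnInterval γ t₀ t₁ ∧
    ∀ᵐ t : ℝ, t ∈ Icc t₀ t₁ → ∃ γ' ∈ filippovSet F t (γ t), HasDerivAt γ γ' t

/-- Filippov solution on `[0, T)`. -/
def IsFilippovSolutionUpTo (F : ℝ → E → E) (T : ℝ) (γ : ℝ → E) : Prop :=
  ∀ τ, 0 < τ → τ < T → IsFilippovSolution F 0 τ γ

/-- Filippov solution on `[0, ∞)`. -/
def IsGlobalFilippovSolution (F : ℝ → E → E) (γ : ℝ → E) : Prop :=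
  ∀ τ, 0 < τ → IsFilippovSolution F 0 τ γ

end Filippov

/-! ## The leader -/

/-- A real square matrix is Hurwitz if all its complex eigenvalues have negative real part. -/
def IsHurwitz {m : ℕ} (A : Matrix (Fin m) (Fin m) ℝ) : Prop :=
  ∀ μ ∈ spectrum ℂ (A.map (fun r : ℝ => (r : ℂ))), μ.re < 0

/-- The data of the leader `ẇ = S w + d v`, `y_r = w₁`, in companion form: the last row `s` of
`S` and the last entry `dLast` of `d`. -/
structure Leader (n : ℕ) where
  s : Fin n → ℝ
  dLast : ℝ

namespace Leader

variable {n : ℕ} (L : Leader n)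

/-- The companion matrix: ones above the diagonal, last row `s`. -/
def S : Matrix (Fin n) (Fin n) ℝ :=
  Matrix.of fun k j =>
    if (k : ℕ) + 1 = n then L.s j else if (j : ℕ) = (k : ℕ) + 1 then 1 else 0

/-- The input vector `d = (0, …, 0, dLast)`. -/
def d : Fin n → ℝ := fun k => if (k : ℕ) + 1 = n then L.dLast else 0

/-- `ẇ = S w + d v`. -/
def field (v : ℝ) (w : EuclideanSpace ℝ (Fin n)) : EuclideanSpace ℝ (Fin n) :=
  WithLp.toLp 2 (L.S *ᵥ w.ofLp + v • L.d)

/-- `P` is positive definite and `Sᵀ P + P S < 2 P d dᵀ P`. -/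
def Admissible (P : Matrix (Fin n) (Fin n) ℝ) : Prop :=
  P.PosDef ∧
    ((2 : ℝ) • (P * Matrix.vecMulVec L.d L.d * P) - (L.Sᵀ * P + P * L.S)).PosDef

end Leader

/-! ## The followers -/

/-- The data of the `N` followers
`ż = A⁰ z + f(x)`, `ẋ₁ = x₂`, …, `ẋ_{nx} = u + g(z, x)`, `y = x₁`. -/
structure Followers (N : ℕ) where
  nz : Fin N → ℕ
  nx : Fin N → ℕ
  A0 : ∀ i, Matrix (Fin (nz i)) (Fin (nz i)) ℝ
  f : ∀ i, EuclideanSpace ℝ (Fin (nx i)) → EuclideanSpace ℝ (Fin (nz i))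
  g : ∀ i, EuclideanSpace ℝ (Fin (nz i)) → EuclideanSpace ℝ (Fin (nx i)) → ℝ

namespace Followers

variable {N : ℕ} (A : Followers N)

/-- `A⁰ z + f(x)`. -/
def zField (i : Fin N) (z : EuclideanSpace ℝ (Fin (A.nz i)))
    (x : EuclideanSpace ℝ (Fin (A.nx i))) : EuclideanSpace ℝ (Fin (A.nz i)) :=
  WithLp.toLp 2 (A.A0 i *ᵥ z.ofLp) + A.f i x

/-- The chain of integrators `ẋ₁ = x₂`, …, `ẋ_{nx} = u + g(z, x)` under the input `u`. -/
def xField (i : Fin N) (z : EuclideanSpace ℝ (Fin (A.nz i)))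
    (x : EuclideanSpace ℝ (Fin (A.nx i))) (u : ℝ) : EuclideanSpace ℝ (Fin (A.nx i)) :=
  WithLp.toLp 2 fun k =>
    if h : (k : ℕ) + 1 < A.nx i then x ⟨(k : ℕ) + 1, h⟩ else u + A.g i z x

end Followers

/-! ## The communication graph -/

/-- `a` is the weighted adjacency matrix (`a p q > 0` iff there is an edge from `q` to `p`) of a
connected leader-follower graph on the nodes `0, 1, …, N`: node `0` (the leader) receives nothing,
the graph induced on the followers is undirected, and there is a directed path from node `0` to
each other node. -/
structure IsConnectedGraph {N : ℕ} (a : Matrix (Fin (N + 1)) (Fin (N + 1)) ℝ) : Prop where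
  nonneg : ∀ p q, 0 ≤ a p q
  no_loop : ∀ p, a p p = 0
  leader : ∀ q, a 0 q = 0
  undirected : ∀ i j : Fin N, a i.succ j.succ = a j.succ i.succ
  connected : ∀ p, Relation.ReflTransGen (fun q r => 0 < a r q) 0 p

/-! ## The adaptive controller -/

section Controller

variable {N n : ℕ} (L : Leader n) (A : Followers N) (P : Matrix (Fin n) (Fin n) ℝ)

/-- `x̂ = (x₁, …, x_{nx}, x_{nx+1}, …, x_n)`: the state `x` of the chain of follower `i`, followed
by the compensator states `xc = (x_{nx+1}, …, x_n)`. -/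
def xhat (i : Fin N) (x : EuclideanSpace ℝ (Fin (A.nx i)))
    (xc : EuclideanSpace ℝ (Fin (n - A.nx i))) : EuclideanSpace ℝ (Fin n) :=
  WithLp.toLp 2 fun k =>
    if h : (k : ℕ) < A.nx i then x ⟨k, h⟩ else xc ⟨(k : ℕ) - A.nx i, by omega⟩

/-- The scalar `dᵀ P x̂_v`. -/
def feedback (xv : EuclideanSpace ℝ (Fin n)) : ℝ := L.d ⬝ᵥ (P *ᵥ xv.ofLp)

/-- Last line of the dynamic extension,
`∑ⱼ sⱼ x̂ⱼ - dₙ θ dᵀPx̂_v - dₙ θ sgn(dᵀPx̂_v)`. -/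
def lastLine (xh xv : EuclideanSpace ℝ (Fin n)) (θ : ℝ) : ℝ :=
  ∑ j, L.s j * xh j - L.dLast * θ * feedback L P xv
    - L.dLast * θ * Real.sign (feedback L P xv)

/-- Control input `u = -g(ξ, x) + x_{nx+1}`; when `nx = n` there is no state `x_{nx+1}`, and its
place is taken by the last line of the dynamic extension. -/
def control (i : Fin N) (x : EuclideanSpace ℝ (Fin (A.nx i)))
    (xc : EuclideanSpace ℝ (Fin (n - A.nx i))) (θ : ℝ)
    (ξ : EuclideanSpace ℝ (Fin (A.nz i))) (xv : EuclideanSpace ℝ (Fin n)) : ℝ :=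
  -A.g i ξ x +
    if h : 0 < n - A.nx i then xc ⟨0, h⟩ else lastLine L P (xhat A i x xc) xv θ

/-- Compensator chain `ẋ_{nx+1} = x_{nx+2}`, …, `ẋ_n = lastLine`. -/
def xcField (i : Fin N) (x : EuclideanSpace ℝ (Fin (A.nx i)))
    (xc : EuclideanSpace ℝ (Fin (n - A.nx i))) (θ : ℝ) (xv : EuclideanSpace ℝ (Fin n)) :
    EuclideanSpace ℝ (Fin (n - A.nx i)) :=
  WithLp.toLp 2 fun k =>
    if h : (k : ℕ) + 1 < n - A.nx i then xc ⟨(k : ℕ) + 1, h⟩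
    else lastLine L P (xhat A i x xc) xv θ

/-- Adaptation law `θ̇ = ‖dᵀPx̂_v‖₂² + ‖dᵀPx̂_v‖₁`. -/
def θField (xv : EuclideanSpace ℝ (Fin n)) : ℝ :=
  feedback L P xv ^ 2 + |feedback L P xv|

end Controller

/-! ## The closed loop -/

/-- States `(z, x, xc, θ, ξ, w)` of the closed loop. -/
abbrev State {N : ℕ} (A : Followers N) (n : ℕ) : Type :=
  (∀ i, EuclideanSpace ℝ (Fin (A.nz i))) ×
  (∀ i, EuclideanSpace ℝ (Fin (A.nx i))) ×
  (∀ i, EuclideanSpace ℝ (Fin (n - A.nx i))) ×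
  (Fin N → ℝ) ×
  (∀ i, EuclideanSpace ℝ (Fin (A.nz i))) ×
  EuclideanSpace ℝ (Fin n)

section ClosedLoop

variable {N n : ℕ} {A : Followers N}

def zOf (p : State A n) (i : Fin N) : EuclideanSpace ℝ (Fin (A.nz i)) := p.1 i

def xOf (p : State A n) (i : Fin N) : EuclideanSpace ℝ (Fin (A.nx i)) := p.2.1 i

def xcOf (p : State A n) (i : Fin N) : EuclideanSpace ℝ (Fin (n - A.nx i)) := p.2.2.1 i

def θOf (p : State A n) (i : Fin N) : ℝ := p.2.2.2.1 i

def ξOf (p : State A n) (i : Fin N) : EuclideanSpace ℝ (Fin (A.nz i)) := p.2.2.2.2.1 i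

def wOf (p : State A n) : EuclideanSpace ℝ (Fin n) := p.2.2.2.2.2

def xhatOf (p : State A n) (i : Fin N) : EuclideanSpace ℝ (Fin n) :=
  xhat A i (xOf p i) (xcOf p i)

/-- `x̂_{vi} = ∑_{j=0}^N a_{ij} (x̂_i - x̂_j)` with `x̂_0 = w`. -/
def xvOf (a : Matrix (Fin (N + 1)) (Fin (N + 1)) ℝ) (p : State A n) (i : Fin N) :
    EuclideanSpace ℝ (Fin n) :=
  a i.succ 0 • (xhatOf p i - wOf p) + ∑ j : Fin N, a i.succ j.succ • (xhatOf p i - xhatOf p j)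

/-- Followers, adaptive controllers and leader, the leader being driven by `v`. -/
def closedLoop (L : Leader n) (A : Followers N) (a : Matrix (Fin (N + 1)) (Fin (N + 1)) ℝ)
    (P : Matrix (Fin n) (Fin n) ℝ) (v : ℝ → ℝ) (t : ℝ) (p : State A n) : State A n :=
  (fun i => A.zField i (zOf p i) (xOf p i),
   fun i => A.xField i (zOf p i) (xOf p i)
     (control L A P i (xOf p i) (xcOf p i) (θOf p i) (ξOf p i) (xvOf a p i)),
   fun i => xcField L A P i (xOf p i) (xcOf p i) (θOf p i) (xvOf a p i),
   fun i => θField L P (xvOf a p i),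
   fun i => A.zField i (ξOf p i) (xOf p i),
   L.field (v t) (wOf p))

/-- Tracking error `e_i = y_i - y_r = x_{i1} - w_1`. -/
def trackingError [NeZero n] (hx : ∀ i, 1 ≤ A.nx i) (p : State A n) (i : Fin N) : ℝ :=
  xOf p i ⟨0, hx i⟩ - wOf p 0

end ClosedLoop

end

end Coord

/-!
# Tracking by a fully distributed adaptive controller

**Filippov solutions.** The closed loop is a vector field with the terms `θ i * sgn (φ i)`, where
`φ i = dᵀ P x̂_{vi}` is linear in the state. The `φ i` can be prescribed independently, because the
grounded Laplacian `H` (the Laplacian without the row and column of the leader) is invertible and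
`dᵀ P ≠ 0` unless `d = 0`, in which case the signs drop out. Hence the Filippov set at a point is
exactly the set of velocities in which each `sgn (φ i)` is replaced by some `σ i ∈ [-1, 1]` with
`σ i * φ i = |φ i|` (`SwitchedSystem.IsRegular.isFilippovSolution_iff`). Such inclusions are solved
by smoothing the signs and passing to a limit along an ultrafilter
(`SwitchedSystem.IsRegular.exists_isSolution`), provided that solutions cannot escape in finite
time; the same bound lets every solution on `[0, T)` be continued
(`SwitchedSystem.IsRegular.exists_extension`).

**Lyapunov function.** In the errors `η i = x̂ i - w` and `ε i = ξ i - z i` the closed loop reads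
`η̇ i = S η i - (θ i φ i + θ i σ i + v) d + δ i e i`, `ε̇ i = A⁰ ε i`, `θ̇ i = φ i² + |φ i|`, where
`|δ i| ≤ M ‖ε i‖` by the Lipschitz property of `g`. For Lyapunov matrices `R i` of the Hurwitz
matrices `A⁰` consider
`V = ∑ H i j η iᵀ P η j + ∑ (θ i - β)² + κ ∑ ε iᵀ R i ε i`.
The terms with `θ i` cancel against the adaptation law up to `-2 β ∑ (φ i² + |φ i|)`. For large
`β`, the part with `φ i²` makes up for the matrix `2 P d dᵀ P` of the admissibility inequality, as
`H² ≥ λ H` for some `λ > 0`, and the part with `|φ i|` absorbs the bounded input `v`. For large `κ`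
the observation errors dominate `δ`. What remains is `V̇ ≤ -c ∑ ‖η i‖²` (`exists_dissipation`).

**Conclusion.** `V` bounds the errors and gains on `[0, ∞)`. The function `∑ ‖η i‖²` is therefore
Lipschitz in time, and it is integrable since `V` is bounded below; so it tends to zero
(`exists_bound_and_tendsto_errSq`). The gains are nondecreasing and bounded, hence convergent. The
absence of finite escape has to be known for the smoothed equations as well, where `σ i * φ i` may
differ from `|φ i|`. There `V` grows at most exponentially, and `w` and `z` satisfy linear
equations with bounded forcing (`loopSystem_hasAprioriBound`).

**Admissible matrices.** If `d ≠ 0`, the last row of the companion matrix `S` can be changed at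
will by subtracting `d kᵀ`. A Lyapunov matrix of the Hurwitz companion matrix of `(X + 1) ^ n`,
scaled by a large factor, is admissible (`Leader.exists_admissible`).
-/

namespace Coord

/-! ### Absolutely continuous curves and differential inequalities -/

section AbsolutelyContinuous

open AbsolutelyContinuousOnInterval in
/-- Postcomposition with a map that is Lipschitz on the image preserves absolute continuity. -/
theorem absolutelyContinuousOnInterval_comp {X Y : Type*} [PseudoMetricSpace X]
    [PseudoMetricSpace Y] {f : ℝ → X} {a b : ℝ} (hf : AbsolutelyContinuousOnInterval f a b)
    {g : X → Y} {K : NNReal} {s : Set X} (hg : LipschitzOnWith K g s)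
    (hs : MapsTo f (uIcc a b) s) : AbsolutelyContinuousOnInterval (g ∘ f) a b := by
  have h := Tendsto.const_mul (K : ℝ) hf
  rw [mul_zero] at h
  refine squeeze_zero' (Eventually.of_forall fun _ => Finset.sum_nonneg fun _ _ => dist_nonneg)
    ?_ h
  filter_upwards [mem_inf_of_right (mem_principal_self (disjWithin a b))] with E hE
  rw [Finset.mul_sum]
  exact Finset.sum_le_sum fun i hi =>
    hg.dist_le_mul _ (hs (hE.1 i hi).1) _ (hs (hE.1 i hi).2)

/-- A `C¹` function of an absolutely continuous curve is absolutely continuous. -/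
theorem absolutelyContinuousOnInterval_contDiff_comp {E F : Type*} [NormedAddCommGroup E]
    [NormedSpace ℝ E] [FiniteDimensional ℝ E] [NormedAddCommGroup F] [NormedSpace ℝ F]
    {f : ℝ → E} {a b : ℝ} (hf : AbsolutelyContinuousOnInterval f a b)
    {g : E → F} (hg : ContDiff ℝ 1 g) : AbsolutelyContinuousOnInterval (fun t => g (f t)) a b := by
  have : ProperSpace E := FiniteDimensional.proper ℝ E
  obtain ⟨C, hC⟩ := hf.exists_bound
  obtain ⟨K, hK⟩ := (hg.locallyLipschitz.locallyLipschitzOn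
    (s := Metric.closedBall 0 C)).exists_lipschitzOnWith_of_compact (isCompact_closedBall 0 C)
  exact absolutelyContinuousOnInterval_comp hf hK fun t ht => by simpa using hC t ht

theorem sub_le_mul_of_ae_deriv_le {f : ℝ → ℝ} {a b K : ℝ} (hab : a ≤ b)
    (hf : AbsolutelyContinuousOnInterval f a b)
    (hd : ∀ᵐ t : ℝ, t ∈ Icc a b → ∃ f', HasDerivAt f f' t ∧ f' ≤ K) :
    f b - f a ≤ K * (b - a) := by
  rw [← hf.integral_deriv_eq_sub]
  have : ∫ _t in a..b, K = K * (b - a) := by simp [mul_comm]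
  rw [← this]
  refine intervalIntegral.integral_mono_ae_restrict hab hf.intervalIntegrable_deriv (by simp) ?_
  rw [EventuallyLE, ae_restrict_iff' measurableSet_Icc]
  filter_upwards [hd] with t ht h
  obtain ⟨f', h1, h2⟩ := ht h
  rwa [h1.deriv]

theorem ae_mem_Icc_mono {p : ℝ → Prop} {a b c d : ℝ} (hca : a ≤ c) (hdb : d ≤ b)
    (h : ∀ᵐ t : ℝ, t ∈ Icc a b → p t) : ∀ᵐ t : ℝ, t ∈ Icc c d → p t := by
  filter_upwards [h] with t ht h'
  exact ht ⟨hca.trans h'.1, h'.2.trans hdb⟩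

theorem absolutelyContinuousOnInterval_mono_Icc {X : Type*} [PseudoMetricSpace X] {f : ℝ → X}
    {a b c d : ℝ} (hca : a ≤ c) (hcd : c ≤ d) (hdb : d ≤ b)
    (hf : AbsolutelyContinuousOnInterval f a b) : AbsolutelyContinuousOnInterval f c d := by
  refine hf.mono ?_
  rw [uIcc_of_le hcd, uIcc_of_le (hca.trans (hcd.trans hdb))]
  exact Icc_subset_Icc hca hdb

/-- Grönwall's inequality for an absolutely continuous function. -/
theorem one_add_le_mul_exp_of_ae_deriv_le {f : ℝ → ℝ} {a b C : ℝ} (hab : a ≤ b)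
    (hf : AbsolutelyContinuousOnInterval f a b)
    (hd : ∀ᵐ t : ℝ, t ∈ Icc a b → ∃ f', HasDerivAt f f' t ∧ f' ≤ C * (1 + f t)) :
    1 + f b ≤ (1 + f a) * Real.exp (C * (b - a)) := by
  have hE : AbsolutelyContinuousOnInterval (fun t => Real.exp (-C * (t - a))) a b :=
    ContDiffOn.absolutelyContinuousOnInterval (ContDiff.contDiffOn (by fun_prop))
  have h1 : AbsolutelyContinuousOnInterval (fun _ : ℝ => (1 : ℝ)) a b :=
    ContDiffOn.absolutelyContinuousOnInterval (ContDiff.contDiffOn (by fun_prop))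
  have key := sub_le_mul_of_ae_deriv_le (K := 0) hab ((h1.add hf).mul hE) ?_
  · simp only [Pi.mul_apply, Pi.add_apply, sub_self, mul_zero, Real.exp_zero, mul_one,
      zero_mul] at key
    have h3 : Real.exp (-C * (b - a)) * Real.exp (C * (b - a)) = 1 := by
      rw [← Real.exp_add]; simp
    calc 1 + f b = (1 + f b) * Real.exp (-C * (b - a)) * Real.exp (C * (b - a)) := by
          rw [mul_assoc, h3, mul_one]
      _ ≤ (1 + f a) * Real.exp (C * (b - a)) := by
          gcongr
          linarith
  · filter_upwards [hd] with t ht h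
    obtain ⟨f', h1, h2⟩ := ht h
    have hexp : HasDerivAt (fun t => Real.exp (-C * (t - a)))
        (Real.exp (-C * (t - a)) * (-C * 1)) t :=
      (((hasDerivAt_id t).sub_const a).const_mul (-C)).exp
    refine ⟨_, (h1.const_add 1).mul hexp, ?_⟩
    have := Real.exp_pos (-C * (t - a))
    nlinarith [mul_nonneg this.le (sub_nonneg.2 h2)]

/-- An absolutely continuous curve whose speed is at most `K` is `K`-Lipschitz. -/
theorem norm_sub_le_of_ae_norm_deriv_le {E : Type*} [NormedAddCommGroup E] [NormedSpace ℝ E]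
    {f : ℝ → E} {a b K : ℝ} (hab : a ≤ b) (hf : AbsolutelyContinuousOnInterval f a b)
    (hd : ∀ᵐ t : ℝ, t ∈ Icc a b → ∃ f', HasDerivAt f f' t ∧ ‖f'‖ ≤ K) :
    ‖f b - f a‖ ≤ K * (b - a) := by
  obtain ⟨l, hl, hl'⟩ := exists_dual_vector'' ℝ (f b - f a)
  have hac : AbsolutelyContinuousOnInterval (l ∘ f) a b :=
    absolutelyContinuousOnInterval_comp hf (l.lipschitz.lipschitzOnWith (s := univ))
      (mapsTo_univ _ _)
  have := sub_le_mul_of_ae_deriv_le (K := K) hab hac ?_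
  · simp only [Function.comp_apply, ← map_sub] at this
    rwa [hl'] at this
  · filter_upwards [hd] with t ht h
    obtain ⟨f', h1, h2⟩ := ht h
    refine ⟨_, l.hasFDerivAt.comp_hasDerivAt t h1, ?_⟩
    calc l f' ≤ ‖l f'‖ := le_abs_self _
      _ ≤ ‖l‖ * ‖f'‖ := l.le_opNorm _
      _ ≤ 1 * ‖f'‖ := by gcongr
      _ ≤ K := by linarith

theorem lipschitzOnWith_of_ae_norm_deriv_le {E : Type*} [NormedAddCommGroup E] [NormedSpace ℝ E]
    {f : ℝ → E} {a b : ℝ} {K : NNReal} (hf : AbsolutelyContinuousOnInterval f a b)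
    (hd : ∀ᵐ t : ℝ, t ∈ Icc a b → ∃ f', HasDerivAt f f' t ∧ ‖f'‖ ≤ K) :
    LipschitzOnWith K f (Icc a b) := by
  refine LipschitzOnWith.of_dist_le_mul fun s hs t ht => ?_
  wlog hst : s ≤ t generalizing s t
  · rw [dist_comm, dist_comm s]
    exact this t ht s hs (le_of_not_ge hst)
  rw [dist_comm, dist_comm s, dist_eq_norm, Real.dist_eq, abs_of_nonneg (by linarith)]
  exact norm_sub_le_of_ae_norm_deriv_le hst
    (absolutelyContinuousOnInterval_mono_Icc hs.1 hst ht.2 hf) (ae_mem_Icc_mono hs.1 ht.2 hd)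

/-- Barbalat's lemma: a nonnegative Lipschitz function `q` that is dominated by the rate of
decrease of a function bounded below tends to `0`. -/
theorem tendsto_zero_of_lipschitz_of_dissipation {q V : ℝ → ℝ} {K c m : ℝ} (hc : 0 < c)
    (hK : 0 ≤ K) (hq : ∀ t, 0 ≤ t → 0 ≤ q t)
    (hlip : ∀ s t, 0 ≤ s → s ≤ t → |q t - q s| ≤ K * (t - s)) (hV : ∀ t, 0 ≤ t → m ≤ V t)
    (hac : ∀ τ, 0 < τ → AbsolutelyContinuousOnInterval V 0 τ)
    (hd : ∀ τ, 0 < τ → ∀ᵐ t : ℝ, t ∈ Icc 0 τ → ∃ V', HasDerivAt V V' t ∧ V' ≤ -c * q t) :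
    Tendsto q atTop (𝓝 0) := by
  have step : ∀ s t k : ℝ, 0 ≤ s → s < t → (∀ r ∈ Icc s t, -c * q r ≤ k) →
      V t - V s ≤ k * (t - s) := by
    intro s t k hs hst hk
    refine sub_le_mul_of_ae_deriv_le hst.le (absolutelyContinuousOnInterval_mono_Icc hs hst.le
      le_rfl (hac t (hs.trans_lt hst))) ?_
    filter_upwards [hd t (hs.trans_lt hst)] with r hr h
    obtain ⟨V', h1, h2⟩ := hr ⟨hs.trans h.1, h.2⟩
    exact ⟨V', h1, h2.trans (hk r h)⟩
  have hanti : ∀ s t, 0 ≤ s → s ≤ t → V t ≤ V s := by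
    intro s t hs hst
    rcases hst.eq_or_lt with rfl | hst
    · exact le_rfl
    have := step s t 0 hs hst fun r hr => by
      have := mul_nonneg hc.le (hq r (hs.trans hr.1)); linarith
    linarith
  by_contra hcon
  rw [Metric.tendsto_atTop] at hcon
  push Not at hcon
  obtain ⟨ε, hε, hfreq⟩ := hcon
  -- on a window of length `δ` after a time with `q ≥ ε`, `q` stays above `ε / 2`
  set δ : ℝ := ε / (2 * (K + 1)) with hδ
  have hδ0 : 0 < δ := by positivity
  have hKδ : K * δ ≤ ε / 2 := by
    rw [hδ, mul_div_assoc', div_le_div_iff₀ (by positivity) (by positivity)]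
    nlinarith
  have hdrop : ∀ T, 0 ≤ T → ∃ T', T ≤ T' ∧ V T' ≤ V T - c * (ε / 2) * δ := by
    intro T hT
    obtain ⟨s, hs, hqs⟩ := hfreq T
    have hs0 : 0 ≤ s := hT.trans hs
    rw [Real.dist_eq, sub_zero, abs_of_nonneg (hq s hs0)] at hqs
    refine ⟨s + δ, by linarith, ?_⟩
    have := step s (s + δ) (-(c * (ε / 2))) hs0 (by linarith) fun r hr => by
      have h1 := hlip s r hs0 hr.1
      have h2 : K * (r - s) ≤ K * δ := by gcongr; linarith [hr.2]
      have h3 : ε / 2 ≤ q r := by linarith [(abs_le.1 h1).1]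
      nlinarith
    have := hanti T s hT hs
    linarith
  have hiter : ∀ k : ℕ, ∃ T, 0 ≤ T ∧ V T ≤ V 0 - k * (c * (ε / 2) * δ) := by
    intro k
    induction k with
    | zero => exact ⟨0, le_rfl, by simp⟩
    | succ k ih =>
      obtain ⟨T, hT, h1⟩ := ih
      obtain ⟨T', hT', h2⟩ := hdrop T hT
      exact ⟨T', hT.trans hT', by push_cast; linarith⟩
  obtain ⟨k, hk⟩ := exists_nat_gt ((V 0 - m) / (c * (ε / 2) * δ))
  rw [div_lt_iff₀ (by positivity)] at hk
  obtain ⟨T, hT, h1⟩ := hiter k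
  linarith [hV T hT]

end AbsolutelyContinuous

/-! ### Fields with sign switchings and their Filippov sets -/

/-- The data of a time-dependent vector field
`drift p + v t • input + ∑ i, sgn (switch i p) • gain i p`
whose discontinuities are sign switchings on the hyperplanes `switch i p = 0`. -/
structure SwitchedSystem (E ι : Type*) [NormedAddCommGroup E] [NormedSpace ℝ E] where
  drift : E → E
  input : E
  v : ℝ → ℝ
  gain : ι → E → E
  switch : ι → E →L[ℝ] ℝ

namespace SwitchedSystem

variable {E ι : Type*} [NormedAddCommGroup E] [NormedSpace ℝ E]
  (Q : SwitchedSystem E ι)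

/-- `σ` is a selection of the set-valued signs of the switching functions at `p`: the condition
`σ i * x = |x|` with `|σ i| ≤ 1` forces `σ i = sgn x` for `x ≠ 0` and is void for `x = 0`. -/
def IsSelection (p : E) (σ : ι → ℝ) : Prop :=
  ∀ i, |σ i| ≤ 1 ∧ σ i * Q.switch i p = |Q.switch i p|

variable {Q}

theorem convex_setOf_isSelection (p : E) : Convex ℝ {σ | Q.IsSelection p σ} := by
  intro σ hσ τ hτ a b ha hb hab i
  simp only [Pi.add_apply, Pi.smul_apply, smul_eq_mul]
  refine ⟨?_, ?_⟩
  · have h1 := abs_le.1 (hσ i).1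
    have h2 := abs_le.1 (hτ i).1
    rw [abs_le]
    constructor <;> nlinarith
  · calc _ = a * (σ i * Q.switch i p) + b * (τ i * Q.switch i p) := by ring
      _ = _ := by rw [(hσ i).2, (hτ i).2, ← add_mul, hab, one_mul]

theorem isCompact_setOf_isSelection (p : E) : IsCompact {σ | Q.IsSelection p σ} := by
  refine (isCompact_univ_pi fun _ : ι => isCompact_Icc (a := (-1 : ℝ)) (b := 1)).of_isClosed_subset
    ?_ fun σ hσ i _ => abs_le.1 (hσ i).1
  have : {σ | Q.IsSelection p σ} =
      ⋂ i, {σ : ι → ℝ | |σ i| ≤ 1} ∩ {σ | σ i * Q.switch i p = |Q.switch i p|} := by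
    ext; simp [IsSelection]
  rw [this]
  exact isClosed_iInter fun i => (isClosed_le (by fun_prop) (by fun_prop)).inter
    (isClosed_eq (by fun_prop) (by fun_prop))

variable [Fintype ι] (Q)

/-- The right-hand side with the numbers `σ i` in place of the signs. -/
noncomputable def rhs (σ : ι → ℝ) (t : ℝ) (p : E) : E :=
  Q.drift p + Q.v t • Q.input + ∑ i, σ i • Q.gain i p

/-- The discontinuous vector field of the system. -/
noncomputable def field (t : ℝ) (p : E) : E := Q.rhs (fun i => Real.sign (Q.switch i p)) t p

/-- The set-valued right-hand side, with set-valued signs. -/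
def values (t : ℝ) (p : E) : Set E := {q | ∃ σ, Q.IsSelection p σ ∧ Q.rhs σ t p = q}

/-- Regularity of the data, and independence of those switching functions that matter. -/
structure IsRegular : Prop where
  drift : LocallyLipschitz Q.drift
  gain : ∀ i, ContDiff ℝ 1 (Q.gain i)
  continuousOn : ContinuousOn Q.v (Ici 0)
  bounded : ∃ l, 0 < l ∧ ∀ t, 0 ≤ t → |Q.v t| ≤ l
  independent : ∀ s : ι → ℝ, ∃ u, ∀ i, (∀ p, Q.gain i p = 0) ∨ Q.switch i u = s i

theorem abs_sign_le_one (x : ℝ) : |Real.sign x| ≤ 1 := by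
  rcases Real.sign_apply_eq x with h | h | h <;> simp [h]

/-- A bound, uniform in `σ`, for the variation of the right-hand side between `(t, p)` and
`(t', p')`. -/
noncomputable def modulus (t : ℝ) (p : E) (t' : ℝ) (p' : E) : ℝ :=
  ‖Q.drift p' - Q.drift p‖ + |Q.v t' - Q.v t| * ‖Q.input‖ + ∑ i, ‖Q.gain i p' - Q.gain i p‖

theorem norm_rhs_sub_le {σ : ι → ℝ} (hσ : ∀ i, |σ i| ≤ 1) (t : ℝ) (p : E) (t' : ℝ) (p' : E) :
    ‖Q.rhs σ t' p' - Q.rhs σ t p‖ ≤ Q.modulus t p t' p' := by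
  have : Q.rhs σ t' p' - Q.rhs σ t p = (Q.drift p' - Q.drift p) + (Q.v t' - Q.v t) • Q.input
      + ∑ i, σ i • (Q.gain i p' - Q.gain i p) := by
    simp only [rhs, smul_sub, Finset.sum_sub_distrib, sub_smul]; abel
  rw [this]
  refine (norm_add₃_le).trans ?_
  rw [norm_smul, Real.norm_eq_abs]
  refine add_le_add_right ((norm_sum_le _ _).trans (Finset.sum_le_sum fun i _ => ?_)) _
  rw [norm_smul, Real.norm_eq_abs]
  exact mul_le_of_le_one_left (norm_nonneg _) (hσ i)

theorem norm_rhs_le {σ : ι → ℝ} (hσ : ∀ i, |σ i| ≤ 1) (t : ℝ) (p : E) :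
    ‖Q.rhs σ t p‖ ≤ ‖Q.drift p‖ + |Q.v t| * ‖Q.input‖ + ∑ i, ‖Q.gain i p‖ := by
  refine (norm_add₃_le).trans ?_
  rw [norm_smul, Real.norm_eq_abs]
  refine add_le_add_right ((norm_sum_le _ _).trans (Finset.sum_le_sum fun i _ => ?_)) _
  rw [norm_smul, Real.norm_eq_abs]
  exact mul_le_of_le_one_left (norm_nonneg _) (hσ i)

variable {Q}

theorem IsRegular.tendsto_modulus (hQ : Q.IsRegular) {t : ℝ} (ht : 0 ≤ t) (p : E) :
    Tendsto (fun x : ℝ × E => Q.modulus t p x.1 x.2) (𝓝[Ici 0 ×ˢ univ] (t, p)) (𝓝 0) := by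
  have h1 : ContinuousWithinAt (fun x : ℝ × E => Q.v x.1) (Ici 0 ×ˢ univ) (t, p) :=
    ContinuousWithinAt.comp (t := Ici 0) (hQ.continuousOn t ht)
      continuous_fst.continuousWithinAt (fun x hx => hx.1)
  have h2 := hQ.drift.continuous
  have h3 := fun i => (hQ.gain i).continuous
  have : ContinuousWithinAt (fun x : ℝ × E => Q.modulus t p x.1 x.2) (Ici 0 ×ˢ univ) (t, p) := by
    refine ((Continuous.continuousWithinAt (by fun_prop)).add (ContinuousWithinAt.mul
      (h1.sub continuousWithinAt_const).norm continuousWithinAt_const)).add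
      (Continuous.continuousWithinAt (by fun_prop))
  simpa [ContinuousWithinAt, modulus] using this

theorem IsRegular.continuous_modulus_right (hQ : Q.IsRegular) (t : ℝ) (p : E) :
    Continuous fun p' => Q.modulus t p t p' := by
  have h2 := hQ.drift.continuous
  have h3 := fun i => (hQ.gain i).continuous
  unfold modulus
  fun_prop

theorem eventually_isSelection_sign (p : E) :
    ∀ᶠ p' in 𝓝 p, Q.IsSelection p fun i => Real.sign (Q.switch i p') := by
  refine eventually_all.2 fun i => ?_
  have hc : Tendsto (fun p' => Q.switch i p') (𝓝 p) (𝓝 (Q.switch i p)) :=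
    (Q.switch i).continuous.tendsto p
  rcases lt_trichotomy (Q.switch i p) 0 with h | h | h
  · filter_upwards [hc.eventually (gt_mem_nhds h)] with p' h'
    rw [Real.sign_of_neg h', abs_of_neg h]
    exact ⟨by simp, by ring⟩
  · exact Eventually.of_forall fun p' => ⟨abs_sign_le_one _, by simp [h]⟩
  · filter_upwards [hc.eventually (lt_mem_nhds h)] with p' h'
    rw [Real.sign_of_pos h', abs_of_pos h]
    exact ⟨by simp, by ring⟩

theorem rhs_combination (t : ℝ) (p : E) {σ τ : ι → ℝ} {a b : ℝ} (hab : a + b = 1) :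
    Q.rhs (a • σ + b • τ) t p = a • Q.rhs σ t p + b • Q.rhs τ t p := by
  have h : Q.drift p + Q.v t • Q.input = a • (Q.drift p + Q.v t • Q.input)
      + b • (Q.drift p + Q.v t • Q.input) := by rw [← add_smul, hab, one_smul]
  simp only [rhs, Pi.add_apply, Pi.smul_apply, smul_eq_mul, add_smul, Finset.sum_add_distrib,
    mul_smul, ← Finset.smul_sum]
  conv_lhs => rw [h]
  simp only [smul_add]
  abel

theorem convex_values (t : ℝ) (p : E) : Convex ℝ (Q.values t p) := by
  rintro _ ⟨σ, hσ, rfl⟩ _ ⟨τ, hτ, rfl⟩ a b ha hb hab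
  exact ⟨a • σ + b • τ, convex_setOf_isSelection p hσ hτ ha hb hab, rhs_combination t p hab⟩

theorem isCompact_values (t : ℝ) (p : E) : IsCompact (Q.values t p) := by
  have : Q.values t p = (fun σ => Q.rhs σ t p) '' {σ | Q.IsSelection p σ} := by
    ext; simp [values]
  rw [this]
  refine (isCompact_setOf_isSelection p).image ?_
  unfold rhs
  fun_prop

theorem rhs_mem_cthickening {t : ℝ} {p : E} {σ : ι → ℝ} (hσ : Q.IsSelection p σ) {t' : ℝ} {p' : E}
    {ε : ℝ} (hε : Q.modulus t p t' p' ≤ ε) :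
    Q.rhs σ t' p' ∈ Metric.cthickening ε (Q.values t p) := by
  refine Metric.mem_cthickening_of_dist_le _ (Q.rhs σ t p) _ _ ⟨σ, hσ, rfl⟩ ?_
  rw [dist_eq_norm]
  exact (Q.norm_rhs_sub_le (fun i => (hσ i).1) t p t' p').trans hε

theorem mem_values_of_forall_mem_cthickening {t : ℝ} {p q : E}
    (h : ∀ ε, 0 < ε → q ∈ Metric.cthickening ε (Q.values t p)) : q ∈ Q.values t p := by
  rw [← (isCompact_values t p).isClosed.closure_eq, Metric.closure_eq_iInter_cthickening]
  simpa using h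

section Measure

variable [MeasureSpace E]

theorem IsRegular.filippovSet_subset (hQ : Q.IsRegular) (t : ℝ) (p : E) :
    filippovSet Q.field t p ⊆ Q.values t p := by
  intro q hq
  refine mem_values_of_forall_mem_cthickening fun ε hε => ?_
  have h1 : ∀ᶠ p' in 𝓝 p, Q.modulus t p t p' < ε :=
    ((hQ.continuous_modulus_right t p).tendsto p).eventually
      (gt_mem_nhds (by simpa [modulus] using hε))
  obtain ⟨δ, hδ, hball⟩ := Metric.eventually_nhds_iff_ball.1
    (h1.and (eventually_isSelection_sign (Q := Q) p))
  simp only [filippovSet, mem_iInter] at hq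
  refine closure_minimal (convexHull_min ?_ ((convex_values t p).cthickening ε))
    Metric.isClosed_cthickening (hq δ hδ ∅ (by simp))
  rintro _ ⟨p', hp', rfl⟩
  exact rhs_mem_cthickening (hball p' hp'.1).2 (hball p' hp'.1).1.le

theorem mem_convexHull_signs {x s : ℝ} (hs : |s| ≤ 1) (hx : s * x = |x|) :
    s ∈ convexHull ℝ {r : ℝ | |r| = 1 ∧ r * x = |x|} := by
  by_cases h0 : x = 0
  · have : {r : ℝ | |r| = 1 ∧ r * x = |x|} = {-1, 1} := by
      ext r
      simp only [h0, mul_zero, abs_zero, and_true, mem_ofPred_eq, mem_insert_iff,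
        mem_singleton_iff]
      rw [abs_eq zero_le_one, or_comm]
    rw [this, convexHull_pair, segment_eq_Icc (by norm_num)]
    exact abs_le.1 hs
  · refine subset_convexHull ℝ _ ⟨?_, hx⟩
    have h := congrArg abs hx
    rw [abs_mul, abs_abs] at h
    exact mul_right_cancel₀ (abs_ne_zero.2 h0) (by rw [h, one_mul])

/-- By independence, each sign pattern compatible with `p` is attained on an open set that
accumulates at `p`; the other values are convex combinations of these. -/
theorem IsRegular.values_subset_filippovSet [(volume : Measure E).IsOpenPosMeasure]
    (hQ : Q.IsRegular) (t : ℝ) (p : E) : Q.values t p ⊆ filippovSet Q.field t p := by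
  rintro _ ⟨σ, hσ, rfl⟩
  simp only [filippovSet, mem_iInter]
  intro δ hδ N hN
  set K := closure (convexHull ℝ (Q.field t '' (Metric.ball p δ \ N)))
  have hK : Convex ℝ K := (convex_convexHull ℝ _).closure
  have hvert : ∀ s ∈ univ.pi fun i => {r : ℝ | |r| = 1 ∧ r * Q.switch i p = |Q.switch i p|},
      Q.rhs s t p ∈ K := by
    intro s hs
    refine closure_mono (subset_convexHull ℝ _) ?_
    rw [Metric.mem_closure_iff]
    intro ε hε
    obtain ⟨u, hu⟩ := hQ.independent s
    set U : Set E := {x | (x ∈ Metric.ball p δ ∧ Q.modulus t p t x < ε) ∧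
      ∀ i, (∀ p, Q.gain i p = 0) ∨ 0 < s i * Q.switch i x} with hU
    have hUo : IsOpen U := by
      have : U = (Metric.ball p δ ∩ {x | Q.modulus t p t x < ε}) ∩
          ⋂ i, ({_x | ∀ p, Q.gain i p = 0} ∪ {x | 0 < s i * Q.switch i x}) := by
        ext; simp [hU]
      rw [this]
      refine (Metric.isOpen_ball.inter (isOpen_lt (hQ.continuous_modulus_right t p)
        continuous_const)).inter (isOpen_iInter_of_finite fun i => ?_)
      exact isOpen_const.union (isOpen_lt continuous_const (by fun_prop))
    have hUne : U.Nonempty := by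
      have hline : Tendsto (fun r : ℝ => p + r • u) (𝓝[>] 0) (𝓝 p) := by
        have : Tendsto (fun r : ℝ => p + r • u) (𝓝 0) (𝓝 (p + (0 : ℝ) • u)) :=
          Continuous.tendsto (by fun_prop) 0
        rw [zero_smul, add_zero] at this
        exact this.mono_left nhdsWithin_le_nhds
      have h1 : ∀ᶠ r : ℝ in 𝓝[>] 0, p + r • u ∈ Metric.ball p δ :=
        hline.eventually (Metric.ball_mem_nhds p hδ)
      have h2 : ∀ᶠ r : ℝ in 𝓝[>] 0, Q.modulus t p t (p + r • u) < ε :=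
        hline.eventually (((hQ.continuous_modulus_right t p).tendsto p).eventually
          (gt_mem_nhds (by simpa [modulus] using hε)))
      obtain ⟨r, ⟨hr1, hr2⟩, hr3⟩ := ((h1.and h2).and self_mem_nhdsWithin).exists
      refine ⟨p + r • u, ⟨hr1, hr2⟩, fun i => (hu i).imp_right fun hui => ?_⟩
      have hs1 : s i * s i = 1 := by
        rw [← abs_mul_abs_self, (hs i (mem_univ i)).1, one_mul]
      rw [map_add, map_smul, hui, smul_eq_mul, mul_add, (hs i (mem_univ i)).2]
      have : s i * (r * s i) = r := by linear_combination r * hs1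
      rw [this]
      have := abs_nonneg (Q.switch i p)
      have : 0 < r := hr3
      linarith
    obtain ⟨x, hxU, hxN⟩ : (U \ N).Nonempty := by
      refine nonempty_of_measure_ne_zero (μ := volume) ?_
      rw [measure_sdiff_null hN]
      exact (hUo.measure_pos volume hUne).ne'
    refine ⟨Q.field t x, ⟨x, ⟨hxU.1.1, hxN⟩, rfl⟩, ?_⟩
    have hfield : Q.field t x = Q.rhs s t x := by
      simp only [field, rhs]
      congr 1
      refine Finset.sum_congr rfl fun i _ => ?_
      rcases hxU.2 i with h | h
      · rw [h x, smul_zero, smul_zero]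
      · congr 1
        rcases (abs_eq zero_le_one).1 (hs i (mem_univ i)).1 with h1 | h1
        · rw [h1] at h ⊢; exact Real.sign_of_pos (by linarith)
        · rw [h1] at h ⊢; exact Real.sign_of_neg (by linarith)
    rw [hfield, dist_comm, dist_eq_norm]
    exact (Q.norm_rhs_sub_le (fun i => (hs i (mem_univ i)).1.le) t p t x).trans_lt hxU.1.2
  have hconv : Convex ℝ {s : ι → ℝ | Q.rhs s t p ∈ K} := by
    intro s hs r hr a b ha hb hab
    rw [mem_ofPred_eq, rhs_combination t p hab]
    exact hK hs hr ha hb hab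
  refine convexHull_min hvert hconv ?_
  rw [convexHull_pi]
  exact fun i _ => mem_convexHull_signs (hσ i).1 (hσ i).2

end Measure

end SwitchedSystem

/-! ### Existence and extension of Filippov solutions -/

/-- Mean value inclusion: if almost every velocity lies in a closed convex set, so does the
average velocity. -/
theorem slope_mem_of_ae_deriv_mem {E : Type*} [NormedAddCommGroup E] [NormedSpace ℝ E]
    {f : ℝ → E} {a b : ℝ} (hab : a < b) (hf : AbsolutelyContinuousOnInterval f a b) {K : Set E}
    (hK : Convex ℝ K) (hKc : IsClosed K)
    (hd : ∀ᵐ t : ℝ, t ∈ Icc a b → ∃ f' ∈ K, HasDerivAt f f' t) :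
    slope f a b ∈ K := by
  by_contra hy
  obtain ⟨l, u, hu, hl⟩ := geometric_hahn_banach_closed_point hK hKc hy
  have hac : AbsolutelyContinuousOnInterval (l ∘ f) a b :=
    absolutelyContinuousOnInterval_comp hf (l.lipschitz.lipschitzOnWith (s := univ))
      (mapsTo_univ _ _)
  have h := sub_le_mul_of_ae_deriv_le (K := u) hab.le hac (by
    filter_upwards [hd] with t ht h
    obtain ⟨f', h1, h2⟩ := ht h
    exact ⟨_, l.hasFDerivAt.comp_hasDerivAt t h2, (hu f' h1).le⟩)
  have hba : 0 < b - a := sub_pos.2 hab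
  rw [slope_def_module, map_smul, map_sub, smul_eq_mul, inv_mul_eq_div, lt_div_iff₀ hba] at hl
  simp only [Function.comp_apply] at h
  linarith

theorem absolutelyContinuousOnInterval_of_hasDerivWithinAt {E : Type*} [NormedAddCommGroup E]
    [NormedSpace ℝ E] {f f' : ℝ → E} {a b K : ℝ} (hab : a ≤ b)
    (hd : ∀ t ∈ Icc a b, HasDerivWithinAt f (f' t) (Icc a b) t)
    (hK : ∀ t ∈ Icc a b, ‖f' t‖ ≤ K) : AbsolutelyContinuousOnInterval f a b := by
  have : LipschitzOnWith K.toNNReal f (uIcc a b) := by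
    rw [uIcc_of_le hab]
    refine (convex_Icc a b).lipschitzOnWith_of_nnnorm_hasDerivWithin_le hd fun {t} ht => ?_
    rw [← NNReal.coe_le_coe, coe_nnnorm]
    exact (hK t ht).trans (Real.le_coe_toNNReal K)
  exact this.absolutelyContinuousOnInterval

theorem ae_mem_Icc_of_forall_mem_Ioo {p : ℝ → Prop} {a b : ℝ} (h : ∀ t ∈ Ioo a b, p t) :
    ∀ᵐ t : ℝ, t ∈ Icc a b → p t := by
  have h1 : ∀ᵐ t : ℝ, t ≠ a := by simp [ae_iff, measure_singleton]
  have h2 : ∀ᵐ t : ℝ, t ≠ b := by simp [ae_iff, measure_singleton]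
  filter_upwards [h1, h2] with t ha hb ht
  exact h t ⟨ht.1.lt_of_ne' ha, ht.2.lt_of_ne hb⟩

namespace SwitchedSystem

section Smoothing

variable {E ι : Type*} [NormedAddCommGroup E] [NormedSpace ℝ E]

/-- A smooth approximation of the sign function: it takes values in `[-1, 1]`, is `-1` on
`(-∞, 0]` and `1` on `[1, ∞)`. -/
noncomputable def smoothSign (x : ℝ) : ℝ := 2 * Real.smoothTransition x - 1

theorem abs_smoothSign_le_one (x : ℝ) : |smoothSign x| ≤ 1 := by
  have h1 := Real.smoothTransition.nonneg x
  have h2 := Real.smoothTransition.le_one x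
  rw [abs_le, smoothSign]
  constructor <;> linarith

theorem contDiff_smoothSign : ContDiff ℝ 1 smoothSign := by
  have : ContDiff ℝ 1 Real.smoothTransition := Real.smoothTransition.contDiff
  unfold smoothSign
  fun_prop

/-- The multipliers that replace the signs in the smoothed equation. -/
noncomputable def smoothMultiplier (Q : SwitchedSystem E ι) (k : ℕ) (p : E) (i : ι) : ℝ :=
  smoothSign (k * Q.switch i p)

theorem eventually_isSelection_smoothMultiplier [Finite ι] (Q : SwitchedSystem E ι) (p : E) :
    ∀ᶠ x : ℕ × E in atTop ×ˢ 𝓝 p, ∀ i,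
      |smoothSign (x.1 * Q.switch i x.2)| ≤ 1 ∧
        smoothSign (x.1 * Q.switch i x.2) * Q.switch i p = |Q.switch i p| := by
  refine eventually_all.2 fun i => ?_
  have hc : Tendsto (fun x : ℕ × E => Q.switch i x.2) (atTop ×ˢ 𝓝 p) (𝓝 (Q.switch i p)) :=
    ((Q.switch i).continuous.tendsto p).comp tendsto_snd
  have hk : Tendsto (fun x : ℕ × E => (x.1 : ℝ)) (atTop ×ˢ 𝓝 p) atTop :=
    tendsto_natCast_atTop_atTop.comp tendsto_fst
  rcases lt_trichotomy (Q.switch i p) 0 with h | h | h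
  · filter_upwards [hc.eventually (gt_mem_nhds h)] with x hx
    have : smoothSign (x.1 * Q.switch i x.2) = -1 := by
      rw [smoothSign, Real.smoothTransition.zero_of_nonpos]
      · ring
      · exact mul_nonpos_of_nonneg_of_nonpos (Nat.cast_nonneg _) hx.le
    rw [this, abs_of_neg h]
    exact ⟨by simp, by ring⟩
  · exact Eventually.of_forall fun x => ⟨abs_smoothSign_le_one _, by simp [h]⟩
  · filter_upwards [(hk.atTop_mul_pos h hc).eventually_ge_atTop 1] with x hx
    have : smoothSign (x.1 * Q.switch i x.2) = 1 := by
      rw [smoothSign, Real.smoothTransition.one_of_one_le hx]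
      ring
    rw [this, abs_of_pos h]
    exact ⟨by simp, by ring⟩

end Smoothing

variable {E ι : Type*} [NormedAddCommGroup E] [NormedSpace ℝ E] [Fintype ι]
  (Q : SwitchedSystem E ι)

/-- Absolutely continuous solution of the differential inclusion `γ' ∈ values t γ`. -/
def IsSolution (t₀ t₁ : ℝ) (γ : ℝ → E) : Prop :=
  AbsolutelyContinuousOnInterval γ t₀ t₁ ∧
    ∀ᵐ t : ℝ, t ∈ Icc t₀ t₁ → ∃ γ' ∈ Q.values t (γ t), HasDerivAt γ γ' t

/-- Solutions of a weaker inclusion: arbitrary multipliers in `[-1, 1]` replace the signs, and the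
velocity may be scaled down by a factor in `[0, 1]`. It covers Filippov solutions as well as the
solutions of smoothed and truncated equations. -/
def IsRelaxedSolution (t₀ t₁ : ℝ) (γ : ℝ → E) : Prop :=
  AbsolutelyContinuousOnInterval γ t₀ t₁ ∧
    ∀ᵐ t : ℝ, t ∈ Icc t₀ t₁ → ∃ (c : ℝ) (σ : ι → ℝ), c ∈ Icc (0 : ℝ) 1 ∧ (∀ i, |σ i| ≤ 1) ∧
      HasDerivAt γ (c • Q.rhs σ t (γ t)) t

/-- On bounded time intervals relaxed solutions stay bounded in terms of their initial values. -/
def HasAprioriBound : Prop :=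
  ∀ R T : ℝ, ∃ B : ℝ, ∀ (t₀ t₁ : ℝ) (γ : ℝ → E), 0 ≤ t₀ → t₀ ≤ t₁ → t₁ ≤ T →
    Q.IsRelaxedSolution t₀ t₁ γ → ‖γ t₀‖ ≤ R → ‖γ t₁‖ ≤ B

variable {Q}

theorem IsSolution.isRelaxedSolution {t₀ t₁ : ℝ} {γ : ℝ → E} (h : Q.IsSolution t₀ t₁ γ) :
    Q.IsRelaxedSolution t₀ t₁ γ := by
  refine ⟨h.1, ?_⟩
  filter_upwards [h.2] with t ht h'
  obtain ⟨_, ⟨σ, hσ, rfl⟩, h2⟩ := ht h'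
  exact ⟨1, σ, by simp, fun i => (hσ i).1, by rwa [one_smul]⟩

theorem IsRelaxedSolution.mono {a b c d : ℝ} {γ : ℝ → E} (h : Q.IsRelaxedSolution a b γ)
    (hca : a ≤ c) (hcd : c ≤ d) (hdb : d ≤ b) : Q.IsRelaxedSolution c d γ :=
  ⟨absolutelyContinuousOnInterval_mono_Icc hca hcd hdb h.1, ae_mem_Icc_mono hca hdb h.2⟩

theorem IsRegular.isFilippovSolution_iff [MeasureSpace E]
    [(volume : Measure E).IsOpenPosMeasure] (hQ : Q.IsRegular) {t₀ t₁ : ℝ} {γ : ℝ → E} :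
    IsFilippovSolution Q.field t₀ t₁ γ ↔ Q.IsSolution t₀ t₁ γ := by
  have : ∀ t p, filippovSet Q.field t p = Q.values t p := fun t p =>
    (hQ.filippovSet_subset t p).antisymm (hQ.values_subset_filippovSet t p)
  simp only [IsFilippovSolution, IsSolution, this]

variable [FiniteDimensional ℝ E]

theorem IsRegular.exists_speed_bound (hQ : Q.IsRegular) (R : ℝ) :
    ∃ L : ℝ, 0 < L ∧ ∀ t p (σ : ι → ℝ), 0 ≤ t → ‖p‖ ≤ R → (∀ i, |σ i| ≤ 1) →
      ‖Q.rhs σ t p‖ ≤ L := by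
  have : ProperSpace E := FiniteDimensional.proper ℝ E
  obtain ⟨l, hl, hv⟩ := hQ.bounded
  have h2 := hQ.drift.continuous
  have h3 := fun i => (hQ.gain i).continuous
  have hc : Continuous fun p => ‖Q.drift p‖ + l * ‖Q.input‖ + ∑ i, ‖Q.gain i p‖ := by fun_prop
  obtain ⟨C, hC⟩ := (isCompact_closedBall (0 : E) R).exists_bound_of_continuousOn hc.continuousOn
  refine ⟨max C 1, by positivity, fun t p σ ht hp hσ => (Q.norm_rhs_le hσ t p).trans ?_⟩
  refine le_trans ?_ (((le_abs_self _).trans (hC p (by simpa using hp))).trans (le_max_left _ _))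
  gcongr
  exact hv t ht

/-- The smoothed equation, truncated outside of a large ball, is solvable on any bounded interval
by the Picard–Lindelöf theorem. -/
theorem IsRegular.exists_truncated_solution (hQ : Q.IsRegular) {t₀ T ρ : ℝ} (ht₀ : 0 ≤ t₀)
    (hT : t₀ ≤ T) (hρ : 0 < ρ) (k : ℕ) (p₀ : E) :
    ∃ (γ : ℝ → E) (χ : E → ℝ), γ t₀ = p₀ ∧ (∀ p, χ p ∈ Icc (0 : ℝ) 1) ∧
      (∀ p, ‖p‖ ≤ ρ → χ p = 1) ∧ AbsolutelyContinuousOnInterval γ t₀ T ∧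
      ∀ t ∈ Icc t₀ T, HasDerivWithinAt γ
        (χ (γ t) • Q.rhs (Q.smoothMultiplier k (γ t)) t (γ t)) (Icc t₀ T) t := by
  have : ProperSpace E := FiniteDimensional.proper ℝ E
  obtain ⟨l, hl, hv⟩ := hQ.bounded
  obtain ⟨L, hL, hspeed⟩ := hQ.exists_speed_bound (ρ + 1)
  let χ : ContDiffBump (0 : E) := ⟨ρ, ρ + 1, hρ, by linarith⟩
  have hχ : ContDiff ℝ 1 (fun p => χ p) := χ.contDiff
  have hχ01 : ∀ p, χ p ∈ Icc (0 : ℝ) 1 := fun p => ⟨χ.nonneg, χ.le_one⟩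
  set H : ℝ → E → E := fun t p => χ p • Q.rhs (Q.smoothMultiplier k p) t p with hH
  have hbound : ∀ t p, 0 ≤ t → ‖H t p‖ ≤ L := by
    intro t p ht
    rcases le_or_gt ‖p‖ (ρ + 1) with h | h
    · rw [hH, norm_smul, Real.norm_eq_abs, abs_of_nonneg (hχ01 p).1]
      have := hspeed t p _ ht h (fun i => abs_smoothSign_le_one (k * Q.switch i p))
      exact (mul_le_of_le_one_left (norm_nonneg _) (hχ01 p).2).trans this
    · have : χ p = 0 := χ.zero_of_le_dist (by rw [dist_zero_right]; exact h.le)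
      simp [hH, this, hL.le]
  set a : ℝ := L * (T - t₀) with ha
  have ha0 : 0 ≤ a := mul_nonneg hL.le (by linarith)
  have hLip : ∃ K : NNReal, ∀ t, 0 ≤ t → LipschitzOnWith K (H t) (Metric.closedBall p₀ a) := by
    have h0 : ContDiff ℝ 1 fun p => ∑ i, Q.smoothMultiplier k p i • Q.gain i p := by
      have := hQ.gain
      have := contDiff_smoothSign
      unfold smoothMultiplier
      fun_prop
    have h1 : LocallyLipschitz fun p =>
        χ p • (Q.drift p + ∑ i, Q.smoothMultiplier k p i • Q.gain i p) :=
      (ContDiff.locallyLipschitz (𝕂 := ℝ) (f := fun x : ℝ × E × E => x.1 • (x.2.1 + x.2.2))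
        (by fun_prop)).comp (hχ.locallyLipschitz.prodMk (hQ.drift.prodMk h0.locallyLipschitz))
    have h2 : ContDiff ℝ 1 fun p => χ p • Q.input := by fun_prop
    obtain ⟨K₁, hK₁⟩ := (h1.locallyLipschitzOn
      (s := Metric.closedBall p₀ a)).exists_lipschitzOnWith_of_compact (isCompact_closedBall p₀ a)
    obtain ⟨K₂, hK₂⟩ := (h2.locallyLipschitz.locallyLipschitzOn
      (s := Metric.closedBall p₀ a)).exists_lipschitzOnWith_of_compact (isCompact_closedBall p₀ a)
    refine ⟨K₁ + l.toNNReal * K₂, fun t ht => LipschitzOnWith.of_dist_le_mul fun p hp q hq => ?_⟩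
    have e : ∀ p, H t p = χ p • (Q.drift p + ∑ i, Q.smoothMultiplier k p i • Q.gain i p)
        + Q.v t • (χ p • Q.input) := fun p => by
      simp only [hH, rhs, smul_add, smul_comm (Q.v t)]
      abel
    rw [e, e]
    refine (dist_add_add_le _ _ _ _).trans ?_
    rw [dist_smul₀, NNReal.coe_add, NNReal.coe_mul, Real.coe_toNNReal l hl.le, add_mul, mul_assoc]
    gcongr
    · exact hK₁.dist_le_mul p hp q hq
    · exact hv t ht
    · exact hK₂.dist_le_mul p hp q hq
  obtain ⟨K, hK⟩ := hLip
  have hPL : IsPicardLindelof H (tmin := t₀) (tmax := T) ⟨t₀, left_mem_Icc.2 hT⟩ p₀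
      ⟨a, ha0⟩ 0 ⟨L, hL.le⟩ K :=
    { lipschitzOnWith := fun t ht => hK t (ht₀.trans ht.1)
      continuousOn := fun p _ => by
        have : ContinuousOn Q.v (Icc t₀ T) := hQ.continuousOn.mono fun t ht => ht₀.trans ht.1
        simp only [hH, rhs]
        exact continuousOn_const.smul ((continuousOn_const.add
          (this.smul continuousOn_const)).add continuousOn_const)
      norm_le := fun t ht p _ => hbound t p (ht₀.trans ht.1)
      mul_max_le := by
        simp only [sub_self, NNReal.coe_zero, sub_zero]
        rw [max_eq_left (by linarith)]
        exact ha.ge }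
  obtain ⟨γ, h0, hγ⟩ := hPL.exists_eq_forall_mem_Icc_hasDerivWithinAt₀
  exact ⟨γ, χ, h0, hχ01, fun p hp => χ.one_of_mem_closedBall (by simpa using hp),
    absolutelyContinuousOnInterval_of_hasDerivWithinAt hT hγ
      fun t ht => hbound t _ (ht₀.trans ht.1), hγ⟩

/-- The a priori bound keeps the solution of the truncated equation where nothing is truncated. -/
theorem IsRegular.exists_smoothed_solution (hQ : Q.IsRegular) {t₀ T : ℝ} (ht₀ : 0 ≤ t₀)
    (hT : t₀ ≤ T) (k : ℕ) (p₀ : E) {B : ℝ → ℝ}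
    (hB : ∀ T' (γ : ℝ → E), t₀ ≤ T' → Q.IsRelaxedSolution t₀ T' γ → γ t₀ = p₀ →
      ∀ t ∈ Icc t₀ T', ‖γ t‖ ≤ B T') :
    ∃ γ : ℝ → E, γ t₀ = p₀ ∧ AbsolutelyContinuousOnInterval γ t₀ T ∧
      (∀ t ∈ Ioo t₀ T, HasDerivAt γ (Q.rhs (Q.smoothMultiplier k (γ t)) t (γ t)) t) ∧
      ∀ T' ∈ Icc t₀ T, ∀ t ∈ Icc t₀ T', ‖γ t‖ ≤ B T' := by
  obtain ⟨γ, χ, h0, hχ, hχ1, hac, hγ⟩ :=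
    hQ.exists_truncated_solution ht₀ hT (ρ := max (B T) 1) (by positivity) k p₀
  have hd : ∀ t ∈ Ioo t₀ T, HasDerivAt γ
      (χ (γ t) • Q.rhs (Q.smoothMultiplier k (γ t)) t (γ t)) t := fun t ht =>
    (hγ t (Ioo_subset_Icc_self ht)).hasDerivAt (Icc_mem_nhds ht.1 ht.2)
  have hrel : Q.IsRelaxedSolution t₀ T γ :=
    ⟨hac, ae_mem_Icc_of_forall_mem_Ioo fun t ht =>
      ⟨χ (γ t), _, hχ _, fun i => abs_smoothSign_le_one _, hd t ht⟩⟩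
  refine ⟨γ, h0, hac, fun t ht => ?_, fun T' hT' t ht => ?_⟩
  · have := hd t ht
    rwa [hχ1 _ ((hB T γ hT hrel h0 t (Ioo_subset_Icc_self ht)).trans (le_max_left _ _)),
      one_smul] at this
  · exact hB T' γ hT'.1 (hrel.mono le_rfl hT'.1 hT'.2) h0 t ht

end SwitchedSystem

namespace SwitchedSystem

variable {E ι : Type*} [NormedAddCommGroup E] [NormedSpace ℝ E] [Fintype ι]
  {Q : SwitchedSystem E ι}

/-- Concatenation of a Lipschitz curve that is a solution before time `T` with a solution starting
at time `T`. -/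
theorem isSolution_concat {T τ : ℝ} (hT : 0 < T) {g η : ℝ → E} {K : NNReal}
    (hg : LipschitzWith K g)
    (hgsol : ∀ᵐ t : ℝ, t ∈ Ioo 0 T → ∃ γ' ∈ Q.values t (g t), HasDerivAt g γ' t)
    (hη0 : η T = g T)
    (hη : ∀ T', T < T' → Q.IsSolution T T' η ∧ ∃ K, LipschitzOnWith K η (Icc T T')) (hτ : 0 < τ) :
    Q.IsSolution 0 τ fun t => if t < T then g t else η t := by
  set γ : ℝ → E := fun t => if t < T then g t else η t
  have hγ1 : ∀ t, t ≤ T → γ t = g t := fun t ht => by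
    rcases ht.lt_or_eq with h | rfl
    · exact if_pos h
    · simp only [γ, lt_irrefl, if_false, hη0]
  have hγ2 : ∀ t, T ≤ t → γ t = η t := fun t ht => if_neg (not_lt.2 ht)
  obtain ⟨hsol, K₂, hK₂⟩ := hη (max T τ + 1) (by linarith [le_max_left T τ])
  have hlip : LipschitzOnWith (K + K₂) γ (Icc 0 τ) := by
    refine LipschitzOnWith.of_dist_le_mul fun s hs t ht => ?_
    wlog hst : s ≤ t generalizing s t
    · rw [dist_comm, dist_comm s]
      exact this t ht s hs (le_of_not_ge hst)
    have hmem : ∀ r ∈ Icc 0 τ, T ≤ r → r ∈ Icc T (max T τ + 1) := fun r hr h =>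
      ⟨h, by linarith [hr.2, le_max_right T τ]⟩
    have d1 : ∀ a b, a ≤ b → b ≤ T → dist (γ a) (γ b) ≤ K * (b - a) := fun a b hab hb => by
      rw [hγ1 a (hab.trans hb), hγ1 b hb]
      have := hg.dist_le_mul a b
      rwa [dist_comm a, Real.dist_eq, abs_of_nonneg (by linarith)] at this
    have d2 : ∀ a b, T ≤ a → a ≤ b → b ≤ max T τ + 1 → dist (γ a) (γ b) ≤ K₂ * (b - a) :=
      fun a b ha hab hb => by
        rw [hγ2 a ha, hγ2 b (ha.trans hab)]
        have := hK₂.dist_le_mul a ⟨ha, hab.trans hb⟩ b ⟨ha.trans hab, hb⟩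
        rwa [dist_comm a, Real.dist_eq, abs_of_nonneg (by linarith)] at this
    rw [dist_comm s, Real.dist_eq, abs_of_nonneg (by linarith), NNReal.coe_add]
    have hKn := K.coe_nonneg
    have hKn2 := K₂.coe_nonneg
    have htm : t ≤ max T τ + 1 := by linarith [ht.2, le_max_right T τ]
    rcases le_total t T with h | h
    · refine (d1 s t hst h).trans ?_
      nlinarith
    rcases le_total T s with h' | h'
    · refine (d2 s t h' hst htm).trans ?_
      nlinarith
    · refine (dist_triangle _ (γ T) _).trans ?_
      have h3 := d1 s T h' le_rfl
      have h4 := d2 T t le_rfl h htm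
      nlinarith
  refine ⟨?_, ?_⟩
  · rw [← uIcc_of_le hτ.le] at hlip
    exact hlip.absolutelyContinuousOnInterval
  · have hneT : ∀ᵐ t : ℝ, t ≠ T := by simp [ae_iff, measure_singleton]
    have hne0 : ∀ᵐ t : ℝ, t ≠ 0 := by simp [ae_iff, measure_singleton]
    filter_upwards [hgsol, hsol.2, hneT, hne0] with t h1 h2 hneT hne0 ht
    rcases lt_or_gt_of_ne hneT with h | h
    · obtain ⟨γ', hm, hd⟩ := h1 ⟨ht.1.lt_of_ne' hne0, h⟩
      refine ⟨γ', by rwa [hγ1 t h.le], hd.congr_of_eventuallyEq ?_⟩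
      filter_upwards [gt_mem_nhds h] with r hr
      exact hγ1 r hr.le
    · obtain ⟨γ', hm, hd⟩ := h2 ⟨h.le, by linarith [ht.2, le_max_right T τ]⟩
      refine ⟨γ', by rwa [hγ2 t h.le], hd.congr_of_eventuallyEq ?_⟩
      filter_upwards [lt_mem_nhds h] with r hr
      exact hγ2 r hr.le

/-- Limits of smoothed solutions solve the inclusion. The limit is taken along an ultrafilter and
only pointwise; the velocities of the limit are controlled by the mean value inclusion. -/
theorem IsRegular.deriv_mem_values_of_tendsto (hQ : Q.IsRegular) {𝓤 : Filter ℕ} [𝓤.NeBot]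
    (h𝓤 : 𝓤 ≤ atTop) {γ : ℕ → ℝ → E} {η : ℝ → E} {t₀ t b L : ℝ} (hL : 0 < L) (ht₀ : 0 ≤ t₀)
    (ht : t₀ < t) (htb : t < b)
    (hη : ∀ s ∈ Icc t b, Tendsto (fun k => γ k s) 𝓤 (𝓝 (η s)))
    (hac : ∀ᶠ k in 𝓤, AbsolutelyContinuousOnInterval (γ k) t b)
    (hγ : ∀ᶠ k in 𝓤, ∀ s ∈ Icc t b,
      HasDerivAt (γ k) (Q.rhs (Q.smoothMultiplier k (γ k s)) s (γ k s)) s)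
    (hlip : ∀ᶠ k in 𝓤, ∀ s ∈ Icc t b, ‖γ k s - γ k t‖ ≤ L * (s - t))
    {η' : E} (hd : HasDerivAt η η' t) : η' ∈ Q.values t (η t) := by
  refine mem_values_of_forall_mem_cthickening fun ε hε => ?_
  set K := Metric.cthickening ε (Q.values t (η t))
  have hKc : IsClosed K := Metric.isClosed_cthickening
  have h1 := (hQ.tendsto_modulus (ht₀.trans ht.le) (η t)).eventually (gt_mem_nhds hε)
  rw [eventually_nhdsWithin_iff, Metric.eventually_nhds_iff] at h1
  obtain ⟨δ₁, hδ₁, h1⟩ := h1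
  obtain ⟨pk, hpk, pb, hpb, h2⟩ :=
    eventually_prod_iff.1 (eventually_isSelection_smoothMultiplier Q (η t))
  obtain ⟨δ₂, hδ₂, hpb⟩ := Metric.eventually_nhds_iff.1 hpb
  set δ := min δ₁ δ₂
  have hδ : 0 < δ := lt_min hδ₁ hδ₂
  have hslope : Tendsto (slope η t) (𝓝[>] t) (𝓝 η') :=
    (hasDerivAt_iff_tendsto_slope.1 hd).mono_left
      (nhdsWithin_mono t fun s hs => (ne_of_gt hs : s ≠ t))
  refine hKc.mem_of_tendsto hslope ?_
  have hsmall : ∀ᶠ s in 𝓝[>] t, s < min b (t + min (δ / (2 * L)) δ) := by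
    refine (gt_mem_nhds ?_).filter_mono nhdsWithin_le_nhds
    refine lt_min htb ?_
    have : 0 < min (δ / (2 * L)) δ := by positivity
    linarith
  filter_upwards [hsmall, self_mem_nhdsWithin] with s hs hts
  have hts : t < s := hts
  have hsb : s ≤ b := (hs.trans_le (min_le_left _ _)).le
  have hs1 : s - t < δ / (2 * L) := by
    have := hs.trans_le ((min_le_right _ _).trans (add_le_add_right (min_le_left _ _) t))
    linarith
  have hs2 : s - t < δ := by
    have := hs.trans_le ((min_le_right _ _).trans (add_le_add_right (min_le_right _ _) t))
    linarith
  have hLs : L * (s - t) < δ / 2 := by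
    rw [lt_div_iff₀ (by positivity)] at hs1
    linarith
  have hlim : Tendsto (fun k => slope (γ k) t s) 𝓤 (𝓝 (slope η t s)) := by
    simp only [slope_def_module]
    exact ((hη s ⟨hts.le, hsb⟩).sub (hη t ⟨le_rfl, htb.le⟩)).const_smul _
  refine hKc.mem_of_tendsto hlim ?_
  have hnear : ∀ᶠ k in 𝓤, dist (γ k t) (η t) < δ / 2 :=
    (hη t ⟨le_rfl, htb.le⟩).eventually (Metric.ball_mem_nhds _ (by positivity))
  filter_upwards [hac, hγ, hlip, hnear, h𝓤 hpk] with k hac hγ hlip hnear hpk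
  refine slope_mem_of_ae_deriv_mem hts (absolutelyContinuousOnInterval_mono_Icc le_rfl hts.le hsb
    hac) ((convex_values _ _).cthickening ε) hKc (Eventually.of_forall fun r hr => ?_)
  have hrb : r ∈ Icc t b := ⟨hr.1, hr.2.trans hsb⟩
  have hdist : dist (γ k r) (η t) < δ := by
    have h3 := hlip r hrb
    have h4 : L * (r - t) ≤ L * (s - t) := by gcongr; exact hr.2
    have := dist_triangle (γ k r) (γ k t) (η t)
    rw [dist_eq_norm (γ k r) (γ k t)] at this
    linarith
  refine ⟨_, ?_, hγ r hrb⟩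
  refine rhs_mem_cthickening ?_ (h1 (y := (r, γ k r)) ?_ ⟨?_, mem_univ _⟩).le
  · exact h2 hpk (hpb (hdist.trans_le (min_le_right _ _)))
  · rw [Prod.dist_eq]
    refine max_lt ?_ (hdist.trans_le (min_le_left _ _))
    rw [Real.dist_eq, abs_of_nonneg (by linarith [hr.1])]
    have := min_le_left δ₁ δ₂
    linarith [hr.2]
  · exact (ht₀.trans ht.le).trans hr.1

variable [FiniteDimensional ℝ E]

/-- Forward existence from an arbitrary initial time. -/
theorem IsRegular.exists_isSolution (hQ : Q.IsRegular) (hb : Q.HasAprioriBound) {t₀ : ℝ}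
    (ht₀ : 0 ≤ t₀) (p₀ : E) :
    ∃ γ : ℝ → E, γ t₀ = p₀ ∧ ∀ T, t₀ < T → Q.IsSolution t₀ T γ ∧
      ∃ K, LipschitzOnWith K γ (Icc t₀ T) := by
  have : ProperSpace E := FiniteDimensional.proper ℝ E
  choose B hB using hb ‖p₀‖
  have hB' : ∀ T' (γ : ℝ → E), t₀ ≤ T' → Q.IsRelaxedSolution t₀ T' γ → γ t₀ = p₀ →
      ∀ t ∈ Icc t₀ T', ‖γ t‖ ≤ B T' := fun T' γ _ h h0 t ht =>
    hB T' t₀ t γ ht₀ ht.1 ht.2 (h.mono le_rfl ht.1 ht.2) (by rw [h0])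
  have hex := fun k : ℕ => hQ.exists_smoothed_solution ht₀
    (T := t₀ + k) (by linarith [Nat.cast_nonneg (α := ℝ) k]) k p₀ hB'
  choose γ h0 hac hγ hbd using hex
  set 𝓤 : Ultrafilter ℕ := hyperfilter ℕ
  have h𝓤 : (𝓤 : Filter ℕ) ≤ atTop := Nat.hyperfilter_le_atTop
  have hlate : ∀ T : ℝ, ∀ᶠ k : ℕ in (𝓤 : Filter ℕ), T < t₀ + k := fun T => by
    refine h𝓤 ?_
    filter_upwards [(tendsto_natCast_atTop_atTop (R := ℝ)).eventually_gt_atTop (T - t₀)] with k hk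
    linarith
  have hbd' : ∀ T, t₀ ≤ T → ∀ᶠ k in (𝓤 : Filter ℕ), ∀ t ∈ Icc t₀ T, ‖γ k t‖ ≤ B T :=
    fun T hT => by
      filter_upwards [hlate T] with k hk
      exact hbd k T ⟨hT, hk.le⟩
  have hlim : ∀ t, ∃ y, t₀ ≤ t → Tendsto (fun k => γ k t) 𝓤 (𝓝 y) := by
    intro t
    by_cases ht : t₀ ≤ t
    · have hmem : ∀ᶠ k in (𝓤 : Filter ℕ), γ k t ∈ Metric.closedBall (0 : E) (B t) := by
        filter_upwards [hbd' t ht] with k hk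
        simpa using hk t ⟨ht, le_rfl⟩
      obtain ⟨y, -, hy⟩ := (isCompact_closedBall (0 : E) (B t)).ultrafilter_le_nhds
        (𝓤.map fun k => γ k t) (le_principal_iff.2 hmem)
      exact ⟨y, fun _ => hy⟩
    · exact ⟨0, fun h => absurd h ht⟩
  choose η hη using hlim
  have hspeed : ∀ T, t₀ ≤ T → ∃ L : ℝ, 0 < L ∧ ∀ᶠ k in (𝓤 : Filter ℕ), ∀ s ∈ Icc t₀ T,
      ∀ t ∈ Icc t₀ T, dist (γ k s) (γ k t) ≤ L * dist s t := by
    intro T hT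
    obtain ⟨L, hL, hsp⟩ := hQ.exists_speed_bound (B T)
    refine ⟨L, hL, ?_⟩
    filter_upwards [hlate T, hbd' T hT] with k hk hkb s hs t ht
    have : LipschitzOnWith L.toNNReal (γ k) (Icc t₀ T) := by
      refine lipschitzOnWith_of_ae_norm_deriv_le
        (absolutelyContinuousOnInterval_mono_Icc le_rfl hT hk.le (hac k))
        (ae_mem_Icc_of_forall_mem_Ioo fun r hr => ⟨_, hγ k r ⟨hr.1, hr.2.trans hk⟩, ?_⟩)
      rw [Real.coe_toNNReal L hL.le]
      exact hsp r _ _ (ht₀.trans hr.1.le) (hkb r (Ioo_subset_Icc_self hr))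
        fun i => abs_smoothSign_le_one _
    have := this.dist_le_mul s hs t ht
    rwa [Real.coe_toNNReal L hL.le] at this
  have hηlip : ∀ T, t₀ ≤ T → ∃ K, LipschitzOnWith K η (Icc t₀ T) := by
    intro T hT
    obtain ⟨L, hL, h⟩ := hspeed T hT
    refine ⟨L.toNNReal, LipschitzOnWith.of_dist_le_mul fun s hs t ht => ?_⟩
    rw [Real.coe_toNNReal L hL.le]
    refine le_of_tendsto ((hη s hs.1).dist (hη t ht.1)) ?_
    filter_upwards [h] with k hk
    exact hk s hs t ht
  refine ⟨η, ?_, fun T hT => ⟨⟨?_, ?_⟩, hηlip T hT.le⟩⟩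
  · exact tendsto_nhds_unique (hη t₀ le_rfl) (by simp only [h0]; exact tendsto_const_nhds)
  · obtain ⟨K, hK⟩ := hηlip T hT.le
    rw [← uIcc_of_le hT.le] at hK
    exact hK.absolutelyContinuousOnInterval
  · obtain ⟨K, hK⟩ := hηlip T hT.le
    have hdiff := hK.ae_differentiableWithinAt_of_mem_real
    have hIoo := ae_mem_Icc_of_forall_mem_Ioo (a := t₀) (b := T) (p := fun t => t ∈ Ioo t₀ T)
      fun t ht => ht
    filter_upwards [hdiff, hIoo] with t h1 h2 ht
    have ht' := h2 ht
    have hd := ((h1 ht).differentiableAt (Icc_mem_nhds ht'.1 ht'.2)).hasDerivAt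
    obtain ⟨L, hL, h⟩ := hspeed T hT.le
    refine ⟨_, ?_, hd⟩
    refine hQ.deriv_mem_values_of_tendsto h𝓤 hL ht₀ ht'.1 (b := T) ht'.2
      (fun s hs => hη s (ht'.1.le.trans hs.1)) ?_ ?_ ?_ hd
    · filter_upwards [hlate T] with k hk
      exact absolutelyContinuousOnInterval_mono_Icc ht'.1.le ht'.2.le hk.le (hac k)
    · filter_upwards [hlate T] with k hk s hs
      exact hγ k s ⟨ht'.1.trans_le hs.1, hs.2.trans_lt hk⟩
    · filter_upwards [h] with k hk s hs
      have := hk s ⟨ht'.1.le.trans hs.1, hs.2⟩ t ht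
      rwa [dist_eq_norm, Real.dist_eq, abs_of_nonneg (by linarith [hs.1])] at this

/-- No finite escape: a solution on `[0, T)` has a limit at `T` and can be continued from there. -/
theorem IsRegular.exists_extension (hQ : Q.IsRegular) (hb : Q.HasAprioriBound) {T : ℝ}
    (hT : 0 < T) {γ : ℝ → E} (hγ : ∀ τ, 0 < τ → τ < T → Q.IsSolution 0 τ γ) :
    ∃ γ' : ℝ → E, (∀ τ, 0 < τ → Q.IsSolution 0 τ γ') ∧ EqOn γ' γ (Ico 0 T) := by
  have : ProperSpace E := FiniteDimensional.proper ℝ E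
  obtain ⟨B, hB⟩ := hb ‖γ 0‖ T
  have hbd : ∀ t ∈ Ico 0 T, ‖γ t‖ ≤ B := by
    intro t ht
    obtain ⟨r, hr1, hr2⟩ := exists_between ht.2
    exact hB 0 t γ le_rfl ht.1 ht.2.le ((hγ r (ht.1.trans_lt hr1) hr2).isRelaxedSolution.mono
      le_rfl ht.1 hr1.le) le_rfl
  obtain ⟨L, hL, hsp⟩ := hQ.exists_speed_bound B
  have hlip : LipschitzOnWith L.toNNReal γ (Ico 0 T) := by
    intro s hs t ht
    obtain ⟨r, hr1, hr2⟩ := exists_between (max_lt hs.2 ht.2)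
    have h0r : 0 < r := (hs.1.trans (le_max_left s t)).trans_lt hr1
    refine lipschitzOnWith_of_ae_norm_deriv_le (K := L.toNNReal) (hγ r h0r hr2).1 ?_
      ⟨hs.1, ((le_max_left s t).trans_lt hr1).le⟩ ⟨ht.1, ((le_max_right s t).trans_lt hr1).le⟩
    filter_upwards [(hγ r h0r hr2).2] with q hq hq'
    obtain ⟨_, ⟨σ, hσ, rfl⟩, hd⟩ := hq hq'
    refine ⟨_, hd, ?_⟩
    rw [Real.coe_toNNReal L hL.le]
    exact hsp q _ _ hq'.1 (hbd q ⟨hq'.1, hq'.2.trans_lt hr2⟩) fun i => (hσ i).1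
  obtain ⟨g, hg, hgγ⟩ := hlip.extend_finite_dimension
  obtain ⟨η, hη0, hη⟩ := hQ.exists_isSolution hb hT.le (g T)
  refine ⟨fun t => if t < T then g t else η t, fun τ hτ =>
    isSolution_concat hT hg ?_ hη0 hη hτ, fun t ht => ?_⟩
  · have hall : ∀ᵐ t : ℝ, ∀ n : ℕ, t ∈ Icc 0 (T - T / (n + 2)) →
        ∃ γ' ∈ Q.values t (γ t), HasDerivAt γ γ' t := by
      refine ae_all_iff.2 fun n => (hγ (T - T / (n + 2)) ?_ ?_).2
      · have : T / (n + 2) < T := div_lt_self hT (by linarith [Nat.cast_nonneg (α := ℝ) n])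
        linarith
      · have : 0 < T / ((n : ℝ) + 2) := by positivity
        linarith
    filter_upwards [hall] with t h ht
    obtain ⟨n, hn⟩ := exists_nat_gt (T / (T - t))
    have hTt : 0 < T - t := sub_pos.2 ht.2
    obtain ⟨γ', hm, hd⟩ := h n ⟨ht.1.le, by
      rw [div_lt_iff₀ hTt] at hn
      have : T / ((n : ℝ) + 2) ≤ T - t := by
        rw [div_le_iff₀ (by positivity)]
        nlinarith
      linarith⟩
    refine ⟨γ', by rwa [← hgγ ⟨ht.1.le, ht.2⟩], hd.congr_of_eventuallyEq ?_⟩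
    filter_upwards [Ioo_mem_nhds ht.1 ht.2] with r hr
    exact (hgγ ⟨hr.1.le, hr.2⟩).symm
  · simp only [ht.2, if_true]
    exact (hgγ ht).symm

end SwitchedSystem

/-! ### Quadratic forms -/

section QuadraticForms

variable {m : Type*} [Fintype m]

theorem posDef_of_symm_of_pos {M : Matrix m m ℝ} (hs : Mᵀ = M)
    (h : ∀ x, x ≠ 0 → 0 < x ⬝ᵥ (M *ᵥ x)) : M.PosDef :=
  Matrix.PosDef.of_dotProduct_mulVec_pos (by
    rwa [Matrix.IsHermitian, conjTranspose_eq_transpose_of_trivial])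
    fun x hx => by simpa using h x hx

theorem dotProduct_mulVec_comm_of_posDef {M : Matrix m m ℝ} (hM : M.PosDef) (x y : m → ℝ) :
    x ⬝ᵥ (M *ᵥ y) = y ⬝ᵥ (M *ᵥ x) := by
  have hs : Mᵀ = M := by simpa using hM.isHermitian.eq
  rw [dotProduct_mulVec, ← mulVec_transpose, hs, dotProduct_comm]

/-- A positive definite form dominates a multiple of the sum of squares. -/
theorem exists_mul_dotProduct_self_le {M : Matrix m m ℝ} (hM : M.PosDef) :
    ∃ c : ℝ, 0 < c ∧ ∀ x : m → ℝ, c * (x ⬝ᵥ x) ≤ x ⬝ᵥ (M *ᵥ x) := by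
  have hcont : Continuous fun x : m → ℝ => x ⬝ᵥ (M *ᵥ x) := by fun_prop
  have hpos : ∀ x : m → ℝ, x ≠ 0 → 0 < x ⬝ᵥ (M *ᵥ x) := fun x hx => by
    simpa using hM.dotProduct_mulVec_pos hx
  have hS : IsCompact {x : m → ℝ | x ⬝ᵥ x = 1} := by
    refine (isCompact_univ_pi fun _ : m =>
      isCompact_Icc (a := (-1 : ℝ)) (b := 1)).of_isClosed_subset
      (isClosed_eq (by fun_prop) continuous_const) fun x hx i _ => ?_
    have hx : ∑ i, x i * x i = 1 := hx
    have := Finset.single_le_sum (f := fun i => x i * x i) (fun i _ => mul_self_nonneg _)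
      (Finset.mem_univ i)
    simp only [hx] at this
    exact abs_le.1 (abs_le_one_iff_mul_self_le_one.2 this)
  have hscale : ∀ (x : m → ℝ), x ≠ 0 → ∃ r : ℝ, 0 < r ∧ r * r = x ⬝ᵥ x ∧
      (r⁻¹ • x) ⬝ᵥ (r⁻¹ • x) = 1 := fun x hx => by
    have h0 : 0 < x ⬝ᵥ x := by simpa using dotProduct_star_self_pos_iff.2 hx
    have hr := Real.sqrt_pos.2 h0
    have hrr := Real.mul_self_sqrt h0.le
    refine ⟨_, hr, hrr, ?_⟩
    simp only [smul_dotProduct, dotProduct_smul, smul_eq_mul]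
    nth_rewrite 3 [← hrr]
    field_simp
  rcases eq_empty_or_nonempty {x : m → ℝ | x ⬝ᵥ x = 1} with he | hne
  · refine ⟨1, one_pos, fun x => ?_⟩
    by_cases hx : x = 0
    · simp [hx]
    · obtain ⟨r, -, -, h⟩ := hscale x hx
      exact absurd (show _ ∈ {x : m → ℝ | x ⬝ᵥ x = 1} from h) (by rw [he]; simp)
  · obtain ⟨y, hy, hmin⟩ := hS.exists_isMinOn hne hcont.continuousOn
    have hy0 : y ≠ 0 := by rintro rfl; simp at hy
    refine ⟨_, hpos y hy0, fun x => ?_⟩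
    by_cases hx : x = 0
    · simp [hx]
    · obtain ⟨r, hr, hrr, h⟩ := hscale x hx
      have := isMinOn_iff.1 hmin _ h
      simp only [smul_dotProduct, mulVec_smul, dotProduct_smul, smul_eq_mul] at this
      rw [← hrr]
      calc _ ≤ (r⁻¹ * (r⁻¹ * x ⬝ᵥ (M *ᵥ x))) * (r * r) := by gcongr
        _ = _ := by field_simp

theorem exists_abs_bilin_le {l : Type*} [Fintype l] (M : Matrix m l ℝ) :
    ∃ C : ℝ, 0 < C ∧ ∀ (x : m → ℝ) (y : l → ℝ), |x ⬝ᵥ (M *ᵥ y)| ≤ C * (x ⬝ᵥ x + y ⬝ᵥ y) := by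
  refine ⟨1 + ∑ i, ∑ j, |M i j|, by positivity, fun x y => ?_⟩
  have h1 : ∀ i, x i * x i ≤ x ⬝ᵥ x := fun i =>
    Finset.single_le_sum (f := fun i => x i * x i) (fun i _ => mul_self_nonneg _)
      (Finset.mem_univ i)
  have h2 : ∀ j, y j * y j ≤ y ⬝ᵥ y := fun j =>
    Finset.single_le_sum (f := fun i => y i * y i) (fun i _ => mul_self_nonneg _)
      (Finset.mem_univ j)
  have h0 : 0 ≤ x ⬝ᵥ x + y ⬝ᵥ y := add_nonneg
    (Finset.sum_nonneg fun i _ => mul_self_nonneg _)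
    (Finset.sum_nonneg fun i _ => mul_self_nonneg _)
  calc |x ⬝ᵥ (M *ᵥ y)| = |∑ i, ∑ j, M i j * (x i * y j)| := by
        simp only [dotProduct, mulVec, Finset.mul_sum]
        congr 1
        exact Finset.sum_congr rfl fun i _ => Finset.sum_congr rfl fun j _ => by ring
    _ ≤ ∑ i, ∑ j, |M i j * (x i * y j)| :=
        (Finset.abs_sum_le_sum_abs _ _).trans
          (Finset.sum_le_sum fun i _ => Finset.abs_sum_le_sum_abs _ _)
    _ ≤ ∑ i, ∑ j, |M i j| * (x ⬝ᵥ x + y ⬝ᵥ y) := by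
        gcongr with i _ j _
        rw [abs_mul]
        gcongr
        rw [abs_mul]
        nlinarith [h1 i, h2 j, sq_nonneg (|x i| - |y j|), abs_mul_abs_self (x i),
          abs_mul_abs_self (y j), mul_self_nonneg (x i), mul_self_nonneg (y j)]
    _ = (∑ i, ∑ j, |M i j|) * (x ⬝ᵥ x + y ⬝ᵥ y) := by simp only [Finset.sum_mul]
    _ ≤ _ := by gcongr; linarith

/-- The form `∑ H i j (η i)ᵀ M (η j)` given by the Kronecker product of two positive definite
matrices is positive definite. -/
theorem exists_mul_le_sum_kronecker {l : Type*} [Fintype l] {H : Matrix l l ℝ} {M : Matrix m m ℝ}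
    (hH : H.PosDef) (hM : M.PosDef) :
    ∃ c : ℝ, 0 < c ∧ ∀ η : l → m → ℝ,
      c * ∑ i, η i ⬝ᵥ η i ≤ ∑ i, ∑ j, H i j * (η i ⬝ᵥ (M *ᵥ η j)) := by
  obtain ⟨c, hc, h⟩ := exists_mul_dotProduct_self_le (hH.kronecker hM)
  refine ⟨c, hc, fun η => ?_⟩
  have := h fun x => η x.1 x.2
  simp only [dotProduct, mulVec, Fintype.sum_prod_type, kroneckerMap_apply] at this ⊢
  refine this.trans_eq ?_
  refine Finset.sum_congr rfl fun i _ => ?_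
  simp only [Finset.mul_sum]
  rw [Finset.sum_comm]
  refine Finset.sum_congr rfl fun j _ => Finset.sum_congr rfl fun k _ =>
    Finset.sum_congr rfl fun k' _ => by ring

end QuadraticForms

/-! ### Lyapunov functions for Hurwitz matrices -/

section Lyapunov

open Polynomial in
/-- If `T` is a bounded operator and `s` a multiset of numbers in the open left half-plane, there
is a quadratic form that decreases along `ẋ = T x` up to an error caused by
`∏_{μ ∈ s} (T - μ) x`. Each factor `T - μ` adds the term `κ ‖y‖²` with `y` the product of the
earlier factors applied to `x`, since `ẏ = μ y + (T - μ) y`. -/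
theorem exists_lyapunov_form_of_multiset {V : Type*} [NormedAddCommGroup V]
    [InnerProductSpace ℂ V] (T : V →L[ℂ] V) (s : Multiset ℂ) (hs : ∀ μ ∈ s, μ.re < 0) :
    ∃ (B : V →ₗ[ℝ] V →ₗ[ℝ] ℝ) (K : ℝ), 0 < K ∧ (∀ x y, B x y = B y x) ∧ (∀ x, 0 ≤ B x x) ∧
      (∀ x, 2 * B x (T x) ≤ -‖x‖ ^ 2 +
        K * ‖aeval T (s.map fun μ => X - C μ).prod x‖ ^ 2) ∧
      ∀ x, ‖x‖ ^ 2 ≤ K * (B x x + ‖aeval T (s.map fun μ => X - C μ).prod x‖ ^ 2) := by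
  induction s using Multiset.induction with
  | empty => exact ⟨0, 1, one_pos, by simp, by simp, by simp, by simp⟩
  | cons μ s ih =>
    obtain ⟨B, K, hK, hsymm, hnonneg, hdec, hcoer⟩ :=
      ih fun ν hν => hs ν (Multiset.mem_cons_of_mem hν)
    set Y : V →L[ℂ] V := aeval T (s.map fun μ => X - C μ).prod with hY
    have hμ := hs μ (Multiset.mem_cons_self μ s)
    set a : ℝ := -μ.re with ha
    have ha0 : 0 < a := by linarith
    set Y' : V →ₗ[ℝ] V := (Y : V →ₗ[ℂ] V).restrictScalars ℝ
    have hprod : ∀ x, aeval T ((μ ::ₘ s).map fun μ => X - C μ).prod x = T (Y x) - μ • Y x := by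
      intro x
      rw [Multiset.map_cons, Multiset.prod_cons, map_mul, map_sub, aeval_X, aeval_C]
      simp [hY, Algebra.algebraMap_eq_smul_one]
    have hcomm : ∀ x, Y (T x) = T (Y x) := fun x => by
      have := (Commute.all (s.map fun μ => X - C μ).prod X).map (aeval (R := ℂ) T)
      rw [aeval_X] at this
      exact congrArg (fun Z : V →L[ℂ] V => Z x) this.eq
    set κ : ℝ := K / a with hκ
    have hκ0 : 0 < κ := by positivity
    let _ : InnerProductSpace ℝ V := InnerProductSpace.complexToReal
    have hinner : ∀ x y : V, inner ℝ x y = (inner ℂ x y).re := fun x y => rfl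
    refine ⟨B + κ • (innerₗ V).compl₁₂ Y' Y', K * (1 + 1 / κ) + κ / a, by positivity,
      ?_, ?_, ?_, ?_⟩
    · intro x y
      simp [Y', hsymm x y, real_inner_comm]
    · intro x
      have := hnonneg x
      have h2 := real_inner_self_nonneg (x := Y x)
      simp only [LinearMap.add_apply, LinearMap.smul_apply, LinearMap.compl₁₂_apply,
        innerₗ_apply_apply, smul_eq_mul]
      exact add_nonneg this (mul_nonneg hκ0.le h2)
    · intro x
      rw [hprod]
      set z := T (Y x) - μ • Y x with hz
      have hTY : T (Y x) = μ • Y x + z := by rw [hz]; abel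
      have h1 := hdec x
      have h2 : inner ℝ (Y x) (T (Y x)) = μ.re * ‖Y x‖ ^ 2 + inner ℝ (Y x) z := by
        have h0 : inner ℂ (Y x) (Y x) = ((‖Y x‖ ^ 2 : ℝ) : ℂ) := by
          rw [inner_self_eq_norm_sq_to_K]
          push_cast
          rfl
        rw [hTY, inner_add_right, hinner (Y x) (μ • Y x), inner_smul_right, h0,
          Complex.re_mul_ofReal]
      have h3 : inner ℝ (Y x) z ≤ ‖Y x‖ * ‖z‖ := real_inner_le_norm _ _
      have h4 : 2 * (‖Y x‖ * ‖z‖) ≤ a * ‖Y x‖ ^ 2 + ‖z‖ ^ 2 / a := by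
        have : a * ‖Y x‖ ^ 2 + ‖z‖ ^ 2 / a - 2 * (‖Y x‖ * ‖z‖) = (a * ‖Y x‖ - ‖z‖) ^ 2 / a := by
          field_simp
          ring
        have := div_nonneg (sq_nonneg (a * ‖Y x‖ - ‖z‖)) ha0.le
        linarith
      have h5 : κ * a = K := by rw [hκ]; field_simp
      simp only [LinearMap.add_apply, LinearMap.smul_apply, LinearMap.compl₁₂_apply,
        innerₗ_apply_apply, smul_eq_mul]
      change 2 * (B x (T x) + κ * inner ℝ (Y x) (Y (T x))) ≤ _
      rw [hcomm, h2]
      have h6 : κ * (2 * (μ.re * ‖Y x‖ ^ 2 + inner ℝ (Y x) z)) ≤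
          κ * (-(a * ‖Y x‖ ^ 2) + ‖z‖ ^ 2 / a) := by
        gcongr
        have : μ.re = -a := by rw [ha]; ring
        rw [this]
        linarith
      have h7 : 0 ≤ K * (1 + 1 / κ) * ‖z‖ ^ 2 := by positivity
      have h8 : κ * (-(a * ‖Y x‖ ^ 2) + ‖z‖ ^ 2 / a) = -(K * ‖Y x‖ ^ 2) + κ / a * ‖z‖ ^ 2 := by
        rw [← h5]; ring
      linarith
    · intro x
      rw [hprod]
      set z := T (Y x) - μ • Y x
      have h1 := hcoer x
      simp only [LinearMap.add_apply, LinearMap.smul_apply, LinearMap.compl₁₂_apply,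
        innerₗ_apply_apply, smul_eq_mul]
      change _ ≤ _ * (B x x + κ * inner ℝ (Y x) (Y x) + ‖z‖ ^ 2)
      rw [real_inner_self_eq_norm_sq]
      have hB := hnonneg x
      have e : K * (1 + 1 / κ) * (B x x + κ * ‖Y x‖ ^ 2) =
          K * (B x x + ‖Y x‖ ^ 2) + K * (1 / κ * B x x + κ * ‖Y x‖ ^ 2) := by
        field_simp
        ring
      have p1 : 0 ≤ K * (1 / κ * B x x + κ * ‖Y x‖ ^ 2) := by positivity
      have p2 : 0 ≤ κ / a * (B x x + κ * ‖Y x‖ ^ 2 + ‖z‖ ^ 2) := by positivity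
      have p3 : 0 ≤ K * (1 + 1 / κ) * ‖z‖ ^ 2 := by positivity
      linarith

open Polynomial in
/-- Lyapunov's theorem for Hurwitz matrices. -/
theorem IsHurwitz.exists_lyapunov {m : ℕ} {A : Matrix (Fin m) (Fin m) ℝ} (hA : IsHurwitz A) :
    ∃ R : Matrix (Fin m) (Fin m) ℝ, R.PosDef ∧
      ∀ x, 2 * (x ⬝ᵥ (R *ᵥ (A *ᵥ x))) ≤ -(x ⬝ᵥ x) := by
  set M : Matrix (Fin m) (Fin m) ℂ := A.map (fun r : ℝ => (r : ℂ)) with hM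
  set T := toEuclideanCLM (𝕜 := ℂ) M
  obtain ⟨B, K, hK, hsymm, hnonneg, hdec, hcoer⟩ :=
    exists_lyapunov_form_of_multiset T M.charpoly.roots fun μ hμ => by
      refine hA μ (mem_spectrum_of_isRoot_charpoly ?_)
      exact (mem_roots'.1 hμ).2
  have hzero : aeval T (M.charpoly.roots.map fun μ => X - C μ).prod = 0 := by
    rw [← (IsAlgClosed.splits M.charpoly).eq_prod_roots_of_monic M.charpoly_monic]
    have h := aeval_algHom_apply (toEuclideanCLM (n := Fin m) (𝕜 := ℂ)) M M.charpoly
    rw [h, aeval_self_charpoly, map_zero]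
  simp only [hzero, _root_.zero_apply, norm_zero] at hdec hcoer
  -- the real vectors sit inside the complex ones
  let J : (Fin m → ℝ) →ₗ[ℝ] EuclideanSpace ℂ (Fin m) :=
    { toFun := fun x => WithLp.toLp 2 fun i => (x i : ℂ)
      map_add' := fun x y => by ext i; simp
      map_smul' := fun c x => by ext i; simp }
  have hJ : ∀ x, ‖J x‖ ^ 2 = x ⬝ᵥ x := fun x => by
    rw [EuclideanSpace.norm_sq_eq]
    simp [J, dotProduct, sq]
  have hTJ : ∀ x, T (J x) = J (A *ᵥ x) := fun x => by
    ext i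
    simp only [T, ofLp_toEuclideanCLM, J, LinearMap.coe_mk, AddHom.coe_mk, hM, mulVec, dotProduct,
      Matrix.map_apply]
    push_cast
    rfl
  set R := LinearMap.BilinForm.toMatrix' (B.compl₁₂ J J) with hR
  have hRB : ∀ x y, x ⬝ᵥ (R *ᵥ y) = B (J x) (J y) := fun x y => by
    rw [← toBilin'_apply', hR, toBilin'_toMatrix', LinearMap.compl₁₂_apply]
  refine ⟨R, posDef_of_symm_of_pos ?_ fun x hx => ?_, fun x => ?_⟩
  · ext i j
    simp only [transpose_apply, hR, LinearMap.BilinForm.toMatrix'_apply, LinearMap.compl₁₂_apply]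
    exact hsymm _ _
  · rw [hRB]
    have h0 : 0 < x ⬝ᵥ x := by simpa using dotProduct_star_self_pos_iff.2 hx
    have := hcoer (J x)
    rw [hJ] at this
    by_contra hcon
    nlinarith
  · rw [hRB, ← hTJ, ← hJ]
    have := hdec (J x)
    linarith

end Lyapunov

/-! ### Existence of admissible gain matrices -/

section Admissible

variable {n : ℕ} (L : Leader n)

theorem Leader.S_mulVec (x : Fin n → ℝ) (k : Fin n) :
    (L.S *ᵥ x) k = if h : (k : ℕ) + 1 < n then x ⟨(k : ℕ) + 1, h⟩ else ∑ j, L.s j * x j := by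
  simp only [mulVec, dotProduct, Leader.S, of_apply]
  by_cases hk : (k : ℕ) + 1 = n
  · simp [hk]
  · have h : (k : ℕ) + 1 < n := by omega
    rw [dif_pos h, Finset.sum_eq_single ⟨(k : ℕ) + 1, h⟩]
    · simp [hk]
    · intro j _ hj
      have : ¬ (j : ℕ) = (k : ℕ) + 1 := fun e => hj (Fin.ext e)
      simp [hk, this]
    · simp

/-- The companion matrix of `(X + 1) ^ n` is Hurwitz. -/
theorem isHurwitz_companion_binomial (hn : 0 < n) (c : ℝ) :
    IsHurwitz (Leader.S (n := n) ⟨fun j => -(n.choose j : ℝ), c⟩) := by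
  intro μ hμ
  set M : Matrix (Fin n) (Fin n) ℂ :=
    (Leader.S (n := n) ⟨fun j => -(n.choose j : ℝ), c⟩).map (fun r : ℝ => (r : ℂ)) with hM
  rw [← spectrum_toLin', ← Module.End.hasEigenvalue_iff_mem_spectrum] at hμ
  obtain ⟨v, hv⟩ := hμ.exists_hasEigenvector
  have hMv : ∀ k, (M *ᵥ v) k = μ * v k := fun k => by
    have := congrFun hv.apply_eq_smul k
    simpa [toLin'_apply] using this
  have hrow : ∀ k : Fin n, ∀ h : (k : ℕ) + 1 < n, v ⟨(k : ℕ) + 1, h⟩ = μ * v k := by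
    intro k h
    rw [← hMv]
    simp only [mulVec, dotProduct, hM, Matrix.map_apply, Leader.S, of_apply, h.ne, if_false]
    rw [Finset.sum_eq_single ⟨(k : ℕ) + 1, h⟩]
    · simp
    · intro j _ hj
      have : ¬ (j : ℕ) = (k : ℕ) + 1 := fun e => hj (Fin.ext e)
      simp [this]
    · simp
  have hpow : ∀ k : ℕ, ∀ h : k < n, v ⟨k, h⟩ = μ ^ k * v ⟨0, hn⟩ := by
    intro k
    induction k with
    | zero => simp
    | succ k ih =>
      intro h
      rw [hrow ⟨k, by omega⟩ h, ih (by omega)]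
      ring
  have hv0 : v ⟨0, hn⟩ ≠ 0 := by
    intro h0
    refine hv.2 (funext fun k => ?_)
    rw [show v k = v ⟨k, k.2⟩ from rfl, hpow k k.2, h0]
    simp
  have hlast := hMv ⟨n - 1, by omega⟩
  have hn1 : n - 1 + 1 = n := by omega
  simp only [mulVec, dotProduct, hM, Matrix.map_apply, Leader.S, of_apply, hn1, if_true] at hlast
  have hsum : ∑ j : Fin n, -((n.choose j : ℂ)) * μ ^ (j : ℕ) = μ ^ n := by
    refine mul_right_cancel₀ hv0 ?_
    rw [Finset.sum_mul]
    have e : μ ^ n * v ⟨0, hn⟩ = μ * v ⟨n - 1, by omega⟩ := by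
      rw [hpow (n - 1), ← mul_assoc, ← pow_succ', hn1]
    rw [e, ← hlast]
    refine Finset.sum_congr rfl fun j _ => ?_
    rw [show v j = v ⟨j, j.2⟩ from rfl, hpow j j.2]
    push_cast
    ring
  have hbin : (μ + 1) ^ n = 0 := by
    rw [add_pow, Finset.sum_range_succ, ← Fin.sum_univ_eq_sum_range
      (fun k => μ ^ k * 1 ^ (n - k) * (n.choose k : ℂ)) n]
    simp only [one_pow, mul_one, Nat.choose_self, Nat.cast_one]
    conv_lhs => rw [← hsum]
    rw [← Finset.sum_add_distrib]
    exact Finset.sum_eq_zero fun j _ => by ring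
  have : μ = -1 := eq_neg_of_add_eq_zero_left (pow_eq_zero_iff hn.ne' |>.1 hbin)
  simp [this]

/-- A feedback `K x` through `d` places all eigenvalues of `S - d K` at `-1`. If `R` is a Lyapunov
matrix of `S - d K`, then a large multiple of `R` is admissible, since the cross term with `K x`
is dominated by the square of `dᵀ R x`. -/
theorem Leader.exists_admissible [NeZero n] (hd : L.dLast ≠ 0) : ∃ P, L.Admissible P := by
  set s' : Fin n → ℝ := fun j => -(n.choose j : ℝ) with hs'
  set Lc : Leader n := ⟨s', L.dLast⟩ with hLc
  obtain ⟨R, hR, hlyap⟩ := (isHurwitz_companion_binomial (NeZero.pos n) L.dLast).exists_lyapunov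
  set κ : Fin n → ℝ := fun j => (L.s j - s' j) / L.dLast with hκ
  have hSx : ∀ x, L.S *ᵥ x = Lc.S *ᵥ x + (κ ⬝ᵥ x) • L.d := by
    intro x
    ext k
    rw [Pi.add_apply, Leader.S_mulVec, Leader.S_mulVec, Pi.smul_apply, smul_eq_mul, Leader.d]
    by_cases hk : (k : ℕ) + 1 < n
    · simp [hk, hk.ne]
    · have hk' : (k : ℕ) + 1 = n := by omega
      simp only [hk', lt_irrefl, dif_neg, not_false_eq_true, if_true, dotProduct, hκ, hLc,
        Finset.sum_mul]
      rw [← Finset.sum_add_distrib]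
      refine Finset.sum_congr rfl fun j _ => ?_
      field_simp
      ring
  obtain ⟨C, hC, hCb⟩ := exists_abs_bilin_le (vecMulVec κ κ)
  have hκx : ∀ x, (κ ⬝ᵥ x) ^ 2 ≤ 2 * C * (x ⬝ᵥ x) := fun x => by
    have h1 := (le_abs_self _).trans (hCb x x)
    rw [vecMulVec_mulVec, dotProduct_smul, dotProduct_comm x κ] at h1
    simp only [MulOpposite.smul_eq_mul_unop, MulOpposite.unop_op] at h1
    nlinarith
  have hRs : Rᵀ = R := by simpa using hR.isHermitian.eq
  set ν : ℝ := 2 * C + 1 with hν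
  have hν0 : 0 < ν := by positivity
  refine ⟨ν • R, hR.smul hν0, posDef_of_symm_of_pos ?_ fun x hx => ?_⟩
  · simp only [transpose_sub, transpose_smul, transpose_mul, transpose_add, transpose_transpose,
      hRs, transpose_vecMulVec, ← Matrix.mul_assoc, add_comm]
  · have h0 : 0 < x ⬝ᵥ x := by simpa using dotProduct_star_self_pos_iff.2 hx
    set φ : ℝ := L.d ⬝ᵥ (R *ᵥ x) with hφ
    have e1 : x ⬝ᵥ ((R * vecMulVec L.d L.d * R) *ᵥ x) = φ ^ 2 := by
      rw [← mulVec_mulVec, ← mulVec_mulVec, vecMulVec_mulVec, mulVec_smul, dotProduct_smul,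
        dotProduct_mulVec_comm_of_posDef hR x L.d]
      simp only [MulOpposite.smul_eq_mul_unop, MulOpposite.unop_op]
      rw [sq]
    have e2 : x ⬝ᵥ ((R * L.S) *ᵥ x) = x ⬝ᵥ (R *ᵥ (Lc.S *ᵥ x)) + (κ ⬝ᵥ x) * φ := by
      rw [← mulVec_mulVec, hSx, mulVec_add, mulVec_smul, dotProduct_add, dotProduct_smul,
        smul_eq_mul, dotProduct_mulVec_comm_of_posDef hR x L.d]
    have e3 : x ⬝ᵥ ((L.Sᵀ * R) *ᵥ x) = x ⬝ᵥ ((R * L.S) *ᵥ x) := by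
      rw [← mulVec_mulVec, ← mulVec_mulVec, mulVec_transpose, dotProduct_comm,
        ← dotProduct_mulVec, dotProduct_mulVec_comm_of_posDef hR x, dotProduct_comm]
    have e4 : x ⬝ᵥ (((2 : ℝ) • (ν • R * vecMulVec L.d L.d * ν • R) -
        (L.Sᵀ * ν • R + ν • R * L.S)) *ᵥ x) =
        ν * (2 * ν * φ ^ 2 - 2 * (x ⬝ᵥ ((R * L.S) *ᵥ x))) := by
      simp only [sub_mulVec, add_mulVec, smul_mulVec, dotProduct_sub, dotProduct_add,
        dotProduct_smul, Matrix.mul_smul, Matrix.smul_mul, smul_eq_mul, e1, e3]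
      ring
    rw [e4, e2]
    refine mul_pos hν0 ?_
    have h1 := hlyap x
    have h2 := hκx x
    have h3 : 2 * (κ ⬝ᵥ x * φ) ≤ (κ ⬝ᵥ x) ^ 2 / (4 * C) + 4 * C * φ ^ 2 := by
      have : (κ ⬝ᵥ x) ^ 2 / (4 * C) + 4 * C * φ ^ 2 - 2 * (κ ⬝ᵥ x * φ) =
          (κ ⬝ᵥ x - 4 * C * φ) ^ 2 / (4 * C) := by
        field_simp
        ring
      have := div_nonneg (sq_nonneg (κ ⬝ᵥ x - 4 * C * φ)) (by positivity : 0 ≤ 4 * C)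
      linarith
    have h4 : (κ ⬝ᵥ x) ^ 2 / (4 * C) ≤ (x ⬝ᵥ x) / 2 := by
      rw [div_le_div_iff₀ (by positivity) (by positivity)]
      nlinarith
    have h5 : 0 ≤ φ ^ 2 := sq_nonneg φ
    rw [hν]
    nlinarith

end Admissible

/-! ### The grounded Laplacian -/

section Laplacian

variable {N : ℕ} (a : Matrix (Fin (N + 1)) (Fin (N + 1)) ℝ)

/-- The matrix obtained from the graph Laplacian by deleting the row and column of the leader. -/
def groundedLaplacian : Matrix (Fin N) (Fin N) ℝ :=
  Matrix.of fun i j =>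
    (if i = j then a i.succ 0 + ∑ k : Fin N, a i.succ k.succ else 0) - a i.succ j.succ

theorem sum_groundedLaplacian_smul {V : Type*} [AddCommGroup V] [Module ℝ V] (y : Fin N → V)
    (i : Fin N) : ∑ j, groundedLaplacian a i j • y j =
      a i.succ 0 • y i + ∑ j : Fin N, a i.succ j.succ • (y i - y j) := by
  simp only [groundedLaplacian, of_apply, sub_smul, ite_smul, zero_smul, Finset.sum_sub_distrib,
    Finset.sum_ite_eq, Finset.mem_univ, if_true, add_smul, smul_sub, Finset.sum_smul]
  abel

variable {a}

theorem IsConnectedGraph.groundedLaplacian_posDef (ha : IsConnectedGraph a) :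
    (groundedLaplacian a).PosDef := by
  have hform : ∀ y : Fin N → ℝ, 2 * (y ⬝ᵥ (groundedLaplacian a *ᵥ y)) =
      2 * ∑ i : Fin N, a i.succ 0 * y i ^ 2 +
        ∑ i : Fin N, ∑ j : Fin N, a i.succ j.succ * (y i - y j) ^ 2 := by
    intro y
    have h1 : y ⬝ᵥ (groundedLaplacian a *ᵥ y) = ∑ i : Fin N, a i.succ 0 * y i ^ 2 +
        ∑ i : Fin N, ∑ j : Fin N, a i.succ j.succ * (y i * (y i - y j)) := by
      simp only [dotProduct, mulVec]
      rw [← Finset.sum_add_distrib]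
      refine Finset.sum_congr rfl fun i _ => ?_
      have := sum_groundedLaplacian_smul a y i
      simp only [smul_eq_mul] at this
      rw [this, mul_add, Finset.mul_sum]
      congr 1
      · ring
      · exact Finset.sum_congr rfl fun j _ => by ring
    have h2 : ∑ i : Fin N, ∑ j : Fin N, a i.succ j.succ * (y i * (y i - y j)) =
        ∑ i : Fin N, ∑ j : Fin N, a i.succ j.succ * (y j * (y j - y i)) := by
      rw [Finset.sum_comm]
      refine Finset.sum_congr rfl fun i _ => Finset.sum_congr rfl fun j _ => ?_
      rw [ha.undirected]
    have h3 : ∑ i : Fin N, ∑ j : Fin N, a i.succ j.succ * (y i - y j) ^ 2 =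
        ∑ i : Fin N, ∑ j : Fin N, a i.succ j.succ * (y i * (y i - y j)) +
          ∑ i : Fin N, ∑ j : Fin N, a i.succ j.succ * (y j * (y j - y i)) := by
      simp only [← Finset.sum_add_distrib]
      exact Finset.sum_congr rfl fun i _ => Finset.sum_congr rfl fun j _ => by ring
    rw [h1, h3, ← h2]
    ring
  refine posDef_of_symm_of_pos ?_ fun y hy => ?_
  · ext i j
    simp only [transpose_apply, groundedLaplacian, of_apply, ha.undirected j i, eq_comm (a := j)]
    by_cases h : i = j
    · subst h; rfl
    · simp [h]
  · have n1 : ∀ i : Fin N, 0 ≤ a i.succ 0 * y i ^ 2 := fun i =>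
      mul_nonneg (ha.nonneg _ _) (sq_nonneg _)
    have n2 : ∀ i j : Fin N, 0 ≤ a i.succ j.succ * (y i - y j) ^ 2 := fun i j =>
      mul_nonneg (ha.nonneg _ _) (sq_nonneg _)
    have s1 := Finset.sum_nonneg fun i (_ : i ∈ Finset.univ) => n1 i
    have s2 := Finset.sum_nonneg fun i (_ : i ∈ Finset.univ) =>
      Finset.sum_nonneg fun j (_ : j ∈ Finset.univ) => n2 i j
    have hf := hform y
    by_contra hcon
    have z1 : ∑ i : Fin N, a i.succ 0 * y i ^ 2 = 0 := by linarith
    have z2 : ∑ i : Fin N, ∑ j : Fin N, a i.succ j.succ * (y i - y j) ^ 2 = 0 := by linarith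
    have e1 := (Finset.sum_eq_zero_iff_of_nonneg fun i _ => n1 i).1 z1
    have e2 : ∀ i j : Fin N, a i.succ j.succ * (y i - y j) ^ 2 = 0 := fun i j =>
      (Finset.sum_eq_zero_iff_of_nonneg fun j _ => n2 i j).1
        ((Finset.sum_eq_zero_iff_of_nonneg fun i _ => Finset.sum_nonneg fun j _ => n2 i j).1 z2 i
          (Finset.mem_univ i)) j (Finset.mem_univ j)
    -- `y`, extended by `0` to the leader, vanishes along every path from the leader
    have hpath : ∀ p, (Fin.cons 0 y : Fin (N + 1) → ℝ) p = 0 := by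
      intro p
      induction ha.connected p with
      | refl => simp
      | @tail q r _ hqr ih =>
        rcases Fin.eq_zero_or_eq_succ r with rfl | ⟨i, rfl⟩
        · rw [ha.leader] at hqr
          exact absurd hqr (lt_irrefl _)
        · rw [Fin.cons_succ]
          rcases Fin.eq_zero_or_eq_succ q with rfl | ⟨j, rfl⟩
          · have := (mul_eq_zero.1 (e1 i (Finset.mem_univ i))).resolve_left hqr.ne'
            exact pow_eq_zero_iff two_ne_zero |>.1 this
          · rw [Fin.cons_succ] at ih
            have := (mul_eq_zero.1 (e2 i j)).resolve_left hqr.ne'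
            have := pow_eq_zero_iff two_ne_zero |>.1 this
            linarith
    exact hy (funext fun i => by simpa using hpath i.succ)

end Laplacian

/-! ### The closed loop as a switched system -/

section Loop

variable {N n : ℕ} (L : Leader n) (A : Followers N) (a : Matrix (Fin (N + 1)) (Fin (N + 1)) ℝ)
  (P : Matrix (Fin n) (Fin n) ℝ)

/-- The last line of the dynamic extension with the number `s` in place of the sign. -/
noncomputable def lastLineWith (s : ℝ) (xh xv : EuclideanSpace ℝ (Fin n)) (θ : ℝ) : ℝ :=
  ∑ j, L.s j * xh j - L.dLast * θ * feedback L P xv - L.dLast * θ * s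

/-- The closed loop with numbers `σ i` in place of the signs and `c` in place of the leader's
input. -/
noncomputable def closedLoopWith (σ : Fin N → ℝ) (c : ℝ) (p : State A n) : State A n :=
  (fun i => A.zField i (zOf p i) (xOf p i),
   fun i => A.xField i (zOf p i) (xOf p i) (-A.g i (ξOf p i) (xOf p i) +
     if h : 0 < n - A.nx i then xcOf p i ⟨0, h⟩
     else lastLineWith L P (σ i) (xhatOf p i) (xvOf a p i) (θOf p i)),
   fun i => WithLp.toLp 2 fun k =>
     if h : (k : ℕ) + 1 < n - A.nx i then xcOf p i ⟨(k : ℕ) + 1, h⟩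
     else lastLineWith L P (σ i) (xhatOf p i) (xvOf a p i) (θOf p i),
   fun i => θField L P (xvOf a p i),
   fun i => A.zField i (ξOf p i) (xOf p i),
   L.field c (wOf p))

/-- The unit vector of the state component `x̂_{in}`, which is the last compensator state, or the
last state of the chain of follower `i` if there is no compensator. -/
noncomputable def lastUnit (n : ℕ) (i : Fin N) : State A n :=
  (0, fun j => WithLp.toLp 2 fun k => if j = i ∧ (k : ℕ) + 1 = A.nx j ∧ n ≤ A.nx j then 1 else 0,
    fun j => WithLp.toLp 2 fun k => if j = i ∧ (k : ℕ) + 1 = n - A.nx j then 1 else 0, 0, 0, 0)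

variable {A}

theorem xhat_add (i : Fin N) (x y : EuclideanSpace ℝ (Fin (A.nx i)))
    (xc yc : EuclideanSpace ℝ (Fin (n - A.nx i))) :
    xhat A i (x + y) (xc + yc) = xhat A i x xc + xhat A i y yc := by
  ext k
  simp only [xhat, PiLp.add_apply]
  split_ifs <;> rfl

theorem xhat_smul (i : Fin N) (r : ℝ) (x : EuclideanSpace ℝ (Fin (A.nx i)))
    (xc : EuclideanSpace ℝ (Fin (n - A.nx i))) :
    xhat A i (r • x) (r • xc) = r • xhat A i x xc := by
  ext k
  simp only [xhat, PiLp.smul_apply]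
  split_ifs <;> rfl

/-- The vector `x̂_i` as a linear function of the state. -/
noncomputable def xhatL (i : Fin N) : State A n →ₗ[ℝ] EuclideanSpace ℝ (Fin n) where
  toFun p := xhatOf p i
  map_add' _ _ := xhat_add i _ _ _ _
  map_smul' r _ := xhat_smul i r _ _

/-- The leader's state as a linear function of the state. -/
noncomputable def wL : State A n →ₗ[ℝ] EuclideanSpace ℝ (Fin n) where
  toFun p := wOf p
  map_add' _ _ := rfl
  map_smul' _ _ := rfl

/-- The synchronization error `x̂_i - w` as a linear function of the state. -/
noncomputable def errL (i : Fin N) : State A n →ₗ[ℝ] (Fin n → ℝ) :=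
  (WithLp.linearEquiv 2 ℝ (Fin n → ℝ)).toLinearMap ∘ₗ (xhatL i - wL)

/-- The observation error `ξ_i - z_i` as a linear function of the state. -/
noncomputable def obsL (i : Fin N) : State A n →ₗ[ℝ] (Fin (A.nz i) → ℝ) where
  toFun p := (ξOf p i).ofLp - (zOf p i).ofLp
  map_add' p q := by
    change ((p.2.2.2.2.1 i).ofLp + (q.2.2.2.2.1 i).ofLp) - ((p.1 i).ofLp + (q.1 i).ofLp) = _
    simp only [ξOf, zOf]
    abel
  map_smul' r p := by
    change (r • (p.2.2.2.2.1 i).ofLp) - (r • (p.1 i).ofLp) = _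
    simp only [ξOf, zOf, RingHom.id_apply, smul_sub]

/-- The gain `θ_i` as a linear function of the state. -/
noncomputable def gainL (i : Fin N) : State A n →ₗ[ℝ] ℝ where
  toFun p := θOf p i
  map_add' _ _ := rfl
  map_smul' _ _ := rfl

/-- The state `z_i` as a linear function of the state of the closed loop. -/
noncomputable def zL (i : Fin N) : State A n →ₗ[ℝ] (Fin (A.nz i) → ℝ) where
  toFun p := (zOf p i).ofLp
  map_add' _ _ := rfl
  map_smul' _ _ := rfl

theorem errL_apply (i : Fin N) (p : State A n) (k : Fin n) :
    errL i p k = xhatOf p i k - wOf p k := rfl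

theorem xvOf_ofLp (p : State A n) (i : Fin N) :
    (xvOf a p i).ofLp = ∑ j, groundedLaplacian a i j • errL j p := by
  rw [sum_groundedLaplacian_smul]
  ext k
  simp only [xvOf, WithLp.ofLp_add, WithLp.ofLp_smul, WithLp.ofLp_sub, WithLp.ofLp_sum,
    Pi.add_apply, Finset.sum_apply, Pi.smul_apply, Pi.sub_apply, errL_apply,
    sub_sub_sub_cancel_right]

/-- The switching function `dᵀ P x̂_{vi}` as a linear function of the state. -/
noncomputable def feedbackL (i : Fin N) : State A n →ₗ[ℝ] ℝ :=
  dotProductBilin ℝ ℝ L.d ∘ₗ P.mulVecLin ∘ₗ ∑ j, groundedLaplacian a i j • errL j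

theorem feedbackL_apply (i : Fin N) (p : State A n) :
    feedbackL L a P i p = feedback L P (xvOf a p i) := by
  rw [feedback, xvOf_ofLp]
  simp only [feedbackL, LinearMap.comp_apply, LinearMap.sum_apply, LinearMap.smul_apply,
    mulVecLin_apply]
  rfl

set_option synthInstance.maxSize 4000 in
set_option synthInstance.maxHeartbeats 400000 in
instance : (volume : Measure (State A n)).IsOpenPosMeasure := inferInstance

theorem errL_closedLoopWith (hdeg : ∀ i, A.nx i ≤ n) (hx : ∀ i, 1 ≤ A.nx i) (σ : Fin N → ℝ) (c : ℝ)
    (p : State A n) (i : Fin N) (k : Fin n) :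
    errL i (closedLoopWith L A a P σ c p) k = (L.S *ᵥ errL i p) k -
      (θOf p i * feedback L P (xvOf a p i) + θOf p i * σ i + c) * L.d k +
      (A.g i (zOf p i) (xOf p i) - A.g i (ξOf p i) (xOf p i)) *
        (if (k : ℕ) + 1 = A.nx i then 1 else 0) := by
  have hSw : (L.S *ᵥ errL i p) k = (L.S *ᵥ (xhatOf p i).ofLp) k - (L.S *ᵥ (wOf p).ofLp) k := by
    rw [← Pi.sub_apply, ← mulVec_sub]; rfl
  have hw : wOf (closedLoopWith L A a P σ c p) k = (L.S *ᵥ (wOf p).ofLp) k + c * L.d k := rfl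
  have hlast : lastLineWith L P (σ i) (xhatOf p i) (xvOf a p i) (θOf p i) =
      ∑ j, L.s j * xhatOf p i j -
        (θOf p i * feedback L P (xvOf a p i) + θOf p i * σ i) * L.dLast := by
    rw [lastLineWith]; ring
  have hdn := hdeg i
  have hx1 := hx i
  rw [errL_apply, hw, hSw, Leader.S_mulVec L (xhatOf p i).ofLp]
  suffices h : xhatOf (closedLoopWith L A a P σ c p) i k =
      (if h : (k : ℕ) + 1 < n then xhatOf p i ⟨(k : ℕ) + 1, h⟩ else ∑ j, L.s j * xhatOf p i j) -
      (θOf p i * feedback L P (xvOf a p i) + θOf p i * σ i) * L.d k +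
      (A.g i (zOf p i) (xOf p i) - A.g i (ξOf p i) (xOf p i)) *
        (if (k : ℕ) + 1 = A.nx i then 1 else 0) by
    rw [h]; ring
  have hk := k.2
  by_cases h1 : (k : ℕ) < A.nx i
  · have e1 : xhatOf (closedLoopWith L A a P σ c p) i k =
        if h : (k : ℕ) + 1 < A.nx i then xOf p i ⟨(k : ℕ) + 1, h⟩ else
          (-A.g i (ξOf p i) (xOf p i) + if h : 0 < n - A.nx i then xcOf p i ⟨0, h⟩
            else lastLineWith L P (σ i) (xhatOf p i) (xvOf a p i) (θOf p i))
            + A.g i (zOf p i) (xOf p i) := by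
      simp only [xhatOf, xhat, h1, dif_pos]
      rfl
    rw [e1]
    by_cases h2 : (k : ℕ) + 1 < A.nx i
    · have h3 : (k : ℕ) + 1 < n := by omega
      have e2 : xhatOf p i ⟨(k : ℕ) + 1, h3⟩ = xOf p i ⟨(k : ℕ) + 1, h2⟩ := by
        simp only [xhatOf, xhat, h2, dif_pos]
      rw [dif_pos h2, dif_pos h3, e2, if_neg h2.ne, Leader.d, if_neg h3.ne]
      ring
    · have h4 : (k : ℕ) + 1 = A.nx i := by omega
      rw [dif_neg h2, if_pos h4]
      by_cases h5 : 0 < n - A.nx i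
      · have h3 : (k : ℕ) + 1 < n := by omega
        have e2 : xhatOf p i ⟨(k : ℕ) + 1, h3⟩ = xcOf p i ⟨0, h5⟩ := by
          simp only [xhatOf, xhat, h2, dif_neg, not_false_eq_true]
          exact congrArg (xcOf p i).ofLp (Fin.ext (by simp only []; omega))
        rw [dif_pos h5, dif_pos h3, e2, Leader.d, if_neg h3.ne]
        ring
      · have h3 : ¬ (k : ℕ) + 1 < n := by omega
        rw [dif_neg h5, dif_neg h3, hlast, Leader.d, if_pos (by omega)]
        ring
  · have hkn : (k : ℕ) - A.nx i < n - A.nx i := by omega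
    have e1 : xhatOf (closedLoopWith L A a P σ c p) i k =
        if h : (k : ℕ) - A.nx i + 1 < n - A.nx i then xcOf p i ⟨(k : ℕ) - A.nx i + 1, h⟩
        else lastLineWith L P (σ i) (xhatOf p i) (xvOf a p i) (θOf p i) := by
      simp only [xhatOf, xhat, h1, dif_neg, not_false_eq_true]
      rfl
    have h4 : ¬ (k : ℕ) + 1 = A.nx i := by omega
    rw [e1, if_neg h4]
    by_cases h2 : (k : ℕ) + 1 < n
    · have h5 : ¬ (k : ℕ) + 1 < A.nx i := by omega
      have e2 : xhatOf p i ⟨(k : ℕ) + 1, h2⟩ = xcOf p i ⟨(k : ℕ) - A.nx i + 1, by omega⟩ := by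
        simp only [xhatOf, xhat, h5, dif_neg, not_false_eq_true]
        exact congrArg (xcOf p i).ofLp (Fin.ext (by simp only []; omega))
      rw [dif_pos (by omega : (k : ℕ) - A.nx i + 1 < n - A.nx i), dif_pos h2, e2, Leader.d,
        if_neg h2.ne]
      ring
    · rw [dif_neg (by omega), dif_neg h2, hlast, Leader.d, if_pos (by omega)]
      ring

theorem obsL_closedLoopWith (σ : Fin N → ℝ) (c : ℝ) (p : State A n) (i : Fin N) :
    obsL i (closedLoopWith L A a P σ c p) = A.A0 i *ᵥ obsL i p := by
  change (A.A0 i *ᵥ (ξOf p i).ofLp + (A.f i (xOf p i)).ofLp) -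
    (A.A0 i *ᵥ (zOf p i).ofLp + (A.f i (xOf p i)).ofLp) =
      A.A0 i *ᵥ ((ξOf p i).ofLp - (zOf p i).ofLp)
  rw [mulVec_sub]
  abel

theorem closedLoopWith_eq (σ : Fin N → ℝ) (c : ℝ) (p : State A n) :
    closedLoopWith L A a P σ c p = closedLoopWith L A a P 0 0 p +
      c • (0, 0, 0, 0, 0, WithLp.toLp 2 L.d) +
      ∑ i, σ i • (-(L.dLast * θOf p i)) • lastUnit A n i := by
  have hll : ∀ i, lastLineWith L P (σ i) (xhatOf p i) (xvOf a p i) (θOf p i) =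
      lastLineWith L P 0 (xhatOf p i) (xvOf a p i) (θOf p i) - L.dLast * θOf p i * σ i :=
    fun i => by
    simp only [lastLineWith]; ring
  have hsum : ∀ (i : Fin N) (r : Prop) [Decidable r],
      ∑ j, σ j * (-(L.dLast * θOf p j) * if i = j ∧ r then 1 else 0) =
        if r then -(L.dLast * θOf p i * σ i) else 0 := by
    intro i r _
    rw [Finset.sum_eq_single i]
    · by_cases hr : r <;> simp [hr, mul_comm, mul_left_comm]
    · intro j _ hj
      simp [hj.symm]
    · simp
  refine Prod.ext ?_ (Prod.ext ?_ (Prod.ext ?_ (Prod.ext ?_ (Prod.ext ?_ ?_))))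
  · simp [closedLoopWith, lastUnit, Prod.fst_sum]
  · funext i
    ext k
    simp only [closedLoopWith, lastUnit, Prod.fst_sum, Prod.snd_sum, Prod.fst_add, Prod.snd_add,
      Prod.smul_fst, Prod.smul_snd, Pi.add_apply, Pi.smul_apply, Finset.sum_apply, smul_zero,
      Pi.zero_apply, PiLp.add_apply, WithLp.ofLp_sum, PiLp.smul_apply, smul_eq_mul,
      add_zero, Followers.xField, hsum, hll]
    split_ifs <;> first | omega | ring
  · funext i
    ext k
    simp only [closedLoopWith, lastUnit, Prod.fst_sum, Prod.snd_sum, Prod.fst_add, Prod.snd_add,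
      Prod.smul_fst, Prod.smul_snd, Pi.add_apply, Pi.smul_apply, Finset.sum_apply, smul_zero,
      Pi.zero_apply, PiLp.add_apply, WithLp.ofLp_sum, PiLp.smul_apply, smul_eq_mul,
      add_zero, hsum, hll]
    split_ifs <;> first | omega | ring
  · simp [closedLoopWith, lastUnit, Prod.snd_sum]
  · simp [closedLoopWith, lastUnit, Prod.snd_sum]
  · simp [closedLoopWith, lastUnit, Prod.snd_sum, Leader.field]

end Loop

section LoopSystem

variable {N n : ℕ} (L : Leader n) (A : Followers N) (a : Matrix (Fin (N + 1)) (Fin (N + 1)) ℝ)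
  (P : Matrix (Fin n) (Fin n) ℝ)

/-- The closed loop as a switched system. -/
noncomputable def loopSystem (v : ℝ → ℝ) : SwitchedSystem (State A n) (Fin N) where
  drift := closedLoopWith L A a P 0 0
  input := (0, 0, 0, 0, 0, WithLp.toLp 2 L.d)
  v := v
  gain i p := (-(L.dLast * θOf p i)) • lastUnit A n i
  switch i := LinearMap.toContinuousLinearMap (feedbackL L a P i)

variable {A}

theorem loopSystem_rhs (v : ℝ → ℝ) (σ : Fin N → ℝ) (t : ℝ) (p : State A n) :
    (loopSystem L A a P v).rhs σ t p = closedLoopWith L A a P σ (v t) p :=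
  (closedLoopWith_eq L a P σ (v t) p).symm

theorem loopSystem_switch (v : ℝ → ℝ) (i : Fin N) (p : State A n) :
    (loopSystem L A a P v).switch i p = feedback L P (xvOf a p i) :=
  feedbackL_apply L a P i p

theorem loopSystem_field (v : ℝ → ℝ) :
    (loopSystem L A a P v).field = closedLoop L A a P v := by
  funext t p
  rw [SwitchedSystem.field, loopSystem_rhs]
  simp only [loopSystem_switch]
  rfl

theorem contDiff_of_linearMap {V W : Type*} [NormedAddCommGroup V] [NormedSpace ℝ V]
    [FiniteDimensional ℝ V] [NormedAddCommGroup W] [NormedSpace ℝ W] (f : V →ₗ[ℝ] W)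
    {k : WithTop ℕ∞} : ContDiff ℝ k f :=
  (LinearMap.toContinuousLinearMap f).contDiff

theorem contDiff_zOf (i : Fin N) : ContDiff ℝ 1 fun p : State A n => zOf p i :=
  contDiff_of_linearMap (⟨⟨fun p => zOf p i, fun _ _ => rfl⟩, fun _ _ => rfl⟩ : State A n →ₗ[ℝ] _)

theorem contDiff_xOf (i : Fin N) : ContDiff ℝ 1 fun p : State A n => xOf p i :=
  contDiff_of_linearMap (⟨⟨fun p => xOf p i, fun _ _ => rfl⟩, fun _ _ => rfl⟩ : State A n →ₗ[ℝ] _)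

theorem contDiff_xcOf (i : Fin N) : ContDiff ℝ 1 fun p : State A n => xcOf p i :=
  contDiff_of_linearMap (⟨⟨fun p => xcOf p i, fun _ _ => rfl⟩, fun _ _ => rfl⟩ : State A n →ₗ[ℝ] _)

theorem contDiff_ξOf (i : Fin N) : ContDiff ℝ 1 fun p : State A n => ξOf p i :=
  contDiff_of_linearMap (⟨⟨fun p => ξOf p i, fun _ _ => rfl⟩, fun _ _ => rfl⟩ : State A n →ₗ[ℝ] _)

theorem contDiff_wOf : ContDiff ℝ 1 fun p : State A n => wOf p :=
  contDiff_of_linearMap (⟨⟨fun p => wOf p, fun _ _ => rfl⟩, fun _ _ => rfl⟩ : State A n →ₗ[ℝ] _)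

theorem contDiff_θOf (i : Fin N) : ContDiff ℝ 1 fun p : State A n => θOf p i :=
  contDiff_of_linearMap (gainL i)

theorem contDiff_feedback (i : Fin N) :
    ContDiff ℝ 1 fun p : State A n => feedback L P (xvOf a p i) := by
  have : (fun p : State A n => feedback L P (xvOf a p i)) = feedbackL L a P i :=
    funext fun p => (feedbackL_apply L a P i p).symm
  rw [this]
  exact contDiff_of_linearMap _

theorem contDiff_lastLineWith (s : ℝ) (i : Fin N) : ContDiff ℝ 1 fun p : State A n =>
    lastLineWith L P s (xhatOf p i) (xvOf a p i) (θOf p i) := by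
  have h1 := contDiff_feedback (A := A) L a P i
  have h2 := contDiff_θOf (A := A) (n := n) i
  have h3 : ∀ j, ContDiff ℝ 1 fun p : State A n => xhatOf p i j := fun j =>
    contDiff_euclidean.1 (contDiff_of_linearMap (xhatL i)) j
  unfold lastLineWith
  fun_prop

theorem contDiff_zField (hf : ∀ i, ContDiff ℝ (⊤ : ℕ∞) (A.f i)) (i : Fin N)
    {z : State A n → EuclideanSpace ℝ (Fin (A.nz i))} (hz : ContDiff ℝ 1 z) :
    ContDiff ℝ 1 fun p => A.zField i (z p) (xOf p i) := by
  refine ContDiff.add ?_ (((hf i).of_le (by exact_mod_cast le_top)).comp (contDiff_xOf i))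
  refine contDiff_euclidean.2 fun k => ?_
  have := contDiff_euclidean.1 hz
  simp only [mulVec, dotProduct]
  fun_prop

/-- The only nonsmooth terms are the absolute values in the adaptation law. -/
theorem locallyLipschitz_closedLoopWith (hf : ∀ i, ContDiff ℝ (⊤ : ℕ∞) (A.f i))
    (hg : ∀ i, ContDiff ℝ (⊤ : ℕ∞) (fun q : EuclideanSpace ℝ (Fin (A.nz i)) ×
      EuclideanSpace ℝ (Fin (A.nx i)) => A.g i q.1 q.2)) (σ : Fin N → ℝ) (c : ℝ) :
    LocallyLipschitz (closedLoopWith (n := n) L A a P σ c) := by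
  have hxk : ∀ i k, ContDiff ℝ 1 fun p : State A n => xOf p i k := fun i k =>
    contDiff_euclidean.1 (contDiff_xOf i) k
  have hxck : ∀ i k, ContDiff ℝ 1 fun p : State A n => xcOf p i k := fun i k =>
    contDiff_euclidean.1 (contDiff_xcOf i) k
  have hgz : ∀ i, ContDiff ℝ 1 fun p : State A n => A.g i (zOf p i) (xOf p i) := fun i =>
    ((hg i).of_le (by exact_mod_cast le_top)).comp ((contDiff_zOf i).prodMk (contDiff_xOf i))
  have hgξ : ∀ i, ContDiff ℝ 1 fun p : State A n => A.g i (ξOf p i) (xOf p i) := fun i =>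
    ((hg i).of_le (by exact_mod_cast le_top)).comp ((contDiff_ξOf i).prodMk (contDiff_xOf i))
  have hll := fun i => contDiff_lastLineWith (A := A) L a P (σ i) i
  have hφ := contDiff_feedback (A := A) L a P
  have hsmooth : ContDiff ℝ 1 fun p : State A n => ((closedLoopWith L A a P σ c p).1,
      (closedLoopWith L A a P σ c p).2.1, (closedLoopWith L A a P σ c p).2.2.1,
      (fun i => feedback L P (xvOf a p i) ^ 2 : Fin N → ℝ),
      (closedLoopWith L A a P σ c p).2.2.2.2.1, (closedLoopWith L A a P σ c p).2.2.2.2.2) := by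
    refine ContDiff.prodMk (contDiff_pi.2 fun i => contDiff_zField hf i (contDiff_zOf i)) ?_
    refine ContDiff.prodMk (contDiff_pi.2 fun i => contDiff_euclidean.2 fun k => ?_) ?_
    · simp only [closedLoopWith, Followers.xField]
      split_ifs
      · exact hxk i _
      · exact ((hgξ i).neg.add (hxck i _)).add (hgz i)
      · exact ((hgξ i).neg.add (hll i)).add (hgz i)
    refine ContDiff.prodMk (contDiff_pi.2 fun i => contDiff_euclidean.2 fun k => ?_) ?_
    · simp only [closedLoopWith]
      split_ifs
      · exact hxck i _
      · exact hll i
    refine ContDiff.prodMk (contDiff_pi.2 fun i => (hφ i).pow 2) ?_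
    refine ContDiff.prodMk (contDiff_pi.2 fun i => contDiff_zField hf i (contDiff_ξOf i)) ?_
    refine contDiff_euclidean.2 fun k => ?_
    have := contDiff_euclidean.1 (contDiff_wOf (A := A) (n := n))
    simp only [closedLoopWith, Leader.field, mulVec, dotProduct, Pi.add_apply, Pi.smul_apply]
    fun_prop
  have habs : LipschitzWith 1 fun y : Fin N → ℝ => fun i => |y i| := by
    refine LipschitzWith.of_dist_le_mul fun x y => ?_
    rw [NNReal.coe_one, one_mul]
    refine (dist_pi_le_iff dist_nonneg).2 fun i => ?_
    exact (abs_abs_sub_abs_le (x i) (y i)).trans (dist_le_pi_dist x y i)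
  have hφabs : LocallyLipschitz fun p : State A n => (fun i => |feedback L P (xvOf a p i)|) :=
    habs.locallyLipschitz.comp (contDiff_pi.2 hφ).locallyLipschitz
  -- recombine the smooth part with the absolute values
  have hcomb : ContDiff ℝ 1 fun x : State A n × (Fin N → ℝ) =>
      x.1 + (0, 0, 0, x.2, 0, 0) := by fun_prop
  have := hcomb.locallyLipschitz.comp (hsmooth.locallyLipschitz.prodMk hφabs)
  refine Eq.mp (congrArg LocallyLipschitz (funext fun p => ?_)) this
  simp [closedLoopWith, θField, Pi.add_def]

/-- The switching functions can be prescribed independently, since the grounded Laplacian is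
invertible and `dᵀ P ≠ 0`. -/
theorem exists_feedback_eq (ha : IsConnectedGraph a) (hP : P.PosDef) (hdeg : ∀ i, A.nx i ≤ n)
    [NeZero n] (hd : L.dLast ≠ 0) (s : Fin N → ℝ) :
    ∃ u : State A n, ∀ i, feedback L P (xvOf a u i) = s i := by
  have hLd : L.d ≠ 0 := fun h => by
    have := congrFun h ⟨n - 1, Nat.sub_lt (NeZero.pos n) one_pos⟩
    have hn : n - 1 + 1 = n := Nat.succ_pred_eq_of_pos (NeZero.pos n)
    simp only [Leader.d, hn, if_true, Pi.zero_apply] at this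
    exact hd this
  have hq : 0 < L.d ⬝ᵥ (P *ᵥ L.d) := by simpa using hP.dotProduct_mulVec_pos hLd
  set H := groundedLaplacian a
  have hH : IsUnit H := ha.groundedLaplacian_posDef.isUnit
  set y : Fin N → ℝ := H⁻¹ *ᵥ s
  have hHy : H *ᵥ y = s := by
    rw [mulVec_mulVec, mul_nonsing_inv _ ((isUnit_iff_isUnit_det _).1 hH), one_mulVec]
  set x₀ : Fin n → ℝ := (L.d ⬝ᵥ (P *ᵥ L.d))⁻¹ • L.d
  have hx₀ : L.d ⬝ᵥ (P *ᵥ x₀) = 1 := by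
    rw [mulVec_smul, dotProduct_smul, smul_eq_mul, inv_mul_cancel₀ hq.ne']
  let u : State A n := (0, fun j => WithLp.toLp 2 fun k => y j * x₀ ⟨k, k.2.trans_le (hdeg j)⟩,
    fun j => WithLp.toLp 2 fun k => y j * x₀ ⟨A.nx j + k, by omega⟩, 0, 0, 0)
  have hu : ∀ j, errL j u = y j • x₀ := by
    intro j
    ext k
    rw [errL_apply]
    have hw : wOf u k = 0 := rfl
    rw [hw, sub_zero, Pi.smul_apply, smul_eq_mul]
    by_cases hk : (k : ℕ) < A.nx j
    · simp only [xhatOf, xhat, hk, dif_pos]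
      rfl
    · simp only [xhatOf, xhat, hk, dif_neg, not_false_eq_true]
      change y j * x₀ _ = _
      congr 2
      exact Fin.ext (by simp only []; omega)
  refine ⟨u, fun i => ?_⟩
  rw [feedback, xvOf_ofLp]
  simp only [hu, smul_smul, ← Finset.sum_smul]
  rw [mulVec_smul, dotProduct_smul, hx₀, smul_eq_mul, mul_one, ← congrFun hHy i]
  rfl

theorem loopSystem_isRegular (hf : ∀ i, ContDiff ℝ (⊤ : ℕ∞) (A.f i))
    (hg : ∀ i, ContDiff ℝ (⊤ : ℕ∞) (fun q : EuclideanSpace ℝ (Fin (A.nz i)) ×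
      EuclideanSpace ℝ (Fin (A.nx i)) => A.g i q.1 q.2))
    (ha : IsConnectedGraph a) (hP : P.PosDef) (hdeg : ∀ i, A.nx i ≤ n) [NeZero n] {v : ℝ → ℝ}
    (hv : ContinuousOn v (Ici 0)) (hvb : ∃ l : ℝ, 0 < l ∧ ∀ t, 0 ≤ t → |v t| ≤ l) :
    (loopSystem L A a P v).IsRegular where
  drift := locallyLipschitz_closedLoopWith L a P hf hg 0 0
  gain i := ((contDiff_const.mul (contDiff_θOf i)).neg).smul contDiff_const
  continuousOn := hv
  bounded := hvb
  independent s := by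
    by_cases hd : L.dLast = 0
    · exact ⟨0, fun i => Or.inl fun p => by simp [loopSystem, hd]⟩
    · obtain ⟨u, hu⟩ := exists_feedback_eq L a P ha hP hdeg hd s
      exact ⟨u, fun i => Or.inr ((loopSystem_switch L a P v i u).trans (hu i))⟩

end LoopSystem

/-! ### The Lyapunov function -/

section Dissipation

theorem dotProduct_self_nonneg {m : Type*} [Fintype m] (x : m → ℝ) : 0 ≤ x ⬝ᵥ x :=
  Finset.sum_nonneg fun _ _ => mul_self_nonneg _

theorem exists_sq_le_of_linearMap {l m : Type*} [Fintype l] [Fintype m]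
    (f : (l → m → ℝ) →ₗ[ℝ] ℝ) :
    ∃ C : ℝ, 0 < C ∧ ∀ η, f η ^ 2 ≤ C * ∑ i, η i ⬝ᵥ η i := by
  set F := LinearMap.toContinuousLinearMap f
  refine ⟨‖F‖ ^ 2 + 1, by positivity, fun η => ?_⟩
  set s := ∑ i, η i ⬝ᵥ η i with hs
  have hs0 : 0 ≤ s := Finset.sum_nonneg fun i _ => dotProduct_self_nonneg _
  have hη : ‖η‖ ≤ √s := by
    refine (pi_norm_le_iff_of_nonneg (Real.sqrt_nonneg _)).2 fun i =>
      (pi_norm_le_iff_of_nonneg (Real.sqrt_nonneg _)).2 fun k => Real.abs_le_sqrt ?_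
    have h1 : η i k * η i k ≤ η i ⬝ᵥ η i :=
      Finset.single_le_sum (f := fun k => η i k * η i k) (fun k _ => mul_self_nonneg _)
        (Finset.mem_univ k)
    have h2 : η i ⬝ᵥ η i ≤ s :=
      Finset.single_le_sum (f := fun i => η i ⬝ᵥ η i) (fun i _ => dotProduct_self_nonneg _)
        (Finset.mem_univ i)
    rw [sq]
    exact h1.trans h2
  have h1 : |f η| ≤ ‖F‖ * √s := (F.le_opNorm η).trans (by gcongr)
  calc f η ^ 2 = |f η| ^ 2 := (sq_abs _).symm
    _ ≤ (‖F‖ * √s) ^ 2 := by gcongr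
    _ = ‖F‖ ^ 2 * s := by rw [mul_pow, Real.sq_sqrt hs0]
    _ ≤ _ := by nlinarith

variable {N n : ℕ} {L : Leader n} {P : Matrix (Fin n) (Fin n) ℝ}

theorem sum_sum_symm {H : Matrix (Fin N) (Fin N) ℝ} (hH : H.PosDef) (F : Fin N → Fin N → ℝ) :
    ∑ i, ∑ j, H i j * F i j = ∑ i, ∑ j, H i j * F j i := by
  rw [Finset.sum_comm]
  refine Finset.sum_congr rfl fun i _ => Finset.sum_congr rfl fun j _ => ?_
  have : H j i = H i j := by simpa using hH.isHermitian.apply i j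
  rw [this]

/-- The algebraic core of the proof. The quadratic form of the errors `η` and the squares of
`θ i - β` exchange the indefinite term `θ i (φ i)²`. For large `β`, the term `-2 β ∑ (φ i)²` makes
up for `2 P d dᵀ P` because `H² ≥ λ H`, and `-2 β ∑ |φ i|` absorbs the leader's input. The
disturbances `δ i` are dominated by the observation errors `ε i`. -/
theorem exists_dissipation (hP : L.Admissible P) {H : Matrix (Fin N) (Fin N) ℝ} (hH : H.PosDef)
    {m : Fin N → ℕ} {A₀ R : ∀ i, Matrix (Fin (m i)) (Fin (m i)) ℝ}
    (hR : ∀ i x, 2 * (x ⬝ᵥ (R i *ᵥ (A₀ i *ᵥ x))) ≤ -(x ⬝ᵥ x)) {M : ℝ} (hM : 0 < M) (l : ℝ)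
    (e : Fin N → Fin n → ℝ) :
    ∃ β κ c : ℝ, 0 < κ ∧ 0 < c ∧ ∀ (η η' : Fin N → Fin n → ℝ) (θ φ σ δ : Fin N → ℝ)
      (ε : ∀ i, Fin (m i) → ℝ) (v : ℝ), |v| ≤ l → (∀ i, δ i ^ 2 ≤ M ^ 2 * (ε i ⬝ᵥ ε i)) →
      (∀ i, φ i = L.d ⬝ᵥ (P *ᵥ ∑ j, H i j • η j)) →
      (∀ i, η' i = L.S *ᵥ η i - (θ i * φ i + θ i * σ i + v) • L.d + δ i • e i) →
      ∑ i, ∑ j, H i j * (η' i ⬝ᵥ (P *ᵥ η j) + η i ⬝ᵥ (P *ᵥ η' j)) +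
        ∑ i, 2 * (θ i - β) * (φ i ^ 2 + |φ i|) +
        κ * ∑ i, 2 * (ε i ⬝ᵥ (R i *ᵥ (A₀ i *ᵥ ε i))) ≤
      -c * ∑ i, η i ⬝ᵥ η i + 2 * ∑ i, θ i * (|φ i| - σ i * φ i) := by
  obtain ⟨hPpos, hQ⟩ := hP
  obtain ⟨c₀, hc₀, hcoer⟩ := exists_mul_le_sum_kronecker hH hQ
  obtain ⟨lam, hlam, hHc⟩ := exists_mul_dotProduct_self_le hH
  have hu := fun i => exists_sq_le_of_linearMap
    (dotProductBilin ℝ ℝ (e i) ∘ₗ P.mulVecLin ∘ₗ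
      ∑ j, H i j • (LinearMap.proj j : (Fin N → Fin n → ℝ) →ₗ[ℝ] (Fin n → ℝ)))
  choose C₁ hC₁ hu using hu
  set C := 1 + ∑ i, C₁ i with hC
  have hC0 : 0 < C := by
    have := Finset.sum_nonneg fun i (_ : i ∈ Finset.univ) => (hC₁ i).le
    linarith
  set τ := c₀ / (2 * C) with hτ
  have hτ0 : 0 < τ := by positivity
  set β := max l (1 / lam) with hβ
  refine ⟨β, M ^ 2 / τ, c₀ / 2, by positivity, by positivity, ?_⟩
  intro η η' θ φ σ δ ε v hv hδ hφ hη'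
  set s := ∑ i, η i ⬝ᵥ η i with hs
  set ζ : Fin N → Fin n → ℝ := fun i => ∑ j, H i j • η j with hζ
  set y : Fin N → ℝ := fun i => L.d ⬝ᵥ (P *ᵥ η i) with hy
  have hbil : ∀ (x : Fin n → ℝ) i, ∑ j, H i j * (x ⬝ᵥ (P *ᵥ η j)) = x ⬝ᵥ (P *ᵥ ζ i) := by
    intro x i
    simp only [hζ, mulVec_sum, mulVec_smul, dotProduct_sum, dotProduct_smul, smul_eq_mul]
  have hφy : ∀ i, φ i = ∑ j, H i j * y j := fun i => by rw [hφ i, hbil L.d i]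
  -- the derivative of the quadratic form of the errors
  have h1 : ∑ i, ∑ j, H i j * (η' i ⬝ᵥ (P *ᵥ η j) + η i ⬝ᵥ (P *ᵥ η' j)) =
      2 * ∑ i, η' i ⬝ᵥ (P *ᵥ ζ i) := by
    simp only [mul_add, Finset.sum_add_distrib]
    rw [sum_sum_symm hH fun i j => η i ⬝ᵥ (P *ᵥ η' j)]
    simp only [fun i j => dotProduct_mulVec_comm_of_posDef hPpos (η j) (η' i), hbil]
    ring
  have h2 : ∀ i, η' i ⬝ᵥ (P *ᵥ ζ i) = (L.S *ᵥ η i) ⬝ᵥ (P *ᵥ ζ i) -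
      (θ i * φ i + θ i * σ i + v) * φ i + δ i * (e i ⬝ᵥ (P *ᵥ ζ i)) := by
    intro i
    rw [hη' i, add_dotProduct, sub_dotProduct, smul_dotProduct, smul_dotProduct, ← hφ i,
      smul_eq_mul, smul_eq_mul]
  have h3 : 2 * ∑ i, (L.S *ᵥ η i) ⬝ᵥ (P *ᵥ ζ i) =
      2 * ∑ i, ∑ j, H i j * (y i * y j) - ∑ i, ∑ j, H i j * (η i ⬝ᵥ
        (((2 : ℝ) • (P * vecMulVec L.d L.d * P) - (L.Sᵀ * P + P * L.S)) *ᵥ η j)) := by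
    have e1 : ∑ i, (L.S *ᵥ η i) ⬝ᵥ (P *ᵥ ζ i) =
        ∑ i, ∑ j, H i j * ((L.S *ᵥ η i) ⬝ᵥ (P *ᵥ η j)) :=
      Finset.sum_congr rfl fun i _ => (hbil _ i).symm
    have e2 := sum_sum_symm hH fun i j => (L.S *ᵥ η i) ⬝ᵥ (P *ᵥ η j)
    have e3 : 2 * ∑ i, (L.S *ᵥ η i) ⬝ᵥ (P *ᵥ ζ i) = ∑ i, ∑ j, H i j *
        ((L.S *ᵥ η i) ⬝ᵥ (P *ᵥ η j) + (L.S *ᵥ η j) ⬝ᵥ (P *ᵥ η i)) := by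
      rw [two_mul]
      nth_rewrite 2 [e1]
      rw [e1, e2]
      nth_rewrite 1 [← e2]
      simp only [← Finset.sum_add_distrib, mul_add]
    rw [e3, Finset.mul_sum, ← Finset.sum_sub_distrib]
    refine Finset.sum_congr rfl fun i _ => ?_
    rw [Finset.mul_sum, ← Finset.sum_sub_distrib]
    refine Finset.sum_congr rfl fun j _ => ?_
    have q1 : η i ⬝ᵥ ((P * vecMulVec L.d L.d * P) *ᵥ η j) = y i * y j := by
      rw [← mulVec_mulVec, ← mulVec_mulVec, vecMulVec_mulVec, mulVec_smul, dotProduct_smul,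
        dotProduct_mulVec_comm_of_posDef hPpos (η i) L.d]
      rfl
    have q2 : η i ⬝ᵥ ((P * L.S) *ᵥ η j) = (L.S *ᵥ η j) ⬝ᵥ (P *ᵥ η i) := by
      rw [← mulVec_mulVec, dotProduct_mulVec_comm_of_posDef hPpos]
    have q3 : η i ⬝ᵥ ((L.Sᵀ * P) *ᵥ η j) = (L.S *ᵥ η i) ⬝ᵥ (P *ᵥ η j) := by
      rw [← mulVec_mulVec, dotProduct_mulVec, vecMul_transpose]
    rw [sub_mulVec, add_mulVec, smul_mulVec, dotProduct_sub, dotProduct_add, dotProduct_smul, q1,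
      q2, q3, smul_eq_mul]
    ring
  have h4 := hcoer η
  -- `H² ≥ λ H`
  have h5 : ∑ i, ∑ j, H i j * (y i * y j) ≤ 1 / lam * ∑ i, φ i ^ 2 := by
    have e1 : ∑ i, ∑ j, H i j * (y i * y j) = ∑ i, y i * φ i := by
      refine Finset.sum_congr rfl fun i _ => ?_
      rw [hφy i, Finset.mul_sum]
      exact Finset.sum_congr rfl fun j _ => by ring
    have e2 : lam * ∑ i, y i ^ 2 ≤ ∑ i, y i * φ i := by
      have h := hHc y
      have r1 : y ⬝ᵥ y = ∑ i, y i ^ 2 := Finset.sum_congr rfl fun i _ => (sq _).symm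
      have r2 : y ⬝ᵥ (H *ᵥ y) = ∑ i, y i * φ i :=
        Finset.sum_congr rfl fun i _ => by rw [hφy i]; rfl
      rwa [r1, r2] at h
    have e3 : 2 * ∑ i, y i * φ i ≤ lam * ∑ i, y i ^ 2 + 1 / lam * ∑ i, φ i ^ 2 := by
      rw [Finset.mul_sum, Finset.mul_sum, Finset.mul_sum, ← Finset.sum_add_distrib]
      refine Finset.sum_le_sum fun i _ => ?_
      have : lam * y i ^ 2 + 1 / lam * φ i ^ 2 - 2 * (y i * φ i) = (lam * y i - φ i) ^ 2 / lam := by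
        field_simp
        ring
      have := div_nonneg (sq_nonneg (lam * y i - φ i)) hlam.le
      linarith
    rw [e1]
    linarith
  have h6 : 2 * ∑ i, δ i * (e i ⬝ᵥ (P *ᵥ ζ i)) ≤
      c₀ / 2 * s + M ^ 2 / τ * ∑ i, ε i ⬝ᵥ ε i := by
    have hs0 : 0 ≤ s := Finset.sum_nonneg fun i _ => dotProduct_self_nonneg _
    have hui : ∀ i, (e i ⬝ᵥ (P *ᵥ ζ i)) ^ 2 ≤ C₁ i * s := by
      intro i
      have := hu i η
      simp only [LinearMap.comp_apply, LinearMap.sum_apply, LinearMap.smul_apply,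
        LinearMap.proj_apply, mulVecLin_apply] at this
      exact this
    have r1 : 2 * ∑ i, δ i * (e i ⬝ᵥ (P *ᵥ ζ i)) ≤
        ∑ i, (τ * (C₁ i * s) + M ^ 2 / τ * (ε i ⬝ᵥ ε i)) := by
      rw [Finset.mul_sum]
      refine Finset.sum_le_sum fun i _ => ?_
      set u := e i ⬝ᵥ (P *ᵥ ζ i)
      have : τ * u ^ 2 + δ i ^ 2 / τ - 2 * (δ i * u) = (τ * u - δ i) ^ 2 / τ := by
        field_simp
        ring
      have h := div_nonneg (sq_nonneg (τ * u - δ i)) hτ0.le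
      have p1 : τ * u ^ 2 ≤ τ * (C₁ i * s) := by gcongr; exact hui i
      have p2 : δ i ^ 2 / τ ≤ M ^ 2 * (ε i ⬝ᵥ ε i) / τ := by gcongr; exact hδ i
      have p3 : M ^ 2 * (ε i ⬝ᵥ ε i) / τ = M ^ 2 / τ * (ε i ⬝ᵥ ε i) := by ring
      linarith
    rw [Finset.sum_add_distrib, ← Finset.mul_sum, ← Finset.mul_sum, ← Finset.sum_mul] at r1
    have r2 : τ * ((∑ i, C₁ i) * s) ≤ c₀ / 2 * s := by
      have : τ * C = c₀ / 2 := by rw [hτ]; field_simp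
      have h7 : τ * ((∑ i, C₁ i) * s) ≤ τ * (C * s) := by
        gcongr
        linarith
      calc _ ≤ τ * (C * s) := h7
        _ = c₀ / 2 * s := by rw [← mul_assoc, this]
    linarith
  have h7 : M ^ 2 / τ * ∑ i, 2 * (ε i ⬝ᵥ (R i *ᵥ (A₀ i *ᵥ ε i))) ≤
      -(M ^ 2 / τ * ∑ i, ε i ⬝ᵥ ε i) := by
    rw [← mul_neg, ← Finset.sum_neg_distrib]
    gcongr with i _
    exact hR i _
  have h8 : 1 / lam * ∑ i, φ i ^ 2 ≤ β * ∑ i, φ i ^ 2 := by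
    gcongr
    exact le_max_right _ _
  have h9 : ∑ i, -(2 * (v * φ i)) ≤ ∑ i, 2 * (β * |φ i|) := by
    refine Finset.sum_le_sum fun i _ => ?_
    have h := neg_abs_le (v * φ i)
    rw [abs_mul] at h
    have : |v| * |φ i| ≤ β * |φ i| := by
      gcongr
      exact hv.trans (le_max_left _ _)
    linarith
  have h10 : 2 * ∑ i, η' i ⬝ᵥ (P *ᵥ ζ i) + ∑ i, 2 * (θ i - β) * (φ i ^ 2 + |φ i|) =
      2 * ∑ i, (L.S *ᵥ η i) ⬝ᵥ (P *ᵥ ζ i) + 2 * ∑ i, δ i * (e i ⬝ᵥ (P *ᵥ ζ i)) +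
      ∑ i, -(2 * (v * φ i)) - ∑ i, 2 * (β * |φ i|) - 2 * (β * ∑ i, φ i ^ 2) +
      2 * ∑ i, θ i * (|φ i| - σ i * φ i) := by
    simp only [h2, Finset.mul_sum, ← Finset.sum_add_distrib, ← Finset.sum_sub_distrib]
    exact Finset.sum_congr rfl fun i _ => by ring
  rw [h1]
  linarith

end Dissipation

section LyapunovFunction

theorem hasDerivAt_linearMap_comp {V W : Type*} [NormedAddCommGroup V] [NormedSpace ℝ V]
    [FiniteDimensional ℝ V] [NormedAddCommGroup W] [NormedSpace ℝ W] (f : V →ₗ[ℝ] W)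
    {γ : ℝ → V} {γ' : V} {t : ℝ} (h : HasDerivAt γ γ' t) :
    HasDerivAt (fun s => f (γ s)) (f γ') t :=
  (LinearMap.toContinuousLinearMap f).hasFDerivAt.comp_hasDerivAt t h

theorem hasDerivAt_dotProduct {m : Type*} [Fintype m] {x y : ℝ → m → ℝ} {x' y' : m → ℝ} {t : ℝ}
    (hx : HasDerivAt x x' t) (hy : HasDerivAt y y' t) :
    HasDerivAt (fun s => x s ⬝ᵥ y s) (x' ⬝ᵥ y t + x t ⬝ᵥ y') t := by
  simp only [dotProduct, ← Finset.sum_add_distrib]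
  exact HasDerivAt.fun_sum fun i _ => (hasDerivAt_pi.1 hx i).mul (hasDerivAt_pi.1 hy i)

theorem hasDerivAt_dotProduct_mulVec {m l : Type*} [Fintype m] [Fintype l] (M : Matrix m l ℝ)
    {x : ℝ → m → ℝ} {y : ℝ → l → ℝ} {x' : m → ℝ} {y' : l → ℝ} {t : ℝ} (hx : HasDerivAt x x' t)
    (hy : HasDerivAt y y' t) :
    HasDerivAt (fun s => x s ⬝ᵥ (M *ᵥ y s)) (x' ⬝ᵥ (M *ᵥ y t) + x t ⬝ᵥ (M *ᵥ y')) t :=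
  hasDerivAt_dotProduct hx (hasDerivAt_linearMap_comp M.mulVecLin hy)

variable {N n : ℕ} {A : Followers N}

/-- The squared size of the synchronization errors. -/
noncomputable def errSq (p : State A n) : ℝ := ∑ i, errL i p ⬝ᵥ errL i p

/-- The squared size of the observation errors. -/
noncomputable def obsSq (p : State A n) : ℝ := ∑ i, obsL i p ⬝ᵥ obsL i p

/-- The squared size of the gains. -/
noncomputable def gainSq (p : State A n) : ℝ := ∑ i, θOf p i ^ 2

theorem errSq_nonneg (p : State A n) : 0 ≤ errSq p :=
  Finset.sum_nonneg fun _ _ => dotProduct_self_nonneg _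

theorem obsSq_nonneg (p : State A n) : 0 ≤ obsSq p :=
  Finset.sum_nonneg fun _ _ => dotProduct_self_nonneg _

theorem gainSq_nonneg (p : State A n) : 0 ≤ gainSq p :=
  Finset.sum_nonneg fun _ _ => sq_nonneg _

/-- The Lyapunov function: the form of the errors weighted by the grounded Laplacian and `P`, the
distances of the gains from a sufficiently large gain `β`, and the forms `R i` of the observation
errors. -/
noncomputable def lyapunov (a : Matrix (Fin (N + 1)) (Fin (N + 1)) ℝ)
    (P : Matrix (Fin n) (Fin n) ℝ) (R : ∀ i, Matrix (Fin (A.nz i)) (Fin (A.nz i)) ℝ) (β κ : ℝ)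
    (p : State A n) : ℝ :=
  ∑ i, ∑ j, groundedLaplacian a i j * (errL i p ⬝ᵥ (P *ᵥ errL j p)) +
    ∑ i, (θOf p i - β) ^ 2 + κ * ∑ i, obsL i p ⬝ᵥ (R i *ᵥ obsL i p)

theorem contDiff_lyapunov (a : Matrix (Fin (N + 1)) (Fin (N + 1)) ℝ)
    (P : Matrix (Fin n) (Fin n) ℝ) (R : ∀ i, Matrix (Fin (A.nz i)) (Fin (A.nz i)) ℝ) (β κ : ℝ) :
    ContDiff ℝ 1 (lyapunov (A := A) a P R β κ) := by
  have h1 : ∀ i k, ContDiff ℝ 1 fun p : State A n => errL i p k := fun i k =>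
    contDiff_pi.1 (contDiff_of_linearMap (errL i)) k
  have h2 : ∀ i k, ContDiff ℝ 1 fun p : State A n => obsL i p k := fun i k =>
    contDiff_pi.1 (contDiff_of_linearMap (obsL i)) k
  have h3 := contDiff_θOf (A := A) (n := n)
  unfold lyapunov
  simp only [dotProduct, mulVec]
  fun_prop

theorem hasDerivAt_lyapunov (a : Matrix (Fin (N + 1)) (Fin (N + 1)) ℝ)
    (P : Matrix (Fin n) (Fin n) ℝ) (R : ∀ i, Matrix (Fin (A.nz i)) (Fin (A.nz i)) ℝ) (β κ : ℝ)
    {γ : ℝ → State A n} {q : State A n} {t : ℝ} (h : HasDerivAt γ q t) :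
    HasDerivAt (fun s => lyapunov a P R β κ (γ s))
      (∑ i, ∑ j, groundedLaplacian a i j *
          (errL i q ⬝ᵥ (P *ᵥ errL j (γ t)) + errL i (γ t) ⬝ᵥ (P *ᵥ errL j q)) +
        ∑ i, 2 * (θOf (γ t) i - β) * θOf q i +
        κ * ∑ i, (obsL i q ⬝ᵥ (R i *ᵥ obsL i (γ t)) + obsL i (γ t) ⬝ᵥ (R i *ᵥ obsL i q))) t := by
  have h1 := fun i => hasDerivAt_linearMap_comp (errL i) h
  have h2 := fun i => hasDerivAt_linearMap_comp (obsL i) h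
  have h3 := fun i => hasDerivAt_linearMap_comp (gainL i) h
  unfold lyapunov
  refine ((HasDerivAt.fun_sum fun i _ => HasDerivAt.fun_sum fun j _ =>
    (hasDerivAt_dotProduct_mulVec P (h1 i) (h1 j)).const_mul _).add
      (HasDerivAt.fun_sum fun i _ => ?_)).add
    ((HasDerivAt.fun_sum fun i _ => hasDerivAt_dotProduct_mulVec (R i) (h2 i) (h2 i)).const_mul κ)
  have := ((h3 i).sub_const β).pow 2
  simp only [Nat.cast_ofNat, Nat.add_one_sub_one, pow_one] at this
  exact this

/-- There is a Lyapunov function for the closed loop that works for all leader inputs bounded by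
`l`; the last term in the bound of its derivative vanishes if `σ` is a selection of signs. -/
theorem exists_lyapunov_closedLoop {L : Leader n} {a : Matrix (Fin (N + 1)) (Fin (N + 1)) ℝ}
    {P : Matrix (Fin n) (Fin n) ℝ} (hP : L.Admissible P) (ha : IsConnectedGraph a)
    (hA0 : ∀ i, IsHurwitz (A.A0 i)) (hdeg : ∀ i, A.nx i ≤ n) (hx : ∀ i, 1 ≤ A.nx i)
    (hlip : ∃ M : ℝ, 0 < M ∧ ∀ i (z Δ : EuclideanSpace ℝ (Fin (A.nz i)))
      (x : EuclideanSpace ℝ (Fin (A.nx i))), |A.g i (z + Δ) x - A.g i z x| ≤ M * ‖Δ‖) (l : ℝ) :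
    ∃ (V : State A n → ℝ) (b m c : ℝ), ContDiff ℝ 1 V ∧ 0 < b ∧ 0 < c ∧
      (∀ p, b * (errSq p + gainSq p + obsSq p) ≤ m + V p) ∧
      ∀ p σ r, |r| ≤ l → fderiv ℝ V p (closedLoopWith L A a P σ r p) ≤ -c * errSq p +
        2 * ∑ i, θOf p i * (|feedback L P (xvOf a p i)| - σ i * feedback L P (xvOf a p i)) := by
  obtain ⟨M, hM, hlip⟩ := hlip
  choose R hR hRd using fun i => (hA0 i).exists_lyapunov
  have hH := ha.groundedLaplacian_posDef
  obtain ⟨β, κ, c, hκ, hc, hdis⟩ := exists_dissipation hP hH hRd hM l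
    fun i k => if (k : ℕ) + 1 = A.nx i then 1 else 0
  obtain ⟨b₁, hb₁, hcoer⟩ := exists_mul_le_sum_kronecker hH hP.1
  choose b₂ hb₂ hcoer₂ using fun i => exists_mul_dotProduct_self_le (hR i)
  obtain ⟨b₃, hb₃, hb₃'⟩ : ∃ b₃ : ℝ, 0 < b₃ ∧ ∀ i, b₃ ≤ b₂ i := by
    rcases isEmpty_or_nonempty (Fin N) with _ | _
    · exact ⟨1, one_pos, fun i => isEmptyElim i⟩
    · obtain ⟨i, hi⟩ := Finite.exists_min b₂
      exact ⟨b₂ i, hb₂ i, hi⟩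
  have hV := contDiff_lyapunov (A := A) a P R β κ
  refine ⟨lyapunov a P R β κ, min (min b₁ (1 / 2)) (κ * b₃), ∑ _i : Fin N, β ^ 2, c, hV,
    by positivity, hc, fun p => ?_, fun p σ r hr => ?_⟩
  · have e1 := hcoer fun i => errL i p
    have e2 : b₃ * obsSq p ≤ ∑ i, obsL i p ⬝ᵥ (R i *ᵥ obsL i p) := by
      rw [obsSq, Finset.mul_sum]
      exact Finset.sum_le_sum fun i _ => (mul_le_mul_of_nonneg_right (hb₃' i)
        (dotProduct_self_nonneg _)).trans (hcoer₂ i _)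
    have e3 : 1 / 2 * gainSq p ≤ ∑ i, (θOf p i - β) ^ 2 + ∑ _i : Fin N, β ^ 2 := by
      rw [gainSq, Finset.mul_sum, ← Finset.sum_add_distrib]
      exact Finset.sum_le_sum fun i _ => by nlinarith [sq_nonneg (θOf p i - 2 * β)]
    have e4 := mul_le_mul_of_nonneg_left e2 hκ.le
    have m1 : min (min b₁ (1 / 2)) (κ * b₃) ≤ b₁ := (min_le_left _ _).trans (min_le_left _ _)
    have m2 : min (min b₁ (1 / 2)) (κ * b₃) ≤ 1 / 2 := (min_le_left _ _).trans (min_le_right _ _)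
    have m3 : min (min b₁ (1 / 2)) (κ * b₃) ≤ κ * b₃ := min_le_right _ _
    have f1 := mul_le_mul_of_nonneg_right m1 (errSq_nonneg p)
    have f2 := mul_le_mul_of_nonneg_right m2 (gainSq_nonneg p)
    have f3 := mul_le_mul_of_nonneg_right m3 (obsSq_nonneg p)
    have e1' : b₁ * errSq p ≤ _ := e1
    rw [lyapunov]
    linarith
  · set q := closedLoopWith L A a P σ r p with hq
    have hline : HasDerivAt (fun s : ℝ => p + s • q) q 0 := by
      simpa using ((hasDerivAt_id (0 : ℝ)).smul_const q).const_add p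
    have h1 := hasDerivAt_lyapunov a P R β κ hline
    have h2 : HasDerivAt (fun s : ℝ => lyapunov a P R β κ (p + s • q))
        (fderiv ℝ (lyapunov a P R β κ) p q) 0 := by
      have h3 : HasFDerivAt (lyapunov a P R β κ) (fderiv ℝ (lyapunov a P R β κ) p)
          (p + (0 : ℝ) • q) := by
        rw [zero_smul, add_zero]
        exact (hV.differentiable one_ne_zero p).hasFDerivAt
      exact h3.comp_hasDerivAt (0 : ℝ) hline
    rw [h2.unique h1]
    simp only [zero_smul, add_zero]
    have h4 := hdis (fun i => errL i p) (fun i => errL i q) (θOf p)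
      (fun i => feedback L P (xvOf a p i)) σ
      (fun i => A.g i (zOf p i) (xOf p i) - A.g i (ξOf p i) (xOf p i)) (fun i => obsL i p) r hr
      (fun i => ?_) (fun i => ?_) fun i => ?_
    · refine le_trans (le_of_eq ?_) h4
      congr 2
      refine Finset.sum_congr rfl fun i _ => ?_
      rw [hq, obsL_closedLoopWith, dotProduct_mulVec_comm_of_posDef (hR i) (A.A0 i *ᵥ obsL i p)]
      ring
    · have h5 := hlip i (zOf p i) (ξOf p i - zOf p i) (xOf p i)
      rw [add_sub_cancel] at h5
      have h6 : ‖ξOf p i - zOf p i‖ ^ 2 = obsL i p ⬝ᵥ obsL i p := by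
        rw [EuclideanSpace.norm_sq_eq]
        refine Finset.sum_congr rfl fun k _ => ?_
        rw [Real.norm_eq_abs, sq_abs, sq]
        rfl
      rw [← h6, ← mul_pow, ← sq_abs, abs_sub_comm]
      gcongr
    · simp only [feedback, xvOf_ofLp]
    · ext k
      rw [hq, errL_closedLoopWith L a P hdeg hx]
      simp only [Pi.add_apply, Pi.sub_apply, Pi.smul_apply, smul_eq_mul]

end LyapunovFunction

/-! ### Boundedness on bounded intervals -/

section AprioriBound

theorem norm_sq_eq_dotProduct {m : ℕ} (y : EuclideanSpace ℝ (Fin m)) :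
    ‖y‖ ^ 2 = y.ofLp ⬝ᵥ y.ofLp := by
  rw [EuclideanSpace.norm_sq_eq]
  exact Finset.sum_congr rfl fun k _ => by rw [Real.norm_eq_abs, sq_abs, sq]

theorem sq_le_dotProduct_self {m : Type*} [Fintype m] (x : m → ℝ) (k : m) : x k ^ 2 ≤ x ⬝ᵥ x := by
  rw [sq]
  exact Finset.single_le_sum (f := fun k => x k * x k) (fun k _ => mul_self_nonneg _)
    (Finset.mem_univ k)

/-- Curves with a velocity `χ (M y + f)`, where `0 ≤ χ ≤ 1` and `f` is bounded, are bounded on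
bounded intervals. -/
theorem exists_dotProduct_self_le_of_affine_growth {m : Type*} [Fintype m] (M : Matrix m m ℝ)
    {F T Y : ℝ} (hF : 0 ≤ F) :
    ∃ B, ∀ (t₀ t₁ : ℝ) (y : ℝ → m → ℝ), t₀ ≤ t₁ → t₁ - t₀ ≤ T →
      AbsolutelyContinuousOnInterval y t₀ t₁ →
      (∀ᵐ t, t ∈ Icc t₀ t₁ → ∃ (χ : ℝ) (f : m → ℝ), χ ∈ Icc (0 : ℝ) 1 ∧ f ⬝ᵥ f ≤ F ∧
        HasDerivAt y (χ • (M *ᵥ y t + f)) t) →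
      y t₀ ⬝ᵥ y t₀ ≤ Y → y t₁ ⬝ᵥ y t₁ ≤ B := by
  obtain ⟨C, hC, hM⟩ := exists_abs_bilin_le M
  set K := 4 * C + 1 + F with hK
  refine ⟨(1 + Y) * Real.exp (K * T), fun t₀ t₁ y h01 hT hac hd hY => ?_⟩
  have hcd : ContDiff ℝ 1 fun x : m → ℝ => x ⬝ᵥ x := by
    unfold dotProduct
    fun_prop
  have h := one_add_le_mul_exp_of_ae_deriv_le (C := K) h01
    (absolutelyContinuousOnInterval_contDiff_comp hac hcd) (by
      filter_upwards [hd] with t ht htI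
      obtain ⟨χ, f, hχ, hf, hder⟩ := ht htI
      refine ⟨_, hasDerivAt_dotProduct hder hder, ?_⟩
      have h1 := (abs_le.1 (hM (y t) (y t))).2
      have h2 : 2 * (y t ⬝ᵥ f) ≤ y t ⬝ᵥ y t + f ⬝ᵥ f := by
        have := dotProduct_self_nonneg (y t - f)
        rw [sub_dotProduct, dotProduct_sub, dotProduct_sub, dotProduct_comm f (y t)] at this
        linarith
      have h3 := dotProduct_self_nonneg (y t)
      rw [dotProduct_comm, ← two_mul, dotProduct_smul, dotProduct_add, smul_eq_mul]
      have h4 : 2 * (y t ⬝ᵥ (M *ᵥ y t) + y t ⬝ᵥ f) ≤ K * (1 + y t ⬝ᵥ y t) := by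
        have : 0 ≤ F * (y t ⬝ᵥ y t) := by positivity
        rw [hK]
        nlinarith
      have h5 : 0 ≤ K * (1 + y t ⬝ᵥ y t) := by positivity
      calc 2 * (χ * (y t ⬝ᵥ (M *ᵥ y t) + y t ⬝ᵥ f))
          = χ * (2 * (y t ⬝ᵥ (M *ᵥ y t) + y t ⬝ᵥ f)) := by ring
        _ ≤ χ * (K * (1 + y t ⬝ᵥ y t)) := mul_le_mul_of_nonneg_left h4 hχ.1
        _ ≤ 1 * (K * (1 + y t ⬝ᵥ y t)) := mul_le_mul_of_nonneg_right hχ.2 h5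
        _ = _ := one_mul _)
  have h6 : Real.exp (K * (t₁ - t₀)) ≤ Real.exp (K * T) := by
    have : 0 ≤ K := by positivity
    gcongr
  have h7 := dotProduct_self_nonneg (y t₀)
  calc y t₁ ⬝ᵥ y t₁ ≤ (1 + y t₀ ⬝ᵥ y t₀) * Real.exp (K * (t₁ - t₀)) := by linarith
    _ ≤ (1 + Y) * Real.exp (K * T) :=
        mul_le_mul (by linarith) h6 (Real.exp_pos _).le (by linarith)

variable {N n : ℕ} {A : Followers N}

theorem exists_feedback_sq_le (L : Leader n) (a : Matrix (Fin (N + 1)) (Fin (N + 1)) ℝ)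
    (P : Matrix (Fin n) (Fin n) ℝ) :
    ∃ C : ℝ, 0 < C ∧ ∀ p : State A n, ∑ i, feedback L P (xvOf a p i) ^ 2 ≤ C * errSq p := by
  choose C hC h using fun i => exists_sq_le_of_linearMap
    (dotProductBilin ℝ ℝ L.d ∘ₗ P.mulVecLin ∘ₗ ∑ j, groundedLaplacian a i j •
      (LinearMap.proj j : (Fin N → Fin n → ℝ) →ₗ[ℝ] (Fin n → ℝ)))
  refine ⟨1 + ∑ i, C i, add_pos_of_pos_of_nonneg one_pos (Finset.sum_nonneg fun i _ => (hC i).le),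
    fun p => ?_⟩
  have h1 : ∑ i, feedback L P (xvOf a p i) ^ 2 ≤ ∑ i, C i * errSq p :=
    Finset.sum_le_sum fun i _ => by
      refine le_trans (le_of_eq ?_) (h i fun j => errL j p)
      simp [feedback, xvOf_ofLp, mulVec_sum, mulVec_smul, dotProduct_sum]
  rw [add_mul, Finset.sum_mul]
  have := errSq_nonneg p
  linarith

theorem xhatOf_sq_le (p : State A n) (i : Fin N) (k : Fin n) :
    xhatOf p i k ^ 2 ≤ 2 * (errSq p + (wOf p).ofLp ⬝ᵥ (wOf p).ofLp) := by
  have h1 : xhatOf p i k = errL i p k + wOf p k := by rw [errL_apply]; ring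
  have h2 := sq_le_dotProduct_self (errL i p) k
  have h3 : errL i p ⬝ᵥ errL i p ≤ errSq p :=
    Finset.single_le_sum (f := fun i => errL i p ⬝ᵥ errL i p)
      (fun i _ => dotProduct_self_nonneg _) (Finset.mem_univ i)
  have h4 := sq_le_dotProduct_self (wOf p).ofLp k
  rw [h1]
  nlinarith [sq_nonneg (errL i p k - wOf p k)]

theorem norm_le_sqrt_of_forall_sq_le {m : ℕ} (hm : m ≤ n) {y : EuclideanSpace ℝ (Fin m)} {D : ℝ}
    (hD : 0 ≤ D) (h : ∀ k, y k ^ 2 ≤ D) : ‖y‖ ≤ √(n * D) := by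
  refine Real.le_sqrt_of_sq_le ?_
  rw [EuclideanSpace.norm_sq_eq]
  calc ∑ k, ‖y k‖ ^ 2 ≤ ∑ _k : Fin m, D :=
        Finset.sum_le_sum fun k _ => by rw [Real.norm_eq_abs, sq_abs]; exact h k
    _ = m * D := by simp
    _ ≤ n * D := by gcongr

theorem norm_xOf_le (hdeg : ∀ i, A.nx i ≤ n) (p : State A n) (i : Fin N) :
    ‖xOf p i‖ ≤ √(n * (2 * (errSq p + (wOf p).ofLp ⬝ᵥ (wOf p).ofLp))) := by
  refine norm_le_sqrt_of_forall_sq_le (hdeg i)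
    (mul_nonneg two_pos.le (add_nonneg (errSq_nonneg p) (dotProduct_self_nonneg _))) fun k => ?_
  have : xOf p i k = xhatOf p i ⟨k, k.2.trans_le (hdeg i)⟩ := by simp [xhatOf, xhat]
  rw [this]
  exact xhatOf_sq_le p i _

theorem norm_xcOf_le (p : State A n) (i : Fin N) :
    ‖xcOf p i‖ ≤ √(n * (2 * (errSq p + (wOf p).ofLp ⬝ᵥ (wOf p).ofLp))) := by
  refine norm_le_sqrt_of_forall_sq_le (Nat.sub_le _ _)
    (mul_nonneg two_pos.le (add_nonneg (errSq_nonneg p) (dotProduct_self_nonneg _))) fun k => ?_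
  have : xcOf p i k = xhatOf p i ⟨A.nx i + k, by omega⟩ := by simp [xhatOf, xhat]
  rw [this]
  exact xhatOf_sq_le p i _

theorem norm_obs_sq_le (p : State A n) (i : Fin N) : ‖ξOf p i - zOf p i‖ ^ 2 ≤ obsSq p := by
  rw [norm_sq_eq_dotProduct]
  exact Finset.single_le_sum (f := fun i => obsL i p ⬝ᵥ obsL i p)
    (fun i _ => dotProduct_self_nonneg _) (Finset.mem_univ i)

theorem norm_err_sq_le (p : State A n) (i : Fin N) : ‖xhatOf p i - wOf p‖ ^ 2 ≤ errSq p := by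
  rw [norm_sq_eq_dotProduct]
  exact Finset.single_le_sum (f := fun i => errL i p ⬝ᵥ errL i p)
    (fun i _ => dotProduct_self_nonneg _) (Finset.mem_univ i)

theorem gain_sq_le (p : State A n) (i : Fin N) : θOf p i ^ 2 ≤ gainSq p :=
  Finset.single_le_sum (f := fun i => θOf p i ^ 2) (fun _ _ => sq_nonneg _) (Finset.mem_univ i)

/-- The state is bounded by the errors and gains together with `z` and `w`: the vectors `x` and
`x_c` are the two parts of `x̂ = (x̂ - w) + w`, and `ξ = (ξ - z) + z`. -/
theorem norm_state_le (hdeg : ∀ i, A.nx i ≤ n) {p : State A n} {s : ℝ}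
    (hs : errSq p + gainSq p + obsSq p ≤ s) (hz : ∀ i, (zOf p i).ofLp ⬝ᵥ (zOf p i).ofLp ≤ s)
    (hw : (wOf p).ofLp ⬝ᵥ (wOf p).ofLp ≤ s) : ‖p‖ ≤ 2 * √s + √(n * (2 * (s + s))) := by
  have he := errSq_nonneg p
  have hg := gainSq_nonneg p
  have ho := obsSq_nonneg p
  have hs0 := Real.sqrt_nonneg s
  have hs1 := Real.sqrt_nonneg (n * (2 * (s + s)))
  have hx : √(n * (2 * (errSq p + (wOf p).ofLp ⬝ᵥ (wOf p).ofLp))) ≤ √(n * (2 * (s + s))) := by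
    gcongr
    linarith
  have hzn : ∀ i, ‖zOf p i‖ ≤ √s := fun i => Real.le_sqrt_of_sq_le (by
    rw [norm_sq_eq_dotProduct]; exact hz i)
  have hB : 0 ≤ 2 * √s + √(n * (2 * (s + s))) := by positivity
  refine norm_prod_le_iff.2 ⟨(pi_norm_le_iff_of_nonneg hB).2 fun i => ?_, norm_prod_le_iff.2
    ⟨(pi_norm_le_iff_of_nonneg hB).2 fun i => ?_, norm_prod_le_iff.2
    ⟨(pi_norm_le_iff_of_nonneg hB).2 fun i => ?_, norm_prod_le_iff.2
    ⟨(pi_norm_le_iff_of_nonneg hB).2 fun i => ?_, norm_prod_le_iff.2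
    ⟨(pi_norm_le_iff_of_nonneg hB).2 fun i => ?_, ?_⟩⟩⟩⟩⟩
  · have : ‖p.1 i‖ ≤ √s := hzn i
    linarith
  · have := (norm_xOf_le hdeg p i).trans hx
    change ‖xOf p i‖ ≤ _
    linarith
  · have := (norm_xcOf_le p i).trans hx
    change ‖xcOf p i‖ ≤ _
    linarith
  · have : |θOf p i| ≤ √s := Real.abs_le_sqrt (by linarith [gain_sq_le p i])
    change |θOf p i| ≤ _
    linarith
  · have h1 : ‖ξOf p i - zOf p i‖ ≤ √s :=
      Real.le_sqrt_of_sq_le (by linarith [norm_obs_sq_le p i])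
    have h2 := norm_add_le (ξOf p i - zOf p i) (zOf p i)
    rw [sub_add_cancel] at h2
    change ‖ξOf p i‖ ≤ _
    linarith [hzn i]
  · have : ‖wOf p‖ ≤ √s := Real.le_sqrt_of_sq_le (by rw [norm_sq_eq_dotProduct]; exact hw)
    change ‖wOf p‖ ≤ _
    linarith

variable {L : Leader n} {a : Matrix (Fin (N + 1)) (Fin (N + 1)) ℝ}
  {P : Matrix (Fin n) (Fin n) ℝ} {v : ℝ → ℝ}

/-- On relaxed solutions the Lyapunov function need not decrease, but it grows at most
exponentially. -/
theorem exists_errors_le (hP : L.Admissible P) (ha : IsConnectedGraph a)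
    (hA0 : ∀ i, IsHurwitz (A.A0 i)) (hdeg : ∀ i, A.nx i ≤ n) (hx : ∀ i, 1 ≤ A.nx i)
    (hlip : ∃ M : ℝ, 0 < M ∧ ∀ i (z Δ : EuclideanSpace ℝ (Fin (A.nz i)))
      (x : EuclideanSpace ℝ (Fin (A.nx i))), |A.g i (z + Δ) x - A.g i z x| ≤ M * ‖Δ‖)
    (hvb : ∃ l : ℝ, 0 < l ∧ ∀ t, 0 ≤ t → |v t| ≤ l) (R T : ℝ) :
    ∃ B, ∀ (t₀ t₁ : ℝ) (γ : ℝ → State A n), 0 ≤ t₀ → t₀ ≤ t₁ → t₁ ≤ T →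
      (loopSystem L A a P v).IsRelaxedSolution t₀ t₁ γ → ‖γ t₀‖ ≤ R →
      errSq (γ t₁) + gainSq (γ t₁) + obsSq (γ t₁) ≤ B := by
  obtain ⟨l, -, hl⟩ := hvb
  obtain ⟨V, b, m, c, hV, hb, hc, hcoer, hdec⟩ :=
    exists_lyapunov_closedLoop hP ha hA0 hdeg hx hlip l
  obtain ⟨C, hC, hfb⟩ := exists_feedback_sq_le (A := A) L a P
  obtain ⟨B₀, hB₀⟩ := (isCompact_closedBall (0 : State A n) R).bddAbove_image
    (f := fun p => m + V p) (continuous_const.add hV.continuous).continuousOn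
  set K := 2 * (1 + C) / b with hK
  have hK0 : 0 < K := by positivity
  refine ⟨(1 + B₀) * Real.exp (K * T) / b, fun t₀ t₁ γ h0 h01 h1T hγ hR => ?_⟩
  have hcd : ContDiff ℝ 1 fun p => m + V p := contDiff_const.add hV
  have h := one_add_le_mul_exp_of_ae_deriv_le (C := K) h01
    (absolutelyContinuousOnInterval_contDiff_comp hγ.1 hcd) (by
      filter_upwards [hγ.2] with t ht htI
      obtain ⟨χ, σ, hχ, hσ, hder⟩ := ht htI
      rw [loopSystem_rhs] at hder
      have h1 := ((hV.differentiable one_ne_zero (γ t)).hasFDerivAt.comp_hasDerivAt t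
        hder).const_add m
      refine ⟨_, h1, ?_⟩
      rw [map_smul, smul_eq_mul]
      set p := γ t
      have h2 := hdec p σ (v t) (hl t (h0.trans htI.1))
      have h3 : ∑ i, θOf p i * (|feedback L P (xvOf a p i)| - σ i * feedback L P (xvOf a p i)) ≤
          gainSq p + ∑ i, feedback L P (xvOf a p i) ^ 2 := by
        rw [gainSq, ← Finset.sum_add_distrib]
        refine Finset.sum_le_sum fun i _ => ?_
        set φ := feedback L P (xvOf a p i)
        have e1 : |(|φ| - σ i * φ)| ≤ 2 * |φ| := by
          have := abs_sub |φ| (σ i * φ)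
          rw [abs_abs, abs_mul] at this
          nlinarith [hσ i, abs_nonneg φ]
        calc θOf p i * (|φ| - σ i * φ) ≤ |θOf p i| * (2 * |φ|) := by
              refine (le_abs_self _).trans ?_
              rw [abs_mul]
              gcongr
          _ ≤ θOf p i ^ 2 + φ ^ 2 := by
              nlinarith [sq_nonneg (|θOf p i| - |φ|), sq_abs (θOf p i), sq_abs φ]
      have h4 := hfb p
      have h5 := hcoer p
      have he := errSq_nonneg p
      have hg := gainSq_nonneg p
      have ho := obsSq_nonneg p
      have h6 : fderiv ℝ V p (closedLoopWith L A a P σ (v t) p) ≤ K * (1 + (m + V p)) := by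
        have e1 : K * b = 2 * (1 + C) := by rw [hK]; field_simp
        have e2 := mul_le_mul_of_nonneg_left h5 hK0.le
        rw [← mul_assoc, e1] at e2
        nlinarith [mul_nonneg hC.le hg, mul_nonneg hC.le ho, mul_nonneg hc.le he]
      have h7 : 0 ≤ K * (1 + (m + V p)) := by
        have : 0 ≤ b * (errSq p + gainSq p + obsSq p) := by positivity
        have : 0 ≤ 1 + (m + V p) := by linarith
        positivity
      calc _ ≤ χ * (K * (1 + (m + V p))) := mul_le_mul_of_nonneg_left h6 hχ.1
        _ ≤ 1 * (K * (1 + (m + V p))) := mul_le_mul_of_nonneg_right hχ.2 h7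
        _ = _ := one_mul _)
  have hB := hB₀ ⟨γ t₀, mem_closedBall_zero_iff.2 hR, rfl⟩
  have h0' : 0 ≤ 1 + (m + V (γ t₀)) := by
    have h5 := hcoer (γ t₀)
    have he := errSq_nonneg (γ t₀)
    have hg := gainSq_nonneg (γ t₀)
    have ho := obsSq_nonneg (γ t₀)
    have : 0 ≤ b * (errSq (γ t₀) + gainSq (γ t₀) + obsSq (γ t₀)) := by positivity
    linarith
  have h6 : Real.exp (K * (t₁ - t₀)) ≤ Real.exp (K * T) := by
    gcongr
    linarith
  rw [le_div_iff₀ hb, mul_comm]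
  calc _ ≤ (1 + (m + V (γ t₀))) * Real.exp (K * (t₁ - t₀)) := by linarith [hcoer (γ t₁)]
    _ ≤ (1 + B₀) * Real.exp (K * T) :=
        mul_le_mul (add_le_add_right hB 1) h6 (Real.exp_pos _).le (by simp only [] at hB; linarith)

theorem exists_leader_le (hvb : ∃ l : ℝ, 0 < l ∧ ∀ t, 0 ≤ t → |v t| ≤ l) (R T : ℝ) :
    ∃ B, ∀ (t₀ t₁ : ℝ) (γ : ℝ → State A n), 0 ≤ t₀ → t₀ ≤ t₁ → t₁ ≤ T →
      (loopSystem L A a P v).IsRelaxedSolution t₀ t₁ γ → ‖γ t₀‖ ≤ R →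
      (wOf (γ t₁)).ofLp ⬝ᵥ (wOf (γ t₁)).ofLp ≤ B := by
  obtain ⟨l, hl0, hl⟩ := hvb
  obtain ⟨B, hB⟩ := exists_dotProduct_self_le_of_affine_growth L.S (F := l ^ 2 * (L.d ⬝ᵥ L.d))
    (T := T) (Y := R ^ 2) (mul_nonneg (sq_nonneg l) (dotProduct_self_nonneg _))
  set wf : State A n →ₗ[ℝ] (Fin n → ℝ) :=
    (WithLp.linearEquiv 2 ℝ (Fin n → ℝ)).toLinearMap ∘ₗ wL with hwf
  refine ⟨B, fun t₀ t₁ γ h0 h01 h1T hγ hR => hB t₀ t₁ (fun t => wf (γ t)) h01 (by linarith)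
    (absolutelyContinuousOnInterval_contDiff_comp hγ.1 (contDiff_of_linearMap wf)) ?_ ?_⟩
  · filter_upwards [hγ.2] with t ht htI
    obtain ⟨χ, σ, hχ, hσ, hder⟩ := ht htI
    rw [loopSystem_rhs] at hder
    refine ⟨χ, v t • L.d, hχ, ?_, ?_⟩
    · rw [smul_dotProduct, dotProduct_smul, smul_eq_mul, smul_eq_mul, ← mul_assoc, ← sq]
      have := hl t (h0.trans htI.1)
      have h2 : v t ^ 2 ≤ l ^ 2 := sq_le_sq' (abs_le.1 this).1 (abs_le.1 this).2
      exact mul_le_mul_of_nonneg_right h2 (dotProduct_self_nonneg _)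
    · have := hasDerivAt_linearMap_comp wf hder
      rw [map_smul] at this
      exact this
  · have h1 : ‖wOf (γ t₀)‖ ≤ R := by
      refine le_trans ?_ hR
      exact ((norm_snd_le _).trans (norm_snd_le _)).trans ((norm_snd_le _).trans
        ((norm_snd_le _).trans (norm_snd_le _)))
    change (wOf (γ t₀)).ofLp ⬝ᵥ (wOf (γ t₀)).ofLp ≤ _
    rw [← norm_sq_eq_dotProduct]
    gcongr

/-- Once `x` is bounded, `ż = A⁰ z + f(x)` is a linear equation with bounded forcing. -/
theorem exists_internal_le (hf : ∀ i, ContDiff ℝ (⊤ : ℕ∞) (A.f i)) (hdeg : ∀ i, A.nx i ≤ n)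
    (i : Fin N) (R T s : ℝ) :
    ∃ B, ∀ (t₀ t₁ : ℝ) (γ : ℝ → State A n), 0 ≤ t₀ → t₀ ≤ t₁ → t₁ ≤ T →
      (loopSystem L A a P v).IsRelaxedSolution t₀ t₁ γ → ‖γ t₀‖ ≤ R →
      (∀ t ∈ Icc t₀ t₁, errSq (γ t) + (wOf (γ t)).ofLp ⬝ᵥ (wOf (γ t)).ofLp ≤ s) →
      (zOf (γ t₁) i).ofLp ⬝ᵥ (zOf (γ t₁) i).ofLp ≤ B := by
  obtain ⟨F, hF⟩ := (isCompact_closedBall (0 : EuclideanSpace ℝ (Fin (A.nx i)))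
    √(n * (2 * s))).bddAbove_image (f := fun x => ‖A.f i x‖ ^ 2)
    (((hf i).continuous.norm.pow 2).continuousOn)
  have hF0 : 0 ≤ F := (sq_nonneg _).trans
    (hF ⟨0, mem_closedBall_zero_iff.2 (by rw [norm_zero]; exact Real.sqrt_nonneg _), rfl⟩)
  obtain ⟨B, hB⟩ := exists_dotProduct_self_le_of_affine_growth (A.A0 i) (F := F)
    (T := T) (Y := R ^ 2) hF0
  refine ⟨B, fun t₀ t₁ γ h0 h01 h1T hγ hR hs => hB t₀ t₁ (fun t => zL i (γ t)) h01 (by linarith)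
    (absolutelyContinuousOnInterval_contDiff_comp hγ.1 (contDiff_of_linearMap (zL i))) ?_ ?_⟩
  · filter_upwards [hγ.2] with t ht htI
    obtain ⟨χ, σ, hχ, hσ, hder⟩ := ht htI
    rw [loopSystem_rhs] at hder
    refine ⟨χ, (A.f i (xOf (γ t) i)).ofLp, hχ, ?_, ?_⟩
    · rw [← norm_sq_eq_dotProduct]
      refine hF ⟨_, mem_closedBall_zero_iff.2 ((norm_xOf_le hdeg (γ t) i).trans ?_), rfl⟩
      have := hs t htI
      gcongr
    · have := hasDerivAt_linearMap_comp (zL i) hder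
      rw [map_smul] at this
      exact this
  · have h1 : ‖zOf (γ t₀) i‖ ≤ R := ((norm_le_pi_norm _ i).trans (norm_fst_le _)).trans hR
    change (zOf (γ t₀) i).ofLp ⬝ᵥ (zOf (γ t₀) i).ofLp ≤ _
    rw [← norm_sq_eq_dotProduct]
    gcongr

theorem loopSystem_hasAprioriBound (hP : L.Admissible P) (ha : IsConnectedGraph a)
    (hA0 : ∀ i, IsHurwitz (A.A0 i)) (hf : ∀ i, ContDiff ℝ (⊤ : ℕ∞) (A.f i))
    (hdeg : ∀ i, A.nx i ≤ n) (hx : ∀ i, 1 ≤ A.nx i)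
    (hlip : ∃ M : ℝ, 0 < M ∧ ∀ i (z Δ : EuclideanSpace ℝ (Fin (A.nz i)))
      (x : EuclideanSpace ℝ (Fin (A.nx i))), |A.g i (z + Δ) x - A.g i z x| ≤ M * ‖Δ‖)
    (hvb : ∃ l : ℝ, 0 < l ∧ ∀ t, 0 ≤ t → |v t| ≤ l) :
    (loopSystem L A a P v).HasAprioriBound := by
  intro R T
  obtain ⟨B₁, h₁⟩ := exists_errors_le hP ha hA0 hdeg hx hlip hvb R T
  obtain ⟨B₂, h₂⟩ := exists_leader_le (A := A) (L := L) (a := a) (P := P) hvb R T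
  choose B₃ h₃ using fun i => exists_internal_le (L := L) (a := a) (P := P) (v := v) hf hdeg i R T
    (B₁ + B₂)
  obtain ⟨B₄, hB₄⟩ : ∃ B₄, ∀ i, B₃ i ≤ B₄ := by
    obtain ⟨B, hB⟩ := (finite_range B₃).bddAbove
    exact ⟨B, fun i => hB (mem_range_self i)⟩
  set s := max B₁ (max B₂ B₄)
  refine ⟨_, fun t₀ t₁ γ h0 h01 h1T hγ hR => norm_state_le (s := s) hdeg
    ((h₁ t₀ t₁ γ h0 h01 h1T hγ hR).trans (le_max_left _ _)) (fun i => ?_)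
    ((h₂ t₀ t₁ γ h0 h01 h1T hγ hR).trans ((le_max_left _ _).trans (le_max_right _ _)))⟩
  refine (h₃ i t₀ t₁ γ h0 h01 h1T hγ hR fun t ht => ?_).trans
    ((hB₄ i).trans ((le_max_right _ _).trans (le_max_right _ _)))
  have hγt := hγ.mono le_rfl ht.1 ht.2
  have e1 := h₁ t₀ t γ h0 ht.1 (ht.2.trans h1T) hγt hR
  have e2 := h₂ t₀ t γ h0 ht.1 (ht.2.trans h1T) hγt hR
  have hg := gainSq_nonneg (γ t)
  have ho := obsSq_nonneg (γ t)
  linarith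

end AprioriBound

/-! ### Convergence -/

section Convergence

theorem abs_dotProduct_le {m : Type*} [Fintype m] (x y : m → ℝ) :
    |x ⬝ᵥ y| ≤ x ⬝ᵥ x + y ⬝ᵥ y := by
  have h1 := dotProduct_self_nonneg (x - y)
  have h2 := dotProduct_self_nonneg (x + y)
  have hx := dotProduct_self_nonneg x
  have hy := dotProduct_self_nonneg y
  rw [sub_dotProduct, dotProduct_sub, dotProduct_sub, dotProduct_comm y x] at h1
  rw [add_dotProduct, dotProduct_add, dotProduct_add, dotProduct_comm y x] at h2
  exact abs_le.2 ⟨by linarith, by linarith⟩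

theorem SwitchedSystem.IsSolution.mono {E ι : Type*} [NormedAddCommGroup E] [NormedSpace ℝ E]
    [Fintype ι] {Q : SwitchedSystem E ι} {a b c d : ℝ} {γ : ℝ → E} (h : Q.IsSolution a b γ)
    (hca : a ≤ c) (hcd : c ≤ d) (hdb : d ≤ b) : Q.IsSolution c d γ :=
  ⟨absolutelyContinuousOnInterval_mono_Icc hca hcd hdb h.1, ae_mem_Icc_mono hca hdb h.2⟩

variable {N n : ℕ} {A : Followers N} {L : Leader n} {a : Matrix (Fin (N + 1)) (Fin (N + 1)) ℝ}
  {P : Matrix (Fin n) (Fin n) ℝ} {v : ℝ → ℝ}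

theorem dotProduct_errL_self_le (p : State A n) (i : Fin N) : errL i p ⬝ᵥ errL i p ≤ errSq p :=
  Finset.single_le_sum (f := fun i => errL i p ⬝ᵥ errL i p)
    (fun _ _ => dotProduct_self_nonneg _) (Finset.mem_univ i)

/-- The speed of the synchronization errors is bounded in terms of the errors and gains alone,
although the state of the leader may be unbounded. -/
theorem exists_errSq_deriv_le (hdeg : ∀ i, A.nx i ≤ n) (hx : ∀ i, 1 ≤ A.nx i)
    (hlip : ∃ M : ℝ, 0 < M ∧ ∀ i (z Δ : EuclideanSpace ℝ (Fin (A.nz i)))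
      (x : EuclideanSpace ℝ (Fin (A.nx i))), |A.g i (z + Δ) x - A.g i z x| ≤ M * ‖Δ‖) (l s : ℝ) :
    ∃ K : ℝ, ∀ (p : State A n) (σ : Fin N → ℝ) (r : ℝ), (∀ i, |σ i| ≤ 1) → |r| ≤ l →
      errSq p + gainSq p + obsSq p ≤ s →
      ‖∑ i, 2 * (errL i p ⬝ᵥ errL i (closedLoopWith L A a P σ r p))‖ ≤ K := by
  obtain ⟨M, hM, hlip⟩ := hlip
  obtain ⟨C₁, hC₁, hS⟩ := exists_abs_bilin_le L.S
  obtain ⟨C₂, hC₂, hfb⟩ := exists_feedback_sq_le (A := A) L a P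
  set e : Fin N → Fin n → ℝ := fun i k => if (k : ℕ) + 1 = A.nx i then 1 else 0 with he
  refine ⟨∑ i, 2 * (C₁ * (s + s) + (s + C₂ * s + (1 + s) + l) * (s + L.d ⬝ᵥ L.d) +
    M * (1 + s) * (s + e i ⬝ᵥ e i)), fun p σ r hσ hr hs => ?_⟩
  have h1 := errSq_nonneg p
  have h2 := gainSq_nonneg p
  have h3 := obsSq_nonneg p
  rw [Real.norm_eq_abs]
  refine (Finset.abs_sum_le_sum_abs _ _).trans (Finset.sum_le_sum fun i _ => ?_)
  have h4 : errL i (closedLoopWith L A a P σ r p) = L.S *ᵥ errL i p -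
      (θOf p i * feedback L P (xvOf a p i) + θOf p i * σ i + r) • L.d +
      (A.g i (zOf p i) (xOf p i) - A.g i (ξOf p i) (xOf p i)) • e i := by
    ext k
    rw [errL_closedLoopWith L a P hdeg hx]
    simp only [he, Pi.add_apply, Pi.sub_apply, Pi.smul_apply, smul_eq_mul]
  have hη := dotProduct_errL_self_le p i
  have hθ := gain_sq_le p i
  have hφ : feedback L P (xvOf a p i) ^ 2 ≤ C₂ * s := by
    have := Finset.single_le_sum (f := fun i => feedback L P (xvOf a p i) ^ 2)
      (fun _ _ => sq_nonneg _) (Finset.mem_univ i)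
    exact (this.trans (hfb p)).trans (by gcongr; linarith)
  have hδ : |A.g i (zOf p i) (xOf p i) - A.g i (ξOf p i) (xOf p i)| ≤ M * (1 + s) := by
    have h5 := hlip i (zOf p i) (ξOf p i - zOf p i) (xOf p i)
    rw [add_sub_cancel] at h5
    rw [abs_sub_comm]
    refine h5.trans ?_
    have h6 := norm_obs_sq_le p i
    gcongr
    nlinarith [sq_nonneg (‖ξOf p i - zOf p i‖ - 1)]
  have hu : |θOf p i * feedback L P (xvOf a p i) + θOf p i * σ i + r| ≤
      s + C₂ * s + (1 + s) + l := by
    have e1 : |θOf p i * feedback L P (xvOf a p i)| ≤ s + C₂ * s := by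
      rw [abs_mul]
      nlinarith [sq_nonneg (|θOf p i| - |feedback L P (xvOf a p i)|), sq_abs (θOf p i),
        sq_abs (feedback L P (xvOf a p i))]
    have e2 : |θOf p i * σ i| ≤ 1 + s := by
      rw [abs_mul]
      nlinarith [sq_nonneg (|θOf p i| - 1), sq_abs (θOf p i), hσ i, abs_nonneg (θOf p i)]
    exact (abs_add_le _ _).trans (add_le_add ((abs_add_le _ _).trans (add_le_add e1 e2)) hr)
  rw [abs_mul, abs_two, h4, dotProduct_add, dotProduct_sub, dotProduct_smul, dotProduct_smul,
    smul_eq_mul, smul_eq_mul]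
  have hs0 : errL i p ⬝ᵥ errL i p ≤ s := by linarith
  have t1 : |errL i p ⬝ᵥ (L.S *ᵥ errL i p)| ≤ C₁ * (s + s) := (hS _ _).trans (by gcongr)
  have t2 : |(θOf p i * feedback L P (xvOf a p i) + θOf p i * σ i + r) * (errL i p ⬝ᵥ L.d)| ≤
      (s + C₂ * s + (1 + s) + l) * (s + L.d ⬝ᵥ L.d) := by
    rw [abs_mul]
    exact mul_le_mul hu ((abs_dotProduct_le _ _).trans (by gcongr)) (abs_nonneg _)
      ((abs_nonneg _).trans hu)
  have t3 : |(A.g i (zOf p i) (xOf p i) - A.g i (ξOf p i) (xOf p i)) * (errL i p ⬝ᵥ e i)| ≤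
      M * (1 + s) * (s + e i ⬝ᵥ e i) := by
    rw [abs_mul]
    exact mul_le_mul hδ ((abs_dotProduct_le _ _).trans (by gcongr)) (abs_nonneg _)
      ((abs_nonneg _).trans hδ)
  have t4 := abs_add_le (errL i p ⬝ᵥ (L.S *ᵥ errL i p) -
    (θOf p i * feedback L P (xvOf a p i) + θOf p i * σ i + r) * (errL i p ⬝ᵥ L.d))
    ((A.g i (zOf p i) (xOf p i) - A.g i (ξOf p i) (xOf p i)) * (errL i p ⬝ᵥ e i))
  have t5 := abs_sub (errL i p ⬝ᵥ (L.S *ᵥ errL i p))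
    ((θOf p i * feedback L P (xvOf a p i) + θOf p i * σ i + r) * (errL i p ⬝ᵥ L.d))
  linarith

theorem hasDerivAt_errSq {γ : ℝ → State A n} {q : State A n} {t : ℝ} (h : HasDerivAt γ q t) :
    HasDerivAt (fun s => errSq (γ s)) (∑ i, 2 * (errL i (γ t) ⬝ᵥ errL i q)) t := by
  unfold errSq
  refine HasDerivAt.fun_sum fun i _ => ?_
  have h1 := hasDerivAt_linearMap_comp (errL i) h
  have h2 := hasDerivAt_dotProduct h1 h1
  rwa [dotProduct_comm (errL i q), ← two_mul] at h2

theorem contDiff_errSq : ContDiff ℝ 1 (errSq (A := A) (n := n)) := by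
  have h1 : ∀ i k, ContDiff ℝ 1 fun p : State A n => errL i p k := fun i k =>
    contDiff_pi.1 (contDiff_of_linearMap (errL i)) k
  unfold errSq dotProduct
  fun_prop

/-- Along solutions the Lyapunov function decreases, so the errors and gains are bounded; its
dissipation rate is Lipschitz and therefore tends to zero. -/
theorem exists_bound_and_tendsto_errSq (hP : L.Admissible P) (ha : IsConnectedGraph a)
    (hA0 : ∀ i, IsHurwitz (A.A0 i)) (hdeg : ∀ i, A.nx i ≤ n) (hx : ∀ i, 1 ≤ A.nx i)
    (hlip : ∃ M : ℝ, 0 < M ∧ ∀ i (z Δ : EuclideanSpace ℝ (Fin (A.nz i)))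
      (x : EuclideanSpace ℝ (Fin (A.nx i))), |A.g i (z + Δ) x - A.g i z x| ≤ M * ‖Δ‖)
    (hvb : ∃ l : ℝ, 0 < l ∧ ∀ t, 0 ≤ t → |v t| ≤ l) {γ : ℝ → State A n}
    (hγ : ∀ τ, 0 < τ → (loopSystem L A a P v).IsSolution 0 τ γ) :
    (∃ s, ∀ t, 0 ≤ t → errSq (γ t) + gainSq (γ t) + obsSq (γ t) ≤ s) ∧
      Tendsto (fun t => errSq (γ t)) atTop (𝓝 0) := by
  obtain ⟨l, -, hl⟩ := hvb
  obtain ⟨V, b, m, c, hV, hb, hc, hcoer, hdec⟩ :=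
    exists_lyapunov_closedLoop hP ha hA0 hdeg hx hlip l
  have hac : ∀ τ, 0 < τ → AbsolutelyContinuousOnInterval (fun t => V (γ t)) 0 τ := fun τ hτ =>
    absolutelyContinuousOnInterval_contDiff_comp (hγ τ hτ).1 hV
  have hd : ∀ τ, 0 < τ → ∀ᵐ t : ℝ, t ∈ Icc 0 τ →
      ∃ V', HasDerivAt (fun t => V (γ t)) V' t ∧ V' ≤ -c * errSq (γ t) := by
    intro τ hτ
    filter_upwards [(hγ τ hτ).2] with t ht htI
    obtain ⟨_, ⟨σ, hσ, rfl⟩, hder⟩ := ht htI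
    rw [loopSystem_rhs] at hder
    refine ⟨_, (hV.differentiable one_ne_zero (γ t)).hasFDerivAt.comp_hasDerivAt t hder, ?_⟩
    refine (hdec (γ t) σ (v t) (hl t htI.1)).trans_eq ?_
    rw [add_eq_left, mul_eq_zero]
    refine Or.inr (Finset.sum_eq_zero fun i _ => ?_)
    have := (hσ i).2
    rw [loopSystem_switch] at this
    rw [this, sub_self, mul_zero]
  have hbd : ∀ t, 0 ≤ t → errSq (γ t) + gainSq (γ t) + obsSq (γ t) ≤ (m + V (γ 0)) / b := by
    intro t ht
    rw [le_div_iff₀ hb, mul_comm]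
    refine (hcoer (γ t)).trans ?_
    rcases ht.eq_or_lt with rfl | ht
    · exact le_rfl
    · have := sub_le_mul_of_ae_deriv_le (K := 0) ht.le (hac t ht) (by
        filter_upwards [hd t ht] with r hr hrI
        obtain ⟨V', h1, h2⟩ := hr hrI
        exact ⟨V', h1, h2.trans (by nlinarith [errSq_nonneg (γ r)])⟩)
      linarith
  refine ⟨⟨_, hbd⟩, ?_⟩
  obtain ⟨K, hK⟩ := exists_errSq_deriv_le (L := L) (a := a) (P := P) hdeg hx hlip l
    ((m + V (γ 0)) / b)
  have hK0 : 0 ≤ K := (norm_nonneg _).trans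
    (hK (γ 0) 0 (v 0) (by simp) (hl 0 le_rfl) (hbd 0 le_rfl))
  refine tendsto_zero_of_lipschitz_of_dissipation hc hK0 (fun t _ => errSq_nonneg _)
    (fun s t hs hst => ?_) (m := -m) (fun t _ => ?_) hac hd
  · have hsol := (hγ (t + 1) (by linarith)).mono hs hst (by linarith)
    refine norm_sub_le_of_ae_norm_deriv_le hst
      (absolutelyContinuousOnInterval_contDiff_comp hsol.1 contDiff_errSq) ?_
    filter_upwards [hsol.2] with r hr hrI
    obtain ⟨_, ⟨σ, hσ, rfl⟩, hder⟩ := hr hrI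
    rw [loopSystem_rhs] at hder
    have hr0 := hs.trans hrI.1
    exact ⟨_, hasDerivAt_errSq hder, hK (γ r) σ (v r) (fun i => (hσ i).1) (hl r hr0) (hbd r hr0)⟩
  · have h0 : 0 ≤ b * (errSq (γ t) + gainSq (γ t) + obsSq (γ t)) := by
      have h1 := errSq_nonneg (γ t)
      have h2 := gainSq_nonneg (γ t)
      have h3 := obsSq_nonneg (γ t)
      positivity
    linarith [hcoer (γ t)]

theorem monotoneOn_gain {γ : ℝ → State A n}
    (hγ : ∀ τ, 0 < τ → (loopSystem L A a P v).IsSolution 0 τ γ) (i : Fin N) :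
    MonotoneOn (fun t => θOf (γ t) i) (Ici 0) := by
  intro s hs t _ hst
  have hs : 0 ≤ s := hs
  have hsol := (hγ (t + 1) (by linarith)).mono hs hst (by linarith)
  have := sub_le_mul_of_ae_deriv_le (K := 0) hst
    (absolutelyContinuousOnInterval_contDiff_comp hsol.1 (contDiff_θOf i).neg) (by
      filter_upwards [hsol.2] with r hr hrI
      obtain ⟨_, ⟨σ, hσ, rfl⟩, hder⟩ := hr hrI
      rw [loopSystem_rhs] at hder
      refine ⟨_, (hasDerivAt_linearMap_comp (gainL i) hder).neg, neg_nonpos.2 ?_⟩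
      change 0 ≤ feedback L P (xvOf a (γ r) i) ^ 2 + |feedback L P (xvOf a (γ r) i)|
      positivity)
  simp only at this ⊢
  linarith

theorem exists_tendsto_of_monotoneOn_of_bounded {f : ℝ → ℝ} (hf : MonotoneOn f (Ici 0)) {B : ℝ}
    (hB : ∀ t, 0 ≤ t → |f t| ≤ B) : ∃ y, Tendsto f atTop (𝓝 y) := by
  have hmono : Monotone fun t => f (max t 0) := fun s t hst =>
    hf (le_max_right s 0) (le_max_right t 0) (max_le_max_right 0 hst)
  refine ⟨_, (tendsto_atTop_ciSup hmono ⟨B, ?_⟩).congr' ?_⟩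
  · rintro _ ⟨t, rfl⟩
    exact (abs_le.1 (hB _ (le_max_right t 0))).2
  · filter_upwards [eventually_ge_atTop 0] with t ht
    rw [max_eq_left ht]

theorem tendsto_trackingError [NeZero n] (hx : ∀ i, 1 ≤ A.nx i) {γ : ℝ → State A n}
    (h : Tendsto (fun t => errSq (γ t)) atTop (𝓝 0)) (i : Fin N) :
    Tendsto (fun t => trackingError hx (γ t) i) atTop (𝓝 0) := by
  have h1 : Tendsto (fun t => √(errSq (γ t))) atTop (𝓝 0) := by
    have := (Real.continuous_sqrt.tendsto 0).comp h
    rwa [Real.sqrt_zero] at this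
  refine squeeze_zero_norm (fun t => ?_) h1
  have h2 : trackingError hx (γ t) i = errL i (γ t) 0 := by
    have h0 : 0 < A.nx i := hx i
    rw [errL_apply, trackingError]
    simp [xhatOf, xhat, h0]
  rw [h2, Real.norm_eq_abs]
  exact Real.abs_le_sqrt ((sq_le_dotProduct_self _ 0).trans (dotProduct_errL_self_le _ i))

end Convergence

end Coord

open Coord in
theorem theorem3 {N n : ℕ} [NeZero n] (L : Leader n) (A : Followers N)
    (a : Matrix (Fin (N + 1)) (Fin (N + 1)) ℝ)
    -- the class of followers: `A⁰` Hurwitz, `f` and `g` smooth, at least one integrator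
    (hA0 : ∀ i, IsHurwitz (A.A0 i))
    (hf : ∀ i, ContDiff ℝ (⊤ : ℕ∞) (A.f i))
    (hg : ∀ i, ContDiff ℝ (⊤ : ℕ∞) (fun q : EuclideanSpace ℝ (Fin (A.nz i)) ×
      EuclideanSpace ℝ (Fin (A.nx i)) => A.g i q.1 q.2))
    (hx : ∀ i, 1 ≤ A.nx i)
    -- connected communication graph
    (hgraph : IsConnectedGraph a)
    -- relative degrees do not exceed that of the leader
    (hdeg : ∀ i, A.nx i ≤ n)
    -- Lipschitz property of `g` in its first argument
    (hlip : ∃ M : ℝ, 0 < M ∧ ∀ i (z Δ : EuclideanSpace ℝ (Fin (A.nz i)))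
      (x : EuclideanSpace ℝ (Fin (A.nx i))), |A.g i (z + Δ) x - A.g i z x| ≤ M * ‖Δ‖) :
    -- an admissible gain matrix exists, and it depends on the leader's `S` and `d` only
    (L.dLast ≠ 0 → ∃ P, L.Admissible P) ∧
    -- every admissible gain matrix works, for every bounded continuous leader input
    ∀ P, L.Admissible P →
      ∀ v : ℝ → ℝ, ContinuousOn v (Set.Ici 0) → (∃ l : ℝ, 0 < l ∧ ∀ t, 0 ≤ t → |v t| ≤ l) →
        -- from each initial state there is a Filippov solution on `[0, ∞)`
        (∀ p₀ : State A n, ∃ γ : ℝ → State A n, γ 0 = p₀ ∧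
          IsGlobalFilippovSolution (closedLoop L A a P v) γ) ∧
        -- there is no finite escape: each Filippov solution extends to `[0, ∞)`
        (∀ (T : ℝ) (γ : ℝ → State A n), 0 < T →
          IsFilippovSolutionUpTo (closedLoop L A a P v) T γ →
          ∃ γ' : ℝ → State A n, IsGlobalFilippovSolution (closedLoop L A a P v) γ' ∧
            Set.EqOn γ' γ (Set.Ico 0 T)) ∧
        -- all Filippov solutions have bounded errors and gains, vanishing tracking errors
        -- and convergent gains
        (∀ γ : ℝ → State A n, IsGlobalFilippovSolution (closedLoop L A a P v) γ →
          (∃ B : ℝ, ∀ t, 0 ≤ t → ∀ i,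
            ‖xhatOf (γ t) i - wOf (γ t)‖ ≤ B ∧ ‖ξOf (γ t) i - zOf (γ t) i‖ ≤ B ∧
              |θOf (γ t) i| ≤ B) ∧
          (∀ i, Filter.Tendsto (fun t => trackingError hx (γ t) i) Filter.atTop (nhds 0)) ∧
          ∀ i, ∃ θlim : ℝ, Filter.Tendsto (fun t => θOf (γ t) i) Filter.atTop (nhds θlim)) := by
  refine ⟨L.exists_admissible, fun P hP v hv hvb => ?_⟩
  have hreg := loopSystem_isRegular L a P hf hg hgraph hP.1 hdeg hv hvb
  have hbound := loopSystem_hasAprioriBound hP hgraph hA0 hf hdeg hx hlip hvb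
  simp only [IsGlobalFilippovSolution, IsFilippovSolutionUpTo, ← loopSystem_field,
    hreg.isFilippovSolution_iff]
  refine ⟨fun p₀ => ?_, fun T γ hT hγ => hreg.exists_extension hbound hT hγ, fun γ hγ => ?_⟩
  · obtain ⟨γ, h0, hγ⟩ := hreg.exists_isSolution hbound le_rfl p₀
    exact ⟨γ, h0, fun τ hτ => (hγ τ hτ).1⟩
  · obtain ⟨⟨s, hs⟩, hlim⟩ :=
      exists_bound_and_tendsto_errSq hP hgraph hA0 hdeg hx hlip hvb hγ
    have hB : ∀ t, 0 ≤ t → ∀ i, ‖xhatOf (γ t) i - wOf (γ t)‖ ≤ √s ∧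
        ‖ξOf (γ t) i - zOf (γ t) i‖ ≤ √s ∧ |θOf (γ t) i| ≤ √s := fun t ht i => by
      have h1 := errSq_nonneg (γ t)
      have h2 := gainSq_nonneg (γ t)
      have h3 := obsSq_nonneg (γ t)
      have h4 := hs t ht
      exact ⟨Real.le_sqrt_of_sq_le ((norm_err_sq_le _ i).trans (by linarith)),
        Real.le_sqrt_of_sq_le ((norm_obs_sq_le _ i).trans (by linarith)),
        Real.abs_le_sqrt ((gain_sq_le _ i).trans (by linarith))⟩
    exact ⟨⟨√s, hB⟩, tendsto_trackingError hx hlim, fun i =>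
      exists_tendsto_of_monotoneOn_of_bounded (monotoneOn_gain hγ i) fun t ht => (hB t ht i).2.2⟩
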